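/- Let $K$ be a field and write $[n]=\{1,\dots,n\}$. **Signed ordered partitions.** A signed ordered partition of $[n]$ ($n\ge 0$) is a table with $n$ columns (numbered from left to right) and $k$ nonempty rows (numbered from bottom to top) with exactly one dot in each column, carrying a sign $+$ or $-$; we write $|\lambda|=n$ for its size, and its signature $\varepsilon(\lambda)\in\{+,-\}^n$ lists the signs by column. (The rows are the parts, in order, of an ordered partition of $[n]$, and every element of $[n]$ is signed.) Restricting to a set of columns or of rows means keeping the dots lying in them and deleting the empty columns and rows. For $\lambda$ of size $n$ and $\lambda'$ of size $n'$, the shifted shuffle $\lambda\,\mathbin{\overline{\sqcup\!\sqcup}}\,\lambda'$ is the set of signed ordered partitions of $[n+n']$ whose restriction to the first $n$ columns is $\lambda$ and to the last $n'$ columns is $\lambda'$. If $\lambda,\lambda'$ have $k$ and $k'$ rows, the convolution $\lambda\star\lambda'$ is the set of signed ordered partitions with $k+k'$ rows whose restriction to the first $k$ rows is $\lambda$ and to the last $k'$ rows is $\lambda'$. Let $\mathrm{OrdPart}_\pm$ be the Hopf algebra with basis $(\mathbb F_\lambda)_\lambda$ indexed by all signed ordered partitions, with $$\mathbb F_\lambda\cdot\mathbb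 F_{\lambda'}=\sum_{\mu\in\lambda\mathbin{\overline{\sqcup\!\sqcup}}\lambda'}\mathbb F_\mu,\qquad \Delta\,\mathbb F_\mu=\sum_{\mu\in\lambda\star\lambda'}\mathbb F_\lambda\otimes\mathbb F_{\lambda'},$$ unit $\mathbb F_\varnothing$, and counit $\mathbb F_\lambda\mapsto 1$ if $\lambda=\varnothing$ and $0$ otherwise. **Schröder-Cambrian trees.** Let $\varepsilon\in\{+,-\}^n$. For $X\subseteq[n]$ let $X^{\pm}$ be the set of $x\in X$ with $\varepsilon_x=\pm$; an $X$ of cardinality $m$ cuts $[n]\setminus X$ into $m+1$ (possibly empty) intervals. A Schröder $\varepsilon$-Cambrian tree is a directed tree with a labeling $p$ of its vertices by nonempty sets forming a partition of $[n]$, such that each vertex $v$ has one incoming (resp. outgoing) subtree $T^v_I$ for each of the intervals $I$ cut by $p(v)^-$ (resp. by $p(v)^+$), and all labels of $T^v_I$ are subsets of $I$. Here $T^v_I$ may be an unlabeled leaf. For $n=0$ the only tree is empty. Trees are considered up to isomorphism of labeled directed trees. **The Schröder-Cambrian $\mathbf P$-symbol.** Given a signed ordered partition $\lambda$ of $[n]$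 of signature $\varepsilon$, draw a vertical wall below each negative dot and above each positive dot of its table. Strands travel upwards, one in each region between horizontally consecutive walls (the two borders of the table counting as walls). Sweep the rows from bottom to top. At each row, the dots of this row that are not separated by a wall crossing this row are merged into one node, labeled by the set of their columns. Each node gathers all strands arriving from just below its row that are visible from it, i.e. not hidden by a wall crossing its row, and produces one strand in each visible region just above its row; the other strands continue upwards. The nodes, with an arc $v\to w$ whenever a strand produced by $v$ is gathered by $w$, form a labeled directed graph $\mathbf P(\lambda)$. For a Schröder $\varepsilon$-Cambrian tree $T$ put $\mathbb P_T=\sum_{\lambda}\mathbb F_\lambda$, the sum over all signed ordered partitions $\lambda$ of signature $\varepsilon$ with $\mathbf P(\lambda)=T$, and let $\mathrm{SchrCamb}\subseteq\mathrm{OrdPart}_\pm$ be the linear span of all $\mathbb P_T$, for all signatures $\varepsilon\in\{+,-\}^n$, $n\ge 0$, and all Schröder $\varepsilon$-Cambrian trees $T$. **Associahedra.** For $\varepsilon\in\{+,-\}^n$ and $0\le a<b\le n+1$ let $B_{ab}$ be the set of $i\in[n]$ such that ($a<i<b$ and $\varepsilon_i=-$), or ($a\ge 1$, $\varepsilon_a=+$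 and $i\le a$), or ($b\le n$, $\varepsilon_b=+$ and $i\ge b$). The Hohlweg–Lange associahedron is $$\mathrm{Asso}^\varepsilon=\Big\{x\in\mathbb R^n:\ \sum_{i\in[n]}x_i=\tfrac{n(n+1)}2,\quad \sum_{i\in B_{ab}}x_i\ \ge\ \tfrac{|B_{ab}|(|B_{ab}|+1)}2\ \text{ for all } 0\le a<b\le n+1\Big\}.$$ **Theorem.** 1. $\mathrm{SchrCamb}$ is a Hopf subalgebra of $\mathrm{OrdPart}_\pm$: it contains the unit, is closed under the product and the antipode, and $\Delta(\mathrm{SchrCamb})\subseteq\mathrm{SchrCamb}\otimes\mathrm{SchrCamb}$. 2. For every signed ordered partition $\lambda$ of signature $\varepsilon$, $\mathbf P(\lambda)$ is a Schröder $\varepsilon$-Cambrian tree, and the family $(\mathbb P_T)_T$, indexed by all pairs of a signature $\varepsilon$ and a Schröder $\varepsilon$-Cambrian tree $T$, is a basis of $\mathrm{SchrCamb}$. 3. For every signature $\varepsilon\in\{+,-\}^n$ there is a bijection $T\mapsto F_T$ from the Schröder $\varepsilon$-Cambrian trees to the nonempty faces of $\mathrm{Asso}^\varepsilon$ (including $\mathrm{Asso}^\varepsilon$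 itself) such that the outer normal cone of $F_T$ in the hyperplane $\sum_i y_i=0$ is the set of all $y$ in this hyperplane with $y_i\le y_j$ whenever there is a (possibly trivial) directed path in $T$ from the vertex whose label contains $i$ to the vertex whose label contains $j$. Hence the basis of $\mathrm{SchrCamb}$ is indexed by all nonempty faces of all Hohlweg–Lange associahedra. -/

import Mathlib

namespace SchroderCambrian

open Finset

/-- A table with `n` columns: the entry of the `c`-th column is the row (numbered from `0`, bottom
to top) and the sign of the only dot of that column. -/
abbrev Table : Type := List (ℕ × ℤˣ)

namespace Table

/-- The set of rows of the table that contain a dot. -/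
def rowSet (w : Table) : Finset ℕ := (w.map Prod.fst).toFinset

/-- Every row below a nonempty row is nonempty: the nonempty rows are `0, …, k - 1`, so that the
table is that of a surjection from the `n` columns to the `k` rows. -/
def Packed (w : Table) : Prop := ∀ m ∈ rowSet w, ∀ m' < m, m' ∈ rowSet w

/-- The number of nonempty rows strictly below row `m`. -/
def rank (w : Table) (m : ℕ) : ℕ := ((rowSet w).filter (· < m)).card

/-- Renumbering of the rows. -/
def relabel (f : ℕ → ℕ) (w : Table) : Table := w.map (Prod.map f id)

/-- Standardization of a table: deletion of the empty rows. Columns keep their order and signs. -/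
def pack (w : Table) : Table := relabel (rank w) w

/-- The number of nonempty rows. -/
def numRows (w : Table) : ℕ := (rowSet w).card

/-- The table obtained by keeping only the dots (columns) lying in the rows satisfying `p`. -/
def rowsOf (p : ℕ → Prop) [DecidablePred p] (w : Table) : Table := w.filter (fun x => p x.1)

theorem mem_rowSet {w : Table} {m : ℕ} : m ∈ rowSet w ↔ ∃ s, (m, s) ∈ w := by
  simp [rowSet]

theorem fst_mem_rowSet {w : Table} {x : ℕ × ℤˣ} (h : x ∈ w) : x.1 ∈ rowSet w :=
  mem_rowSet.2 ⟨x.2, h⟩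

theorem rowSet_relabel (f : ℕ → ℕ) (w : Table) : rowSet (relabel f w) = (rowSet w).image f := by
  ext m; simp [rowSet, relabel]

theorem rowSet_append (u v : Table) : rowSet (u ++ v) = rowSet u ∪ rowSet v := by
  ext m; simp only [mem_union, mem_rowSet, List.mem_append, exists_or]

theorem rowSet_rowsOf (p : ℕ → Prop) [DecidablePred p] (w : Table) :
    rowSet (rowsOf p w) = (rowSet w).filter p := by
  ext m; simp [rowSet, rowsOf]

theorem length_relabel (f : ℕ → ℕ) (w : Table) : (relabel f w).length = w.length := by
  simp [relabel]

theorem length_pack (w : Table) : (pack w).length = w.length := length_relabel _ _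

theorem relabel_relabel (f g : ℕ → ℕ) (w : Table) :
    relabel g (relabel f w) = relabel (g ∘ f) w := by
  simp [relabel, Function.comp_def]

theorem relabel_congr {f g : ℕ → ℕ} {w : Table} (h : ∀ m ∈ rowSet w, f m = g m) :
    relabel f w = relabel g w := by
  refine List.map_congr_left fun x hx => ?_
  simp [Prod.map, h _ (fst_mem_rowSet hx)]

theorem eqOn_of_relabel_eq {f g : ℕ → ℕ} {w : Table} (h : relabel f w = relabel g w) :
    ∀ m ∈ rowSet w, f m = g m := by
  intro m hm
  obtain ⟨s, hs⟩ := mem_rowSet.1 hm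
  have := (List.map_inj_left.1 h) _ hs
  exact congrArg Prod.fst this

theorem relabel_eq_self {f : ℕ → ℕ} {w : Table} (h : ∀ m ∈ rowSet w, f m = m) :
    relabel f w = w := by
  rw [relabel_congr (g := id) h]; simp [relabel]

theorem relabel_append (f : ℕ → ℕ) (u v : Table) :
    relabel f (u ++ v) = relabel f u ++ relabel f v := by simp [relabel]

theorem relabel_take (f : ℕ → ℕ) (n : ℕ) (w : Table) :
    (relabel f w).take n = relabel f (w.take n) := by simp [relabel, List.map_take]

theorem relabel_drop (f : ℕ → ℕ) (n : ℕ) (w : Table) :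
    (relabel f w).drop n = relabel f (w.drop n) := by simp [relabel, List.map_drop]

theorem rowsOf_append (p : ℕ → Prop) [DecidablePred p] (u v : Table) :
    rowsOf p (u ++ v) = rowsOf p u ++ rowsOf p v := by simp [rowsOf]

theorem rowsOf_relabel (p : ℕ → Prop) [DecidablePred p] (f : ℕ → ℕ) (w : Table) :
    rowsOf p (relabel f w) = relabel f (rowsOf (fun m => p (f m)) w) := by
  simp [rowsOf, relabel, List.filter_map, Function.comp_def]

theorem rowsOf_congr {p q : ℕ → Prop} [DecidablePred p] [DecidablePred q] {w : Table}
    (h : ∀ m ∈ rowSet w, p m ↔ q m) : rowsOf p w = rowsOf q w :=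
  List.filter_congr fun x hx => by simp [h _ (fst_mem_rowSet hx)]

theorem rowsOf_rowsOf (p q : ℕ → Prop) [DecidablePred p] [DecidablePred q] (w : Table) :
    rowsOf p (rowsOf q w) = rowsOf (fun m => p m ∧ q m) w := by
  simp [rowsOf, List.filter_filter]

theorem rank_relabel {f : ℕ → ℕ} {w : Table} (hf : StrictMonoOn f (rowSet w)) {m : ℕ}
    (hm : m ∈ rowSet w) : rank (relabel f w) (f m) = rank w m := by
  unfold rank
  rw [rowSet_relabel, filter_image, card_image_of_injOn]
  · congr 1
    refine filter_congr fun x hx => ?_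
    exact hf.lt_iff_lt hx hm
  · exact hf.injOn.mono fun x hx => (mem_filter.1 (mem_coe.1 hx)).1

theorem pack_relabel {f : ℕ → ℕ} {w : Table} (hf : StrictMonoOn f (rowSet w)) :
    pack (relabel f w) = pack w := by
  unfold pack
  rw [relabel_relabel]
  exact relabel_congr fun m hm => rank_relabel hf hm

theorem strictMonoOn_rank (w : Table) : StrictMonoOn (rank w) (rowSet w) := by
  intro x hx y hy hxy
  refine card_lt_card ?_
  rw [ssubset_iff_of_subset]
  · exact ⟨x, by simpa using ⟨hx, hxy⟩, by simp⟩
  · intro z hz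
    simp only [mem_filter] at hz ⊢
    exact ⟨hz.1, hz.2.trans hxy⟩

theorem rank_eq_self {w : Table} (hw : Packed w) {m : ℕ} (hm : m ∈ rowSet w) : rank w m = m := by
  have : (rowSet w).filter (· < m) = range m := by
    ext x; simp only [mem_filter, mem_range]
    exact ⟨fun h => h.2, fun h => ⟨hw m hm x h, h⟩⟩
  rw [rank, this, card_range]

theorem pack_eq_self {w : Table} (hw : Packed w) : pack w = w :=
  relabel_eq_self fun _ hm => rank_eq_self hw hm

theorem rowSet_eq_range {w : Table} (hw : Packed w) : rowSet w = range (numRows w) := by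
  refine (eq_of_subset_of_card_le ?_ (by simp [numRows])) 
  intro m hm
  rw [mem_range]
  have h1 : range (m + 1) ⊆ rowSet w := by
    intro x hx
    rcases Nat.lt_succ_iff_lt_or_eq.1 (mem_range.1 hx) with h | h
    · exact hw m hm x h
    · exact h ▸ hm
  have := card_le_card h1
  rw [card_range] at this
  exact this

theorem numRows_le_length (w : Table) : numRows w ≤ w.length := by
  unfold numRows rowSet
  simpa using List.toFinset_card_le (w.map Prod.fst)

theorem packed_of_rowSet_eq_range {w : Table} {k : ℕ} (h : rowSet w = range k) : Packed w := by
  intro m hm m' hm'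
  rw [h, mem_range] at *
  exact hm'.trans hm

theorem rowSet_pack (w : Table) : rowSet (pack w) = range (numRows w) := by
  refine eq_of_subset_of_card_le ?_ ?_
  · intro m hm
    rw [pack, rowSet_relabel, mem_image] at hm
    obtain ⟨x, hx, rfl⟩ := hm
    rw [mem_range]
    exact card_lt_card (filter_ssubset.2 ⟨x, hx, by simp⟩)
  · rw [pack, rowSet_relabel, card_image_of_injOn (strictMonoOn_rank w).injOn]
    simp [numRows]

theorem packed_pack (w : Table) : Packed (pack w) := packed_of_rowSet_eq_range (rowSet_pack w)

theorem numRows_pack (w : Table) : numRows (pack w) = numRows w := by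
  rw [numRows, rowSet_pack, card_range]

theorem exists_relabel_pack (w : Table) :
    ∃ f : ℕ → ℕ, StrictMonoOn f (rowSet (pack w)) ∧ w = relabel f (pack w) := by
  classical
  have hinj := (strictMonoOn_rank w).injOn
  refine ⟨Function.invFunOn (rank w) (rowSet w), ?_, ?_⟩
  · intro x hx y hy hxy
    rw [pack, rowSet_relabel, mem_coe, mem_image] at hx hy
    obtain ⟨a, ha, rfl⟩ := hx
    obtain ⟨b, hb, rfl⟩ := hy
    rw [hinj.leftInvOn_invFunOn ha, hinj.leftInvOn_invFunOn hb]
    exact ((strictMonoOn_rank w).lt_iff_lt ha hb).1 hxy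
  · rw [pack, relabel_relabel, relabel_eq_self]
    exact fun m hm => hinj.leftInvOn_invFunOn hm

theorem pack_rowsOf_relabel (p : ℕ → Prop) [DecidablePred p] {f : ℕ → ℕ} {w : Table}
    (hf : StrictMonoOn f (rowSet w)) :
    pack (rowsOf p (relabel f w)) = pack (rowsOf (fun m => p (f m)) w) := by
  rw [rowsOf_relabel]
  exact pack_relabel (hf.mono fun x hx => by
    rw [rowSet_rowsOf] at hx; exact (mem_filter.1 (mem_coe.1 hx)).1)

theorem rowSet_take_subset (n : ℕ) (w : Table) : rowSet (w.take n) ⊆ rowSet w := by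
  intro m; simp only [mem_rowSet]
  exact fun ⟨s, hs⟩ => ⟨s, List.mem_of_mem_take hs⟩

theorem rowSet_drop_subset (n : ℕ) (w : Table) : rowSet (w.drop n) ⊆ rowSet w := by
  intro m; simp only [mem_rowSet]
  exact fun ⟨s, hs⟩ => ⟨s, List.mem_of_mem_drop hs⟩

theorem pack_take_pack (n : ℕ) (w : Table) : pack ((pack w).take n) = pack (w.take n) := by
  conv_lhs => rw [pack, pack, relabel_take]
  exact pack_relabel ((strictMonoOn_rank w).mono (by exact_mod_cast rowSet_take_subset n w))

theorem pack_drop_pack (n : ℕ) (w : Table) : pack ((pack w).drop n) = pack (w.drop n) := by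
  conv_lhs => rw [pack, pack, relabel_drop]
  exact pack_relabel ((strictMonoOn_rank w).mono (by exact_mod_cast rowSet_drop_subset n w))

theorem finite_packed (n : ℕ) : {w : Table | Packed w ∧ w.length = n}.Finite := by
  have h : ({x : ℕ × ℤˣ | x.1 < n}).Finite := by
    refine ((Set.finite_Iio n).prod (Set.finite_univ (α := ℤˣ))).subset ?_
    rintro ⟨a, b⟩ h; simpa using h
  have h' : Finite {x : ℕ × ℤˣ // x.1 < n} := h.to_subtype
  refine (List.finite_length_eq {x : ℕ × ℤˣ // x.1 < n} n).image
    (List.map Subtype.val) |>.subset ?_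
  rintro w ⟨hw, hn⟩
  refine ⟨w.attach.map fun x => ⟨x.1, ?_⟩, by simpa using hn, by
    rw [List.map_map]; exact List.attach_map_subtype_val w⟩
  have := fst_mem_rowSet x.2
  rw [rowSet_eq_range hw, mem_range] at this
  have := numRows_le_length w
  omega

end Table

open Table

/-- A signed ordered partition `λ₁ | ⋯ | λ_k` of `[n]`, given by its table: column `j ∈ {1, …, n}`
has its signed dot in row `i - 1` when `j ∈ λ_i`. -/
@[ext]
structure SignedOrdPart where
  table : Table
  packed : Packed table

noncomputable instance : DecidableEq SignedOrdPart := Classical.decEq _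

namespace SignedOrdPart

/-- The signed ordered partition obtained by standardizing a table. -/
def std (w : Table) : SignedOrdPart := ⟨pack w, packed_pack w⟩

/-- The number `n` such that the parts partition `[n]`. -/
def size (l : SignedOrdPart) : ℕ := l.table.length

/-- The number of parts. -/
def numParts (l : SignedOrdPart) : ℕ := numRows l.table

/-- Restriction to the set of rows satisfying `p`: delete the other rows and standardize. -/
def rows (p : ℕ → Prop) [DecidablePred p] (l : SignedOrdPart) : SignedOrdPart :=
  std (rowsOf p l.table)

/-- Restriction to the first `n` columns: delete the other columns and standardize. -/
def firstCols (n : ℕ) (l : SignedOrdPart) : SignedOrdPart := std (l.table.take n)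

/-- Restriction to the columns after the `n`-th one: delete the others and standardize. -/
def lastCols (n : ℕ) (l : SignedOrdPart) : SignedOrdPart := std (l.table.drop n)

/-- The finite set of all signed ordered partitions of `[n]`. -/
noncomputable def ofSize (n : ℕ) : Finset SignedOrdPart :=
  ((finite_packed n).preimage (f := SignedOrdPart.table)
    (fun _ _ _ _ h => SignedOrdPart.ext h)).toFinset

theorem mem_ofSize {n : ℕ} {l : SignedOrdPart} : l ∈ ofSize n ↔ l.size = n := by
  simp [ofSize, size, l.packed]

/-- The shifted shuffle product: all signed ordered partitions of `[n + n']` whose restriction to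
the first `n` columns is `l` and whose restriction to the last `n'` columns is `l'`. -/
noncomputable def shiftedShuffle (l l' : SignedOrdPart) : Finset SignedOrdPart :=
  (ofSize (l.size + l'.size)).filter fun m => firstCols l.size m = l ∧ lastCols l.size m = l'

/-- `m` belongs to the convolution product of `l` and `l'`: the restriction of `m` to its first
`l.numParts` rows is `l` and its restriction to the remaining rows is `l'`. -/
def MemConvolution (m l l' : SignedOrdPart) : Prop :=
  m.size = l.size + l'.size ∧ rows (· < l.numParts) m = l ∧ rows (l.numParts ≤ ·) m = l'

/-- The finite set of all pairs `(l, l')` such that `m` is in the convolution product of `l` and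
`l'` (see `mem_convolutionPairs`). -/
noncomputable def convolutionPairs (m : SignedOrdPart) : Finset (SignedOrdPart × SignedOrdPart) :=
  (range (m.numParts + 1)).image fun r => (rows (· < r) m, rows (r ≤ ·) m)

/-- The only (empty) ordered partition of `[0]`. -/
def empty : SignedOrdPart := ⟨[], by simp [Packed, rowSet]⟩

theorem mem_shiftedShuffle {m l l' : SignedOrdPart} : m ∈ shiftedShuffle l l' ↔
    m.size = l.size + l'.size ∧ firstCols l.size m = l ∧ lastCols l.size m = l' := by
  simp [shiftedShuffle, mem_ofSize]

theorem std_table (l : SignedOrdPart) : std l.table = l :=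
  SignedOrdPart.ext (pack_eq_self l.packed)

theorem size_std (w : Table) : (std w).size = w.length := length_pack w

theorem rowSet_table (l : SignedOrdPart) : rowSet l.table = range l.numParts :=
  rowSet_eq_range l.packed

theorem mem_rowSet_table {l : SignedOrdPart} {m : ℕ} : m ∈ rowSet l.table ↔ m < l.numParts := by
  rw [rowSet_table, mem_range]

theorem firstCols_std (n : ℕ) (w : Table) : firstCols n (std w) = std (w.take n) :=
  SignedOrdPart.ext (pack_take_pack n w)

theorem lastCols_std (n : ℕ) (w : Table) : lastCols n (std w) = std (w.drop n) :=
  SignedOrdPart.ext (pack_drop_pack n w)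

theorem numParts_std (w : Table) : (std w).numParts = numRows w := numRows_pack w

theorem std_relabel {f : ℕ → ℕ} {w : Table} (hf : StrictMonoOn f (rowSet w)) :
    std (relabel f w) = std w := SignedOrdPart.ext (pack_relabel hf)

theorem rowSet_rowsOf_lt {l : SignedOrdPart} {r : ℕ} (hr : r ≤ l.numParts) :
    rowSet (rowsOf (· < r) l.table) = range r := by
  rw [rowSet_rowsOf, rowSet_table]
  ext x; simp only [mem_filter, mem_range]; omega

theorem numParts_rows_lt {l : SignedOrdPart} {r : ℕ} (hr : r ≤ l.numParts) :
    (rows (· < r) l).numParts = r := by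
  rw [rows, numParts_std, numRows, rowSet_rowsOf_lt hr, card_range]

theorem rows_lt_table {l : SignedOrdPart} {r : ℕ} (hr : r ≤ l.numParts) :
    (rows (· < r) l).table = rowsOf (· < r) l.table :=
  pack_eq_self (packed_of_rowSet_eq_range (rowSet_rowsOf_lt hr))

theorem strictMonoOn_sub (r : ℕ) (w : Table) :
    StrictMonoOn (fun m => m - r) (rowSet (rowsOf (r ≤ ·) w)) := by
  intro x hx y hy hxy
  rw [rowSet_rowsOf] at hx hy
  have hx := (mem_filter.1 (mem_coe.1 hx)).2
  have hy := (mem_filter.1 (mem_coe.1 hy)).2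
  simp only
  omega

theorem rows_ge_table (l : SignedOrdPart) (r : ℕ) :
    (rows (r ≤ ·) l).table = relabel (fun m => m - r) (rowsOf (r ≤ ·) l.table) := by
  change pack (rowsOf (r ≤ ·) l.table) = _
  rw [← pack_relabel (strictMonoOn_sub r l.table)]
  refine pack_eq_self (packed_of_rowSet_eq_range (k := l.numParts - r) ?_)
  rw [rowSet_relabel, rowSet_rowsOf, rowSet_table]
  ext x; simp only [mem_image, mem_filter, mem_range]
  constructor
  · rintro ⟨a, ⟨h1, h2⟩, rfl⟩; omega
  · intro h; exact ⟨x + r, ⟨by omega, by omega⟩, by omega⟩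

theorem numParts_rows_ge (l : SignedOrdPart) (r : ℕ) :
    (rows (r ≤ ·) l).numParts = l.numParts - r := by
  rw [rows, numParts_std, numRows, rowSet_rowsOf, rowSet_table]
  have : (range l.numParts).filter (r ≤ ·) = Ico r l.numParts := by
    ext x; simp only [mem_filter, mem_range, mem_Ico]; omega
  rw [this, Nat.card_Ico]

theorem rows_rows_lt (p : ℕ → Prop) [DecidablePred p] {l : SignedOrdPart} {r : ℕ}
    (hr : r ≤ l.numParts) : rows p (rows (· < r) l) = rows (fun m => p m ∧ m < r) l := by
  conv_lhs => rw [rows, rows_lt_table hr, rowsOf_rowsOf]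
  rfl

theorem rows_rows_ge (p : ℕ → Prop) [DecidablePred p] (l : SignedOrdPart) (r : ℕ) :
    rows p (rows (r ≤ ·) l) = rows (fun m => p (m - r) ∧ r ≤ m) l := by
  conv_lhs => rw [rows, rows_ge_table]
  refine SignedOrdPart.ext ?_
  refine (pack_rowsOf_relabel p (strictMonoOn_sub r l.table)).trans ?_
  rw [rowsOf_rowsOf]
  rfl

theorem rows_congr {p q : ℕ → Prop} [DecidablePred p] [DecidablePred q] {l : SignedOrdPart}
    (h : ∀ m < l.numParts, p m ↔ q m) : rows p l = rows q l := by
  rw [rows, rows, rowsOf_congr fun m hm => h m (mem_rowSet_table.1 hm)]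

theorem rows_eq_self {p : ℕ → Prop} [DecidablePred p] {l : SignedOrdPart}
    (h : ∀ m < l.numParts, p m) : rows p l = l := by
  rw [rows_congr (q := fun _ => True) (by simpa using h)]
  simp [rows, rowsOf, std_table]

theorem size_rows_add (l : SignedOrdPart) (r : ℕ) :
    (rows (· < r) l).size + (rows (r ≤ ·) l).size = l.size := by
  rw [rows, rows, size_std, size_std]
  simp only [rowsOf, size]
  have := List.length_eq_length_filter_add (l := l.table) (fun x => decide (x.1 < r))
  rw [this]
  congr 3
  funext x
  by_cases h : x.1 < r
  · simp [h]
  · simp [h, not_lt.1 h]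

/-- The pairs in `convolutionPairs m` are exactly those whose convolution contains `m`. -/
theorem mem_convolutionPairs {m : SignedOrdPart} {p : SignedOrdPart × SignedOrdPart} :
    p ∈ convolutionPairs m ↔ MemConvolution m p.1 p.2 := by
  obtain ⟨l, l'⟩ := p
  simp only [convolutionPairs, mem_image, mem_range, MemConvolution, Prod.mk.injEq]
  constructor
  · rintro ⟨r, hr, rfl, rfl⟩
    rw [numParts_rows_lt (by omega)]
    exact ⟨(size_rows_add m r).symm, rfl, rfl⟩
  · rintro ⟨_, h1, h2⟩
    refine ⟨l.numParts, ?_, h1, h2⟩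
    have : l.numParts ≤ m.numParts := by
      conv_lhs => rw [← h1]
      rw [rows, numParts_std, numParts, numRows, numRows, rowSet_rowsOf]
      exact card_filter_le _ _
    omega

theorem sum_convolutionPairs {M : Type*} [AddCommMonoid M] (m : SignedOrdPart)
    (f : SignedOrdPart → SignedOrdPart → M) :
    ∑ p ∈ convolutionPairs m, f p.1 p.2 =
      ∑ r ∈ range (m.numParts + 1), f (rows (· < r) m) (rows (r ≤ ·) m) := by
  rw [convolutionPairs, sum_image]
  intro r hr s hs h
  simp only [coe_range, Set.mem_Iio] at hr hs
  have := congrArg numParts (Prod.ext_iff.1 h).1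
  simp only at this
  rwa [numParts_rows_lt (by omega), numParts_rows_lt (by omega)] at this

theorem size_eq_zero {l : SignedOrdPart} : l.size = 0 ↔ l = empty := by
  rw [SignedOrdPart.ext_iff]; exact List.length_eq_zero_iff

theorem numParts_eq_zero {l : SignedOrdPart} : l.numParts = 0 ↔ l = empty := by
  rw [← size_eq_zero]
  simp only [numParts, numRows, card_eq_zero, rowSet, size]
  simp

theorem size_empty : empty.size = 0 := rfl

theorem firstCols_firstCols (a b : ℕ) (m : SignedOrdPart) :
    firstCols a (firstCols (a + b) m) = firstCols a m := by
  rw [firstCols, firstCols, ← firstCols, firstCols_std, List.take_take, firstCols,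
    Nat.min_eq_left (by omega)]

theorem lastCols_firstCols (a b : ℕ) (m : SignedOrdPart) :
    lastCols a (firstCols (a + b) m) = firstCols b (lastCols a m) := by
  rw [firstCols, lastCols_std, lastCols, firstCols_std, List.drop_take]
  congr 2; omega

theorem lastCols_lastCols (a b : ℕ) (m : SignedOrdPart) :
    lastCols b (lastCols a m) = lastCols (a + b) m := by
  conv_lhs => rw [lastCols.eq_1 a, lastCols_std, List.drop_drop]
  rfl

theorem size_firstCols (a : ℕ) (m : SignedOrdPart) : (firstCols a m).size = min a m.size := by
  rw [firstCols, size_std]; simp [size]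

theorem size_lastCols (a : ℕ) (m : SignedOrdPart) : (lastCols a m).size = m.size - a := by
  rw [lastCols, size_std]; simp [size]

end SignedOrdPart

open SignedOrdPart TensorProduct

/-- The vector space with basis the signed ordered partitions; below it is made a Hopf algebra. -/
def OrdPart (K : Type*) [CommRing K] : Type _ := SignedOrdPart →₀ K

namespace OrdPart

variable (K : Type*) [CommRing K]

noncomputable instance : AddCommGroup (OrdPart K) :=
  inferInstanceAs (AddCommGroup (SignedOrdPart →₀ K))

noncomputable instance : Module K (OrdPart K) :=
  inferInstanceAs (Module K (SignedOrdPart →₀ K))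

/-- The basis `(F_λ)`. -/
noncomputable def basisF : Module.Basis SignedOrdPart K (OrdPart K) :=
  Module.Basis.ofRepr (LinearEquiv.refl K (SignedOrdPart →₀ K))

/-- The basis element `F_λ`. -/
noncomputable def F (l : SignedOrdPart) : OrdPart K := basisF K l

/-- The product `F_λ · F_λ' = ∑ F_μ` over `μ` in the shifted shuffle of `λ` and `λ'`. -/
noncomputable def mulMap : OrdPart K →ₗ[K] OrdPart K →ₗ[K] OrdPart K :=
  (basisF K).constr K fun l => (basisF K).constr K fun l' => ∑ m ∈ shiftedShuffle l l', F K m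

/-- The coproduct `Δ F_μ = ∑ F_λ ⊗ F_λ'` over all `λ, λ'` with `μ` in their convolution. -/
noncomputable def comulMap : OrdPart K →ₗ[K] OrdPart K ⊗[K] OrdPart K :=
  (basisF K).constr K fun m => ∑ p ∈ convolutionPairs m, F K p.1 ⊗ₜ[K] F K p.2

/-- The counit: coefficient of the empty partition. -/
noncomputable def counitMap : OrdPart K →ₗ[K] K :=
  (basisF K).constr K fun l => if l = SignedOrdPart.empty then 1 else 0

variable {K}

theorem mulMap_F (l l' : SignedOrdPart) :
    mulMap K (F K l) (F K l') = ∑ m ∈ shiftedShuffle l l', F K m := by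
  simp only [mulMap, F, Module.Basis.constr_basis]

theorem comulMap_F (m : SignedOrdPart) :
    comulMap K (F K m) = ∑ p ∈ convolutionPairs m, F K p.1 ⊗ₜ[K] F K p.2 := by
  simp only [comulMap, F, Module.Basis.constr_basis]

theorem comulMap_F' (m : SignedOrdPart) : comulMap K (F K m) =
    ∑ r ∈ range (m.numParts + 1), F K (rows (· < r) m) ⊗ₜ[K] F K (rows (r ≤ ·) m) := by
  rw [comulMap_F, sum_convolutionPairs m fun l l' => F K l ⊗ₜ[K] F K l']

theorem counitMap_F (l : SignedOrdPart) :
    counitMap K (F K l) = if l = SignedOrdPart.empty then 1 else 0 := by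
  simp only [counitMap, F, Module.Basis.constr_basis]

theorem hom_ext {M : Type*} [AddCommMonoid M] [Module K M] {f g : OrdPart K →ₗ[K] M}
    (h : ∀ l, f (F K l) = g (F K l)) : f = g := (basisF K).ext h

theorem shuffle_assoc_left (a b c : SignedOrdPart) (f : SignedOrdPart → OrdPart K) :
    ∑ m ∈ shiftedShuffle a b, ∑ v ∈ shiftedShuffle m c, f v =
      ∑ v ∈ (ofSize (a.size + b.size + c.size)).filter (fun v => firstCols a.size v = a ∧
        firstCols b.size (lastCols a.size v) = b ∧ lastCols (a.size + b.size) v = c), f v := by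
  rw [sum_sigma']
  refine sum_bij (fun x _ => x.2) ?_ ?_ ?_ (fun _ _ => rfl)
  · rintro ⟨m, v⟩ h
    simp only [mem_sigma, mem_shiftedShuffle] at h
    obtain ⟨⟨h1, h2, h3⟩, h4, h5, h6⟩ := h
    rw [h1] at h4 h5 h6
    simp only [mem_filter, mem_ofSize]
    refine ⟨h4, ?_, ?_, h6⟩
    · rw [← firstCols_firstCols _ b.size, h5, h2]
    · rw [← lastCols_firstCols, h5, h3]
  · rintro ⟨m, v⟩ h ⟨m', v'⟩ h' e
    simp only [mem_sigma, mem_shiftedShuffle] at h h'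
    simp only at e
    subst e
    obtain ⟨⟨h1, h2, h3⟩, h4, h5, h6⟩ := h
    obtain ⟨⟨h1', h2', h3'⟩, h4', h5', h6'⟩ := h'
    rw [h1] at h5
    rw [h1'] at h5'
    rw [← h5, ← h5']
  · intro v h
    simp only [mem_filter, mem_ofSize] at h
    obtain ⟨h1, h2, h3, h4⟩ := h
    have hs : (firstCols (a.size + b.size) v).size = a.size + b.size := by
      rw [size_firstCols]; omega
    refine ⟨⟨firstCols (a.size + b.size) v, v⟩, ?_, rfl⟩
    simp only [mem_sigma, mem_shiftedShuffle]
    refine ⟨⟨hs, ?_, ?_⟩, by rw [hs, h1], by rw [hs], by rw [hs, h4]⟩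
    · rw [firstCols_firstCols, h2]
    · rw [lastCols_firstCols, h3]

theorem shuffle_assoc_right (a b c : SignedOrdPart) (f : SignedOrdPart → OrdPart K) :
    ∑ m ∈ shiftedShuffle b c, ∑ v ∈ shiftedShuffle a m, f v =
      ∑ v ∈ (ofSize (a.size + b.size + c.size)).filter (fun v => firstCols a.size v = a ∧
        firstCols b.size (lastCols a.size v) = b ∧ lastCols (a.size + b.size) v = c), f v := by
  rw [sum_sigma']
  refine sum_bij (fun x _ => x.2) ?_ ?_ ?_ (fun _ _ => rfl)
  · rintro ⟨m, v⟩ h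
    simp only [mem_sigma, mem_shiftedShuffle] at h
    obtain ⟨⟨h1, h2, h3⟩, h4, h5, h6⟩ := h
    simp only [mem_filter, mem_ofSize]
    refine ⟨by omega, h5, ?_, ?_⟩
    · rw [h6, h2]
    · rw [← lastCols_lastCols, h6, h3]
  · rintro ⟨m, v⟩ h ⟨m', v'⟩ h' e
    simp only [mem_sigma, mem_shiftedShuffle] at h h'
    simp only at e
    subst e
    rw [← h.2.2.2, ← h'.2.2.2]
  · intro v h
    simp only [mem_filter, mem_ofSize] at h
    obtain ⟨h1, h2, h3, h4⟩ := h
    have hs : (lastCols a.size v).size = b.size + c.size := by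
      rw [size_lastCols]; omega
    refine ⟨⟨lastCols a.size v, v⟩, ?_, rfl⟩
    simp only [mem_sigma, mem_shiftedShuffle]
    refine ⟨⟨hs, h3, ?_⟩, by omega, h2, trivial⟩
    rw [lastCols_lastCols, h4]

theorem mulMap_assoc (x y z : OrdPart K) :
    mulMap K (mulMap K x y) z = mulMap K x (mulMap K y z) := by
  have h : (mulMap K).compr₂ (mulMap K) =
      (LinearMap.llcomp K (OrdPart K) (OrdPart K) (OrdPart K) ∘ₗ mulMap K).compl₂ (mulMap K) := by
    refine hom_ext fun a => hom_ext fun b => hom_ext fun c => ?_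
    simp only [LinearMap.compr₂_apply, LinearMap.compl₂_apply, LinearMap.comp_apply,
      LinearMap.llcomp_apply, mulMap_F, map_sum, LinearMap.sum_apply]
    rw [shuffle_assoc_left, shuffle_assoc_right]
  exact LinearMap.congr_fun (LinearMap.congr_fun (LinearMap.congr_fun h x) y) z

theorem shiftedShuffle_empty_left (l : SignedOrdPart) :
    shiftedShuffle SignedOrdPart.empty l = {l} := by
  ext m
  simp only [mem_shiftedShuffle, size_empty, mem_singleton, firstCols, lastCols, List.take_zero,
    List.drop_zero, std_table, zero_add]
  constructor
  · exact fun h => h.2.2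
  · rintro rfl; exact ⟨rfl, SignedOrdPart.ext rfl, rfl⟩

theorem shiftedShuffle_empty_right (l : SignedOrdPart) :
    shiftedShuffle l SignedOrdPart.empty = {l} := by
  ext m
  simp only [mem_shiftedShuffle, size_empty, mem_singleton, add_zero]
  have key : m.size = l.size → firstCols l.size m = m ∧ lastCols l.size m = empty := by
    intro h
    rw [← h, firstCols, lastCols, size, List.take_length, List.drop_length, std_table]
    exact ⟨rfl, SignedOrdPart.ext rfl⟩
  constructor
  · rintro ⟨h1, h2, -⟩; rw [← (key h1).1, h2]
  · rintro rfl; exact ⟨rfl, key rfl⟩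

noncomputable instance : Ring (OrdPart K) :=
  { (inferInstance : AddCommGroup (OrdPart K)) with
    mul := fun x y => mulMap K x y
    one := F K SignedOrdPart.empty
    mul_assoc := mulMap_assoc
    one_mul := fun x => by
      have h : mulMap K (F K SignedOrdPart.empty) = LinearMap.id := hom_ext fun l => by
        rw [mulMap_F, shiftedShuffle_empty_left, sum_singleton, LinearMap.id_apply]
      exact LinearMap.congr_fun h x
    mul_one := fun x => by
      have h : (mulMap K).flip (F K SignedOrdPart.empty) = LinearMap.id := hom_ext fun l => by
        rw [LinearMap.flip_apply, mulMap_F, shiftedShuffle_empty_right, sum_singleton,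
          LinearMap.id_apply]
      exact LinearMap.congr_fun h x
    left_distrib := fun x y z => map_add (mulMap K x) y z
    right_distrib := fun x y z => LinearMap.map_add₂ (mulMap K) x y z
    zero_mul := fun x => LinearMap.map_zero₂ (mulMap K) x
    mul_zero := fun x => map_zero (mulMap K x) }

noncomputable instance : Algebra K (OrdPart K) :=
  Algebra.ofModule (fun r x y => LinearMap.map_smul₂ (mulMap K) r x y)
    (fun r x y => map_smul (mulMap K x) r y)

/-- The product of the Hopf algebra of signed ordered partitions. -/
theorem F_mul_F (l l' : SignedOrdPart) : F K l * F K l' = ∑ m ∈ shiftedShuffle l l', F K m :=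
  mulMap_F l l'

theorem one_eq_F : (1 : OrdPart K) = F K SignedOrdPart.empty := rfl

theorem rows_zero_le (m : SignedOrdPart) : rows (0 ≤ ·) m = m := rows_eq_self fun _ _ => by simp

theorem rows_lt_numParts (m : SignedOrdPart) : rows (· < m.numParts) m = m :=
  rows_eq_self fun _ h => h

theorem rows_lt_eq_empty {m : SignedOrdPart} {r : ℕ} (hr : r ≤ m.numParts) :
    rows (· < r) m = SignedOrdPart.empty ↔ r = 0 := by
  rw [← numParts_eq_zero, numParts_rows_lt hr]

theorem rows_ge_eq_empty {m : SignedOrdPart} {r : ℕ} (hr : r ≤ m.numParts) :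
    rows (r ≤ ·) m = SignedOrdPart.empty ↔ r = m.numParts := by
  rw [← numParts_eq_zero, numParts_rows_ge]; omega

noncomputable instance : Coalgebra K (OrdPart K) where
  comul := comulMap K
  counit := counitMap K
  coassoc := by
    refine hom_ext fun m => ?_
    simp only [LinearMap.comp_apply, comulMap_F', map_sum, LinearMap.rTensor_tmul,
      LinearMap.lTensor_tmul, LinearEquiv.coe_coe, TensorProduct.sum_tmul, TensorProduct.tmul_sum,
      TensorProduct.assoc_tmul]
    rw [sum_sigma', sum_sigma']
    refine sum_bij' (fun x _ => ⟨x.2, x.1 - x.2⟩) (fun x _ => ⟨x.1 + x.2, x.1⟩) ?_ ?_ ?_ ?_ ?_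
    · rintro ⟨r, s⟩ h
      simp only [mem_sigma, mem_range] at h ⊢
      rw [numParts_rows_lt (by omega)] at h
      rw [numParts_rows_ge]; omega
    · rintro ⟨r, s⟩ h
      simp only [mem_sigma, mem_range] at h ⊢
      rw [numParts_rows_ge] at h
      rw [numParts_rows_lt (by omega)]; omega
    · rintro ⟨r, s⟩ h
      simp only [mem_sigma, mem_range] at h ⊢
      rw [numParts_rows_lt (by omega)] at h
      rw [Nat.add_sub_cancel' (by omega)]
    · rintro ⟨r, s⟩ h
      simp
    · rintro ⟨r, s⟩ h
      simp only [mem_sigma, mem_range] at h ⊢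
      rw [numParts_rows_lt (by omega)] at h
      rw [rows_rows_lt _ (by omega), rows_rows_lt _ (by omega), rows_rows_ge, rows_rows_ge,
        rows_congr (l := m) (p := fun x => x < s ∧ x < r) (q := (· < s)) (by intros; omega),
        rows_congr (l := m) (p := fun x => s ≤ x ∧ x < r) (q := fun x => x - s < r - s ∧ s ≤ x)
          (by intros; omega),
        rows_congr (l := m) (p := fun x => r - s ≤ x - s ∧ s ≤ x) (q := (r ≤ ·))
          (by intros; omega)]
  rTensor_counit_comp_comul := by
    refine hom_ext fun m => ?_
    simp only [LinearMap.comp_apply, comulMap_F', map_sum, LinearMap.rTensor_tmul, counitMap_F]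
    rw [sum_eq_single 0]
    · rw [if_pos ((rows_lt_eq_empty (Nat.zero_le _)).2 rfl), rows_zero_le]; rfl
    · intro r hr h0
      rw [mem_range] at hr
      rw [if_neg (by rwa [rows_lt_eq_empty (by omega)]), TensorProduct.zero_tmul]
    · simp
  lTensor_counit_comp_comul := by
    refine hom_ext fun m => ?_
    simp only [LinearMap.comp_apply, comulMap_F', map_sum, LinearMap.lTensor_tmul, counitMap_F]
    rw [sum_eq_single m.numParts]
    · rw [if_pos ((rows_ge_eq_empty le_rfl).2 rfl), rows_lt_numParts]; rfl
    · intro r hr h0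
      rw [mem_range] at hr
      rw [if_neg (by rwa [rows_ge_eq_empty (by omega)]), TensorProduct.tmul_zero]
    · simp

open Coalgebra

/-- The coproduct of the Hopf algebra of signed ordered partitions. -/
theorem comul_F (m : SignedOrdPart) :
    comul (R := K) (F K m) = ∑ p ∈ convolutionPairs m, F K p.1 ⊗ₜ[K] F K p.2 := comulMap_F m

theorem comul_F' (m : SignedOrdPart) : comul (R := K) (F K m) =
    ∑ r ∈ range (m.numParts + 1), F K (rows (· < r) m) ⊗ₜ[K] F K (rows (r ≤ ·) m) :=
  comulMap_F' m

theorem counit_F (l : SignedOrdPart) :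
    counit (R := K) (F K l) = if l = SignedOrdPart.empty then 1 else 0 := counitMap_F l

end OrdPart

namespace Table

theorem rank_eq_numRows (w : Table) (r : ℕ) : rank w r = numRows (rowsOf (· < r) w) := by
  rw [numRows, rowSet_rowsOf, rank]

theorem rank_lt_rank_iff {w : Table} {m r : ℕ} (hm : m ∈ rowSet w) :
    rank w m < rank w r ↔ m < r := by
  constructor
  · intro h
    by_contra hr
    refine absurd h (not_lt.2 (card_le_card fun x hx => ?_))
    simp only [mem_filter] at hx ⊢
    exact ⟨hx.1, by omega⟩
  · intro h
    refine card_lt_card ?_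
    rw [ssubset_iff_of_subset]
    · exact ⟨m, by simpa using ⟨hm, h⟩, by simp⟩
    · intro x hx
      simp only [mem_filter] at hx ⊢
      exact ⟨hx.1, by omega⟩

theorem pack_rowsOf_pack_lt (w : Table) (r : ℕ) :
    pack (rowsOf (· < rank w r) (pack w)) = pack (rowsOf (· < r) w) := by
  conv_lhs => rw [pack.eq_1 w]
  rw [pack_rowsOf_relabel _ (strictMonoOn_rank w)]
  rw [rowsOf_congr fun m hm => rank_lt_rank_iff hm]

theorem pack_rowsOf_pack_ge (w : Table) (r : ℕ) :
    pack (rowsOf (rank w r ≤ ·) (pack w)) = pack (rowsOf (r ≤ ·) w) := by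
  conv_lhs => rw [pack.eq_1 w]
  rw [pack_rowsOf_relabel _ (strictMonoOn_rank w)]
  rw [rowsOf_congr fun m hm => by rw [← not_lt, rank_lt_rank_iff hm, not_lt]]

theorem map_lt_pack (w : Table) (r : ℕ) :
    (pack w).map (fun x => decide (x.1 < rank w r)) = w.map (fun x => decide (x.1 < r)) := by
  rw [pack, relabel, List.map_map]
  refine List.map_congr_left fun x hx => ?_
  simp [rank_lt_rank_iff (fst_mem_rowSet hx)]

theorem eq_of_rowsOf_eq (r : ℕ) : ∀ {u v : Table},
    u.map (fun x => decide (x.1 < r)) = v.map (fun x => decide (x.1 < r)) →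
    rowsOf (· < r) u = rowsOf (· < r) v → rowsOf (r ≤ ·) u = rowsOf (r ≤ ·) v → u = v
  | [], v, h, _, _ => by simpa using h
  | x :: u, [], h, _, _ => by simp at h
  | x :: u, y :: v, h, h1, h2 => by
    simp only [List.map_cons, List.cons.injEq] at h
    by_cases hx : x.1 < r
    · have hy : y.1 < r := by simpa [hx] using h.1
      simp only [rowsOf, List.filter_cons, hx, hy, decide_true, if_true, List.cons.injEq,
        not_le.2 hx, not_le.2 hy, decide_false] at h1 h2
      rw [h1.1, eq_of_rowsOf_eq r h.2 h1.2 h2]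
    · have hy : ¬ y.1 < r := by simpa [hx] using h.1
      simp only [rowsOf, List.filter_cons, hx, hy, decide_true, if_true, List.cons.injEq,
        not_lt.1 hx, not_lt.1 hy, decide_false] at h1 h2
      rw [h2.1, eq_of_rowsOf_eq r h.2 h1 h2.2]

theorem rowsOf_ge_eq_of_relabel_eq {r : ℕ} {u v : Table}
    (h : relabel (fun m => m - r) (rowsOf (r ≤ ·) u) = relabel (fun m => m - r) (rowsOf (r ≤ ·) v)) :
    rowsOf (r ≤ ·) u = rowsOf (r ≤ ·) v := by
  have key : ∀ w : Table, relabel (fun m => m + r) (relabel (fun m => m - r) (rowsOf (r ≤ ·) w)) =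
      rowsOf (r ≤ ·) w := by
    intro w
    rw [relabel_relabel]
    refine relabel_eq_self fun m hm => ?_
    rw [rowSet_rowsOf, mem_filter] at hm
    simp only [Function.comp_apply]
    omega
  rw [← key u, h, key]

end Table

namespace OrdPart

open Coalgebra

theorem std_append_mem (x y : Table) : std (x ++ y) ∈ shiftedShuffle (std x) (std y) := by
  rw [mem_shiftedShuffle]
  simp only [size_std, List.length_append, firstCols_std, lastCols_std, true_and]
  simp

theorem exists_glue {l : SignedOrdPart} {a k : ℕ} (ha : a ≤ l.numParts) {A B : Table}
    (hA : pack A = (rows (· < a) l).table) (hk : ∀ m ∈ rowSet A, m < k)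
    (hB : pack B = (rows (a ≤ ·) l).table) :
    ∃ h : ℕ → ℕ, StrictMonoOn h (rowSet l.table) ∧
      rowsOf (· < k) (relabel h l.table) = A ∧
      rowsOf (k ≤ ·) (relabel h l.table) = relabel (fun m => k + m) B := by
  obtain ⟨f, hf, hfA⟩ := exists_relabel_pack A
  obtain ⟨g, hg, hgB⟩ := exists_relabel_pack B
  rw [hA, rows_lt_table ha] at hf hfA
  rw [hB, rows_ge_table] at hg hgB
  rw [rowSet_rowsOf_lt ha] at hf
  have hfk : ∀ x < a, f x < k := by
    intro x hx
    refine hk _ ?_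
    rw [hfA, rowSet_relabel, rowSet_rowsOf_lt ha]
    exact mem_image_of_mem _ (mem_range.2 hx)
  have hmem : ∀ x, a ≤ x → x < l.numParts →
      x - a ∈ rowSet (relabel (fun m => m - a) (rowsOf (a ≤ ·) l.table)) := by
    intro x hx hxl
    rw [rowSet_relabel, rowSet_rowsOf, rowSet_table]
    exact mem_image.2 ⟨x, by simp [hx, hxl], rfl⟩
  refine ⟨fun x => if x < a then f x else k + g (x - a), ?_, ?_, ?_⟩
  · intro x hx y hy hxy
    rw [mem_coe, mem_rowSet_table] at hx hy
    by_cases hya : y < a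
    · have hxa : x < a := by omega
      simp only [hxa, hya, if_true]
      exact hf (by simpa using hxa) (by simpa using hya) hxy
    · by_cases hxa : x < a
      · simp only [hxa, hya, if_true, if_false]
        have := hfk x hxa
        omega
      · simp only [hxa, hya, if_false]
        have := hg (hmem x (by omega) hx) (hmem y (by omega) hy) (by omega : x - a < y - a)
        omega
  · rw [rowsOf_relabel]
    conv_rhs => rw [hfA]
    rw [rowsOf_congr (q := (· < a))]
    · refine relabel_congr fun m hm => ?_
      rw [rowSet_rowsOf, mem_filter] at hm
      simp [hm.2]
    · intro m _
      by_cases h : m < a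
      · simp [h, hfk m h]
      · simp [h]
  · rw [rowsOf_relabel]
    conv_rhs => rw [hgB]
    rw [relabel_relabel, relabel_relabel, rowsOf_congr (q := (a ≤ ·))]
    · refine relabel_congr fun m hm => ?_
      rw [rowSet_rowsOf, mem_filter] at hm
      simp [not_lt.2 hm.2]
    · intro m _
      by_cases h : m < a
      · simp [not_le.2 (hfk m h), not_le.2 h, h]
      · simp [h, not_lt.1 h]

variable {K : Type*} [CommRing K]

theorem comul_mul_F (l l' : SignedOrdPart) : comul (R := K) (F K l * F K l') =
    comul (R := K) (F K l) * comul (R := K) (F K l') := by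
  have e1 : comul (R := K) (F K l * F K l') =
      ∑ x ∈ (shiftedShuffle l l').sigma (fun m => range (m.numParts + 1)),
        F K (rows (· < x.2) x.1) ⊗ₜ[K] F K (rows (x.2 ≤ ·) x.1) := by
    rw [F_mul_F, map_sum, sum_sigma]
    exact sum_congr rfl fun m _ => comul_F' m
  have e2 : comul (R := K) (F K l) * comul (R := K) (F K l') =
      ∑ x ∈ (range (l.numParts + 1) ×ˢ range (l'.numParts + 1)).sigma (fun ab =>
        shiftedShuffle (rows (· < ab.1) l) (rows (· < ab.2) l') ×ˢ
          shiftedShuffle (rows (ab.1 ≤ ·) l) (rows (ab.2 ≤ ·) l')),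
        F K x.2.1 ⊗ₜ[K] F K x.2.2 := by
    rw [comul_F', comul_F', sum_mul_sum, ← sum_product', sum_sigma]
    refine sum_congr rfl fun ab _ => ?_
    rw [Algebra.TensorProduct.tmul_mul_tmul, F_mul_F, F_mul_F, TensorProduct.sum_tmul, sum_product]
    exact sum_congr rfl fun m _ => TensorProduct.tmul_sum _ _ _
  rw [e1, e2]
  have split : ∀ {m : SignedOrdPart}, m ∈ shiftedShuffle l l' →
      std (m.table.take l.size) = l ∧ std (m.table.drop l.size) = l' := fun h =>
    (mem_shiftedShuffle.1 h).2
  refine sum_bij (fun x _ => ⟨(rank (x.1.table.take l.size) x.2, rank (x.1.table.drop l.size) x.2),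
    (rows (· < x.2) x.1, rows (x.2 ≤ ·) x.1)⟩) ?_ ?_ ?_ (fun _ _ => rfl)
  · rintro ⟨m, r⟩ h
    rw [mem_sigma] at h
    obtain ⟨h1, h2⟩ := split h.1
    set u := m.table.take l.size with hu
    set v := m.table.drop l.size with hv
    have huv : m.table = u ++ v := (List.take_append_drop _ _).symm
    have hl1 : rows (· < rank u r) l = std (rowsOf (· < r) u) := by
      rw [← h1]; exact SignedOrdPart.ext (pack_rowsOf_pack_lt u r)
    have hl2 : rows (rank u r ≤ ·) l = std (rowsOf (r ≤ ·) u) := by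
      rw [← h1]; exact SignedOrdPart.ext (pack_rowsOf_pack_ge u r)
    have hl1' : rows (· < rank v r) l' = std (rowsOf (· < r) v) := by
      rw [← h2]; exact SignedOrdPart.ext (pack_rowsOf_pack_lt v r)
    have hl2' : rows (rank v r ≤ ·) l' = std (rowsOf (r ≤ ·) v) := by
      rw [← h2]; exact SignedOrdPart.ext (pack_rowsOf_pack_ge v r)
    simp only [mem_sigma, mem_product, mem_range]
    refine ⟨⟨?_, ?_⟩, ?_, ?_⟩
    · rw [← h1, numParts_std, Nat.lt_succ_iff]
      exact card_filter_le _ _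
    · rw [← h2, numParts_std, Nat.lt_succ_iff]
      exact card_filter_le _ _
    · rw [hl1, hl1', rows, huv, rowsOf_append]
      exact std_append_mem _ _
    · rw [hl2, hl2', rows, huv, rowsOf_append]
      exact std_append_mem _ _
  · rintro ⟨m, r⟩ h ⟨m', r'⟩ h' e
    simp only [mem_sigma, mem_range] at h h'
    simp only [Sigma.mk.injEq, Prod.mk.injEq, heq_eq_eq] at e
    obtain ⟨⟨ea, eb⟩, eα, eβ⟩ := e
    have hr : r = r' := by
      have := congrArg numParts eα
      rwa [numParts_rows_lt (by omega), numParts_rows_lt (by omega)] at this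
    subst hr
    have hm : m = m' := by
      refine SignedOrdPart.ext (eq_of_rowsOf_eq r ?_ ?_ ?_)
      · obtain ⟨h1, h2⟩ := split h.1
        obtain ⟨h1', h2'⟩ := split h'.1
        have k1 := map_lt_pack (m.table.take l.size) r
        have k2 := map_lt_pack (m.table.drop l.size) r
        have k1' := map_lt_pack (m'.table.take l.size) r
        have k2' := map_lt_pack (m'.table.drop l.size) r
        have q1 : pack (m.table.take l.size) = pack (m'.table.take l.size) :=
          congrArg table (h1.trans h1'.symm)
        have q2 : pack (m.table.drop l.size) = pack (m'.table.drop l.size) :=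
          congrArg table (h2.trans h2'.symm)
        rw [← List.take_append_drop l.size m.table, ← List.take_append_drop l.size m'.table,
          List.map_append, List.map_append, ← k1, ← k2, ← k1', ← k2', q1, q2, ea, eb]
      · have := congrArg table eα
        rwa [rows_lt_table (by omega), rows_lt_table (by omega)] at this
      · have := congrArg table eβ
        rw [rows_ge_table, rows_ge_table] at this
        exact rowsOf_ge_eq_of_relabel_eq this
    rw [hm]
  · rintro ⟨⟨a, b⟩, ⟨α, β⟩⟩ h
    simp only [mem_sigma, mem_product, mem_range, mem_shiftedShuffle] at h
    obtain ⟨⟨ha, hb⟩, ⟨hα, hα1, hα2⟩, ⟨hβ, hβ1, hβ2⟩⟩ := h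
    set s := (rows (· < a) l).size with hs
    set t := (rows (a ≤ ·) l).size with ht
    have hαk : ∀ m ∈ rowSet α.table, m < α.numParts := fun m hm => mem_rowSet_table.1 hm
    obtain ⟨f, hf, hf1, hf2⟩ := exists_glue (l := l) (a := a) (k := α.numParts) (by omega)
      (congrArg table hα1) (fun m hm => hαk m (rowSet_take_subset _ _ hm)) (congrArg table hβ1)
    obtain ⟨g, hg, hg1, hg2⟩ := exists_glue (l := l') (a := b) (k := α.numParts) (by omega)
      (congrArg table hα2) (fun m hm => hαk m (rowSet_drop_subset _ _ hm)) (congrArg table hβ2)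
    set M := relabel f l.table ++ relabel g l'.table with hM
    have hM1 : rowsOf (· < α.numParts) M = α.table := by
      rw [hM, rowsOf_append, hf1, hg1, List.take_append_drop]
    have hM2 : rowsOf (α.numParts ≤ ·) M = relabel (fun m => α.numParts + m) β.table := by
      rw [hM, rowsOf_append, hf2, hg2, ← relabel_append, List.take_append_drop]
    have hMr : rowSet M = range (α.numParts + β.numParts) := by
      have e : rowSet M = rowSet (rowsOf (· < α.numParts) M) ∪
          rowSet (rowsOf (α.numParts ≤ ·) M) := by
        rw [rowSet_rowsOf, rowSet_rowsOf]
        ext x; simp only [mem_union, mem_filter]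
        have := lt_or_ge x α.numParts
        tauto
      rw [e, hM1, hM2, rowSet_relabel, rowSet_table, rowSet_table]
      ext x; simp only [mem_union, mem_range, mem_image]
      constructor
      · rintro (h | ⟨y, hy, rfl⟩) <;> omega
      · intro h
        rcases lt_or_ge x α.numParts with h' | h'
        · exact Or.inl h'
        · exact Or.inr ⟨x - α.numParts, by omega, by omega⟩
    let m : SignedOrdPart := ⟨M, packed_of_rowSet_eq_range hMr⟩
    have hmk : m.numParts = α.numParts + β.numParts := by
      change (rowSet M).card = _
      rw [hMr, card_range]
    have htake : m.table.take l.size = relabel f l.table := by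
      change List.take l.table.length (relabel f l.table ++ relabel g l'.table) = _
      rw [← length_relabel f l.table, List.take_left]
    have hdrop : m.table.drop l.size = relabel g l'.table := by
      change List.drop l.table.length (relabel f l.table ++ relabel g l'.table) = _
      rw [← length_relabel f l.table, List.drop_left]
    refine ⟨⟨m, α.numParts⟩, ?_, ?_⟩
    · simp only [mem_sigma, mem_range, mem_shiftedShuffle]
      refine ⟨⟨?_, ?_, ?_⟩, by omega⟩
      · change List.length (relabel f l.table ++ relabel g l'.table) = _
        rw [List.length_append, length_relabel, length_relabel]; rfl
      · rw [firstCols, htake, std_relabel hf, std_table]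
      · rw [lastCols, hdrop, std_relabel hg, std_table]
    · have hra : rank (m.table.take l.size) α.numParts = a := by
        rw [htake, rank_eq_numRows, hf1, ← numParts_std]
        change (firstCols s α).numParts = a
        rw [hα1, numParts_rows_lt (by omega)]
      have hrb : rank (m.table.drop l.size) α.numParts = b := by
        rw [hdrop, rank_eq_numRows, hg1, ← numParts_std]
        change (lastCols s α).numParts = b
        rw [hα2, numParts_rows_lt (by omega)]
      have h1 : rows (· < α.numParts) m = α := by
        refine SignedOrdPart.ext ?_
        rw [rows_lt_table (by omega)]
        exact hM1
      have h2 : rows (α.numParts ≤ ·) m = β := by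
        rw [rows]
        change std (rowsOf (α.numParts ≤ ·) M) = β
        rw [hM2, std_relabel, std_table]
        intro x _ y _ h
        simpa using h
      simp only [hra, hrb, h1, h2]

theorem convolutionPairs_empty :
    convolutionPairs SignedOrdPart.empty = {(SignedOrdPart.empty, SignedOrdPart.empty)} := by
  have : SignedOrdPart.empty.numParts = 0 := rfl
  rw [convolutionPairs, this, zero_add, range_one, image_singleton]
  rfl

noncomputable instance : Bialgebra K (OrdPart K) :=
  Bialgebra.mk' K (OrdPart K)
    (by rw [one_eq_F]; exact (counit_F _).trans (if_pos rfl))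
    (by
      intro x y
      have h : (LinearMap.mul K (OrdPart K)).compr₂ (counit (R := K)) =
          (LinearMap.mul K K).compl₁₂ (counit (R := K)) (counit (R := K)) := by
        refine hom_ext fun l => hom_ext fun l' => ?_
        simp only [LinearMap.compr₂_apply, LinearMap.compl₁₂_apply, LinearMap.mul_apply']
        rw [F_mul_F, map_sum]
        by_cases h : l = SignedOrdPart.empty
        · subst h
          rw [shiftedShuffle_empty_left, sum_singleton, counit_F, counit_F, if_pos rfl, one_mul]
        · rw [counit_F l, if_neg h, zero_mul]
          refine sum_eq_zero fun m hm => (counit_F m).trans (if_neg ?_)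
          rintro rfl
          have := (mem_shiftedShuffle.1 hm).1
          rw [size_empty] at this
          exact h (size_eq_zero.1 (by omega))
      exact LinearMap.congr_fun (LinearMap.congr_fun h x) y)
    (by
      rw [one_eq_F]
      refine (comul_F _).trans ?_
      rw [convolutionPairs_empty, sum_singleton]
      rfl)
    (by
      intro x y
      have h : (LinearMap.mul K (OrdPart K)).compr₂ (comul (R := K)) =
          (LinearMap.mul K (OrdPart K ⊗[K] OrdPart K)).compl₁₂ (comul (R := K))
            (comul (R := K)) := by
        refine hom_ext fun l => hom_ext fun l' => ?_
        exact comul_mul_F l l'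
      exact LinearMap.congr_fun (LinearMap.congr_fun h x) y)

open WithConv

variable (K) in
noncomputable def convDefect : WithConv (OrdPart K →ₗ[K] OrdPart K) := 1 - toConv LinearMap.id

theorem convMul_F (f g : WithConv (OrdPart K →ₗ[K] OrdPart K)) (m : SignedOrdPart) :
    (f * g) (F K m) = ∑ r ∈ range (m.numParts + 1),
      f (F K (rows (· < r) m)) * g (F K (rows (r ≤ ·) m)) := by
  rw [LinearMap.convMul_apply]
  rw [show (comul (R := K) (F K m) : OrdPart K ⊗[K] OrdPart K) = _ from comul_F' m]
  simp

theorem convDefect_empty : convDefect K (F K SignedOrdPart.empty) = 0 := by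
  change algebraMap K (OrdPart K) (counit (R := K) (F K SignedOrdPart.empty)) -
    F K SignedOrdPart.empty = 0
  rw [show counit (R := K) (F K SignedOrdPart.empty) = 1 from (counit_F _).trans (if_pos rfl),
    map_one, one_eq_F, sub_self]

theorem convDefect_pow_F (n : ℕ) : ∀ m : SignedOrdPart, m.numParts < n →
    (convDefect K ^ n) (F K m) = 0 := by
  induction n with
  | zero => intro m h; omega
  | succ n ih =>
    intro m h
    rw [pow_succ, convMul_F]
    refine sum_eq_zero fun r hr => ?_
    rw [mem_range] at hr
    by_cases hrm : r = m.numParts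
    · rw [(rows_ge_eq_empty (by omega)).2 hrm, convDefect_empty, mul_zero]
    · rw [ih _ (by rw [numParts_rows_lt (by omega)]; omega), zero_mul]

variable (K) in
noncomputable def antipodeMap : OrdPart K →ₗ[K] OrdPart K :=
  (basisF K).constr K fun m => ∑ n ∈ range (m.numParts + 1), (convDefect K ^ n) (F K m)

theorem sum_apply_F (N : ℕ) (m : SignedOrdPart) :
    (∑ n ∈ range N, convDefect K ^ n : WithConv (OrdPart K →ₗ[K] OrdPart K)) (F K m) =
      ∑ n ∈ range N, (convDefect K ^ n) (F K m) := by
  induction N with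
  | zero => rfl
  | succ N ih => rw [sum_range_succ, sum_range_succ, ← ih]; rfl

theorem antipodeMap_F {N : ℕ} (m : SignedOrdPart) (h : m.numParts < N) : antipodeMap K (F K m) =
    (∑ n ∈ range N, convDefect K ^ n : WithConv (OrdPart K →ₗ[K] OrdPart K)) (F K m) := by
  rw [sum_apply_F]
  simp only [antipodeMap]
  rw [F, Module.Basis.constr_basis]
  refine sum_subset (range_mono (by omega)) fun n _ hn => ?_
  exact convDefect_pow_F n m (by simpa using hn)

theorem id_eq : (toConv LinearMap.id : WithConv (OrdPart K →ₗ[K] OrdPart K)) =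
    1 - convDefect K := by rw [convDefect, sub_sub_cancel]

theorem one_sub_pow_F (m : SignedOrdPart) :
    (1 - convDefect K ^ (m.numParts + 1)) (F K m) =
      (1 : WithConv (OrdPart K →ₗ[K] OrdPart K)) (F K m) := by
  change (1 : WithConv (OrdPart K →ₗ[K] OrdPart K)) (F K m) -
    (convDefect K ^ (m.numParts + 1)) (F K m) = _
  rw [convDefect_pow_F _ _ (Nat.lt_succ_self _), sub_zero]

noncomputable instance : HopfAlgebra K (OrdPart K) :=
  HopfAlgebra.ofConvInverse (antipodeMap K)
    (by
      refine WithConv.ext (hom_ext fun m => ?_)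
      have h : (toConv (antipodeMap K) * toConv LinearMap.id :
          WithConv (OrdPart K →ₗ[K] OrdPart K)) (F K m) =
          ((∑ n ∈ range (m.numParts + 1), convDefect K ^ n) *
            (toConv LinearMap.id : WithConv (OrdPart K →ₗ[K] OrdPart K))) (F K m) := by
        rw [convMul_F, convMul_F]
        refine sum_congr rfl fun r hr => ?_
        rw [mem_range] at hr
        congr 1
        exact antipodeMap_F _ (by rw [numParts_rows_lt (by omega)]; omega)
      refine h.trans ?_
      rw [id_eq, geom_sum_mul_neg]
      exact one_sub_pow_F m)
    (by
      refine WithConv.ext (hom_ext fun m => ?_)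
      have h : (toConv LinearMap.id * toConv (antipodeMap K) :
          WithConv (OrdPart K →ₗ[K] OrdPart K)) (F K m) =
          ((toConv LinearMap.id : WithConv (OrdPart K →ₗ[K] OrdPart K)) *
            (∑ n ∈ range (m.numParts + 1), convDefect K ^ n)) (F K m) := by
        rw [convMul_F, convMul_F]
        refine sum_congr rfl fun r hr => ?_
        rw [mem_range] at hr
        congr 1
        exact antipodeMap_F _ (by rw [numParts_rows_ge]; omega)
      refine h.trans ?_
      rw [id_eq, mul_neg_geom_sum]
      exact one_sub_pow_F m)

end OrdPart

/-! ### Schröder-Cambrian trees -/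

/-- Signatures in `{+,-}^n`: lists of signs `1` and `-1`. -/
abbrev Signature : Type := List ℤˣ

/-- The sign of `i ∈ {1, …, n}`. -/
def Signature.sign (e : Signature) (i : ℕ) : ℤˣ := e.getD (i - 1) 1

/-- A directed graph whose vertices are identified with their labels, which are finite sets of
integers; an arc `(v, w)` is directed from `v` (below) to `w` (above). -/
structure LabeledDigraph where
  nodes : Finset (Finset ℕ)
  arcs : Finset (Finset ℕ × Finset ℕ)

namespace LabeledDigraph

/-- The underlying undirected graph. -/
def graph (D : LabeledDigraph) : SimpleGraph {v : Finset ℕ // v ∈ D.nodes} :=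
  SimpleGraph.fromRel fun v w => (v.1, w.1) ∈ D.arcs

/-- The subtree attached to `v` through its neighbor `w`: the component of `w` once `v w` is cut. -/
def branch (D : LabeledDigraph) (v w : {v : Finset ℕ // v ∈ D.nodes}) :
    Set {v : Finset ℕ // v ∈ D.nodes} :=
  {u | (D.graph.deleteEdges {s(v, w)}).Reachable w u}

end LabeledDigraph

/-- The `k`-th (`0 ≤ k ≤ |X|`) of the `|X| + 1` intervals of `[n] ∖ X`, from left to right; it may
be empty. -/
def gap (n : ℕ) (X : Finset ℕ) (k : ℕ) : Finset ℕ :=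
  (Icc 1 n \ X).filter fun x => (X.filter (· < x)).card = k

/-- The elements of `X` of sign `s`. -/
def signPart (e : Signature) (s : ℤˣ) (X : Finset ℕ) : Finset ℕ := X.filter fun x => e.sign x = s

/-- Schröder `e`-Cambrian trees: directed trees whose vertices are labeled by nonempty sets
partitioning `[n]`, such that every vertex `v` has one incoming (resp. outgoing) subtree for each
interval `I` of `[n]` deprived of the negative (resp. positive) elements of `v`, with all labels
contained in `I`. Such a subtree may be a mere leaf; leaves carry no label and are not recorded, so
that each interval is used by at most one arc. For `n = 0` the only tree has no vertex. -/
structure IsSchroderCambrianTree (e : Signature) (D : LabeledDigraph) : Prop where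
  label_nonempty : ∀ v ∈ D.nodes, v.Nonempty
  label_disjoint : ∀ v ∈ D.nodes, ∀ w ∈ D.nodes, v ≠ w → Disjoint v w
  label_cover : D.nodes.biUnion id = Icc 1 e.length
  arcs_subset : D.arcs ⊆ D.nodes ×ˢ D.nodes
  arcs_asymm : ∀ v w, (v, w) ∈ D.arcs → (w, v) ∉ D.arcs
  preconnected : D.graph.Preconnected
  acyclic : D.graph.IsAcyclic
  incoming : ∀ v w : {v : Finset ℕ // v ∈ D.nodes}, (w.1, v.1) ∈ D.arcs →
    ∃ k, ∀ u ∈ D.branch v w, u.1 ⊆ gap e.length (signPart e (-1) v.1) k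
  incoming_unique : ∀ v w w', (w, v) ∈ D.arcs → (w', v) ∈ D.arcs → ∀ k,
    w ⊆ gap e.length (signPart e (-1) v) k → w' ⊆ gap e.length (signPart e (-1) v) k → w = w'
  outgoing : ∀ v w : {v : Finset ℕ // v ∈ D.nodes}, (v.1, w.1) ∈ D.arcs →
    ∃ k, ∀ u ∈ D.branch v w, u.1 ⊆ gap e.length (signPart e 1 v.1) k
  outgoing_unique : ∀ v w w', (v, w) ∈ D.arcs → (v, w') ∈ D.arcs → ∀ k,
    w ⊆ gap e.length (signPart e 1 v) k → w' ⊆ gap e.length (signPart e 1 v) k → w = w'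

/-- The type of Schröder `e`-Cambrian trees, up to isomorphism of labeled directed trees. -/
def SchroderCambrianTree (e : Signature) : Type :=
  {D : LabeledDigraph // IsSchroderCambrianTree e D}

namespace SignedOrdPart

/-- The signs of the dots, by columns from left to right. -/
def signature (l : SignedOrdPart) : Signature := l.table.map Prod.snd

/-- The row of the dot of column `i ∈ {1, …, n}`. -/
def row (l : SignedOrdPart) (i : ℕ) : ℕ := (l.table.getD (i - 1) (0, 1)).1

/-- The vertical wall of column `c` (below the dot if negative, above it if positive) crosses the
row `r`; the dots of row `r` are not counted as walls of that row. -/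
def WallAtRow (l : SignedOrdPart) (r c : ℕ) : Prop :=
  c ∈ Icc 1 l.size ∧
    ((l.signature.sign c = -1 ∧ r < l.row c) ∨ (l.signature.sign c = 1 ∧ l.row c < r))

/-- Line `h` is the horizontal line just below row `h` (so just above row `h - 1`). The wall of
column `c` crosses line `h`; the borders `0` and `n + 1` of the table are counted as walls. -/
def WallAtLine (l : SignedOrdPart) (h c : ℕ) : Prop :=
  c = 0 ∨ c = l.size + 1 ∨ (c ∈ Icc 1 l.size ∧
    ((l.signature.sign c = -1 ∧ h ≤ l.row c) ∨ (l.signature.sign c = 1 ∧ l.row c < h)))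

open Classical in
/-- The node created by the dot of column `i`: the columns of the dots of the same row which are
not separated from it by a wall. -/
noncomputable def nodeOf (l : SignedOrdPart) (i : ℕ) : Finset ℕ :=
  (Icc 1 l.size).filter fun j =>
    l.row j = l.row i ∧ ∀ c, min i j < c → c < max i j → ¬ l.WallAtRow (l.row i) c

/-- `a < b` are consecutive walls of line `h`: they bound a region of that line, which contains
exactly one strand of the insertion algorithm. -/
def IsStrand (l : SignedOrdPart) (h a b : ℕ) : Prop :=
  a < b ∧ l.WallAtLine h a ∧ l.WallAtLine h b ∧ ∀ c, a < c → c < b → ¬ l.WallAtLine h c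

/-- The region between columns `a` and `b`, just below or above the row of the dot `i`, is visible
from the node of `i`: no wall crossing that row lies between the dot and the region. -/
def Visible (l : SignedOrdPart) (i a b : ℕ) : Prop :=
  ∀ c, l.WallAtRow (l.row i) c → ¬ (i < c ∧ c ≤ a) ∧ ¬ (b ≤ c ∧ c < i)

/-- A strand produced by the node of `i` is gathered by the node of `j`, which lies higher: the
strand runs in the same region `(a, b)` of all lines between the two rows. (When a strand goes
through a row without being gathered by a node, the walls bounding it do not change; and a region
reached by a node of an intermediate row is bounded differently below and above that row.) -/
def Joined (l : SignedOrdPart) (i j : ℕ) : Prop :=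
  l.row i < l.row j ∧ ∃ a b, (∀ h, l.row i < h → h ≤ l.row j → l.IsStrand h a b) ∧
    l.Visible i a b ∧ l.Visible j a b

open Classical in
/-- The Schröder-Cambrian `P`-symbol: the tree built by the insertion algorithm, sweeping the table
from bottom to top, with the levels forgotten. -/
noncomputable def pSymbol (l : SignedOrdPart) : LabeledDigraph where
  nodes := (Icc 1 l.size).image l.nodeOf
  arcs := ((Icc 1 l.size ×ˢ Icc 1 l.size).filter fun p => l.Joined p.1 p.2).image
    fun p => (l.nodeOf p.1, l.nodeOf p.2)

end SignedOrdPart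

section SchrCamb

variable (K : Type*) [CommRing K]

open Classical in
/-- The sum of `F_λ` over the signed ordered partitions `λ` with `P`-symbol `T`. -/
noncomputable def PCamb (e : Signature) (T : SchroderCambrianTree e) : OrdPart K :=
  ∑ l ∈ (ofSize e.length).filter (fun l => l.signature = e ∧ l.pSymbol = T.1), OrdPart.F K l

/-- The span of the elements `PCamb T`, for all Schröder-Cambrian trees `T`. -/
noncomputable def SchrCamb : Submodule K (OrdPart K) :=
  Submodule.span K (Set.range fun T : Σ e : Signature, SchroderCambrianTree e => PCamb K T.1 T.2)

end SchrCamb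

/-- A subspace `S` of a Hopf algebra which is a Hopf subalgebra: it contains the unit and is stable
by product, coproduct (`Δ(S) ⊆ S ⊗ S`) and antipode. -/
structure IsHopfSubalgebra {K A : Type*} [CommRing K] [Ring A] [HopfAlgebra K A]
    (S : Submodule K A) : Prop where
  one_mem : (1 : A) ∈ S
  mul_mem : ∀ x ∈ S, ∀ y ∈ S, x * y ∈ S
  comul_mem : ∀ x ∈ S, CoalgebraStruct.comul (R := K) x ∈
    LinearMap.range (TensorProduct.map S.subtype S.subtype)
  antipode_mem : ∀ x ∈ S, HopfAlgebra.antipode K x ∈ S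

/-- Consider a convex `(n + 2)`-gon with vertices `0, …, n + 1` from left to right, where
`i ∈ {1, …, n}` is above the diagonal `[0, n + 1]` if its sign is `+` and below if its sign is `-`.
This is the set of `i ∈ {1, …, n}` lying below the line through the vertices `a < b`, where `a` and
`b` themselves are included when they are positive. -/
def belowDiagonal (e : Signature) (a b : ℕ) : Finset ℕ :=
  (Icc 1 e.length).filter fun i =>
    (a < i ∧ i < b ∧ e.sign i = -1) ∨ (i ≤ a ∧ e.sign a = 1) ∨ (b ≤ i ∧ e.sign b = 1)

/-- The associahedron of Hohlweg and Lange, obtained by keeping, among the inequalities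
`∑_{i ∈ B} x_i ≥ |B| (|B| + 1) / 2` that define the permutahedron in the hyperplane
`∑ x_i = n (n + 1) / 2`, those where `B` is the set below a diagonal of the polygon. (The edges of
the polygon give `B = ∅` or `B = [n]`, hence trivial conditions.) -/
def associahedron (e : Signature) : Set (Fin e.length → ℝ) :=
  {x | ∑ i, x i = (e.length * (e.length + 1) : ℝ) / 2 ∧
    ∀ a b : ℕ, a < b → b ≤ e.length + 1 →
      ((belowDiagonal e a b).card * ((belowDiagonal e a b).card + 1) : ℝ) / 2 ≤
        ∑ i ∈ univ.filter (fun i : Fin e.length => i.val + 1 ∈ belowDiagonal e a b), x i}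

/-- The nonempty faces of the associahedron, including the associahedron itself. -/
def AssociahedronFace (e : Signature) : Type :=
  {G : Set (Fin e.length → ℝ) // G.Nonempty ∧ IsExposed ℝ (associahedron e) G}

/-- The (outer) normal cone of the face `G` of `P`, in the hyperplane `∑ y_i = 0`. -/
def normalCone {n : ℕ} (P G : Set (Fin n → ℝ)) : Set (Fin n → ℝ) :=
  {y | ∑ i, y i = 0 ∧ ∀ x ∈ G, ∀ z ∈ P, ∑ i, y i * z i ≤ ∑ i, y i * x i}

/-- The braid cone of a tree: all `y` with `∑ y_i = 0` and `y_i ≤ y_j` whenever the node of `i` is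
below or equal to the node of `j`. -/
def braidCone {e : Signature} (T : SchroderCambrianTree e) : Set (Fin e.length → ℝ) :=
  {y | ∑ i, y i = 0 ∧ ∀ i j : Fin e.length, ∀ v ∈ T.1.nodes, ∀ w ∈ T.1.nodes,
    (i : ℕ) + 1 ∈ v → (j : ℕ) + 1 ∈ w →
      Relation.ReflTransGen (fun v w => (v, w) ∈ T.1.arcs) v w → y i ≤ y j}

end SchroderCambrian

/-! Everything rests on a description of the fibres of the P-symbol. A strict extension of a tree is
a function on the columns that is constant on labels and strictly increasing along arcs. A table has
P-symbol `T` exactly when its row function is a strict extension of `T`. The rows always extend the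
P-symbol (`isExtension_pSymbol`). Conversely, two trees of one signature with a common strict
extension coincide (`eq_of_common_extension`): a non-monotone path in a tree turns at a vertex, an
element of that vertex separates the two ends of the path, and this element rules out that the ends
are equal or adjacent in the other tree. Each tree has an extension, hence is a P-symbol. That a
P-symbol is a tree (`isSchroderCambrianTree_pSymbol`) comes from the diagonals of the strands: only
the arc carrying a strand crosses its diagonal, so each arc is a bridge and each branch lies on one
side of a diagonal.

Extending a P-symbol is a local condition: only pairs of columns that see a common cell between
adjacent columns are compared (`isExtension_pSymbol_iff`). Hence congruence, i.e. equality of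
signature and P-symbol, passes to intervals of columns (`congruent_restrict`) and is compatible with
convolution (`congruent_glue`). `SchrCamb` is the space of elements whose coefficients are constant
on congruence classes (`mem_SchrCamb_iff`), which gives stability under product and coproduct; the
antipode is a locally finite sum of convolution powers. The elements `PCamb` are independent because
their supports are disjoint and nonempty.

For the polytope, let `P` be the set of dots below a horizontal line, and add the slacks of the
diagonals joining consecutive walls of that line. On the hyperplane this total is x(P) - g(P) for a
set function g whose marginals increase with `P` (`totalSlack_insert`, `marginal_le_and_lt`). So g
is supermodular, and the associahedron is its base polytope: x([n]) = g([n]) and x(P) ≥ g(P). Greedy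
points of orderings lie in it, and Abel summation shows that the face maximizing y is cut out by the
initial sets of y (`mem_face_iff_isMax`). That face depends only on the tree extended by y
(`IsSchroderCambrianTree.face_eq`). Exchanging two adjacent columns of an ordering identifies the
normal cone (`isMaxOnSet_face_iff`), and `eq_of_common_extension` makes the map from trees to faces
injective. -/

namespace SchroderCambrian
open Finset

/-! ### Branches and gaps of Schröder-Cambrian trees -/

namespace LabeledDigraph

variable {D : LabeledDigraph}

/-- The vertices of a labeled digraph. -/
abbrev Vertex (D : LabeledDigraph) : Type := {v : Finset ℕ // v ∈ D.nodes}

/-- There is an arc from `v` to `w` if `s = 1`, from `w` to `v` if `s = -1`. -/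
def Arc (D : LabeledDigraph) (s : ℤˣ) (v w : D.Vertex) : Prop :=
  if s = 1 then (v.1, w.1) ∈ D.arcs else (w.1, v.1) ∈ D.arcs

theorem arc_one {v w : D.Vertex} : D.Arc 1 v w ↔ (v.1, w.1) ∈ D.arcs := by simp [Arc]

theorem arc_neg_one {v w : D.Vertex} : D.Arc (-1) v w ↔ (w.1, v.1) ∈ D.arcs := by
  rw [Arc, if_neg (by decide)]

theorem arc_neg {s : ℤˣ} {v w : D.Vertex} : D.Arc (-s) v w ↔ D.Arc s w v := by
  rcases Int.units_eq_one_or s with rfl | rfl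
  · rw [arc_one, arc_neg_one]
  · rw [neg_neg, arc_one, arc_neg_one]

theorem mem_branch_self (v w : D.Vertex) : w ∈ D.branch v w :=
  SimpleGraph.Reachable.refl _

theorem mem_branch_of_adj {v w u u' : D.Vertex} (hu : u ∈ D.branch v w) (h : D.graph.Adj u u')
    (hne : s(u, u') ≠ s(v, w)) : u' ∈ D.branch v w := by
  refine SimpleGraph.Reachable.trans (v := u) hu (SimpleGraph.Adj.reachable ?_)
  rw [SimpleGraph.deleteEdges_adj]
  exact ⟨h, by simpa using hne⟩

theorem mem_branch_of_adj' {v w u u' : D.Vertex} (hu : u ∈ D.branch v w) (h : D.graph.Adj u u')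
    (h1 : u ≠ v) (h2 : u' ≠ v) : u' ∈ D.branch v w :=
  mem_branch_of_adj hu h (by
    intro h'
    rw [Sym2.eq_iff] at h'
    rcases h' with h' | h'
    · exact h1 h'.1
    · exact h2 h'.2)

theorem mem_branch_of_walk {v w : D.Vertex} : ∀ {u x : D.Vertex} (p : D.graph.Walk u x),
    v ∉ p.support → u ∈ D.branch v w → x ∈ D.branch v w
  | _, _, .nil, _, h => h
  | _, _, .cons h p, hv, hu => by
    rw [SimpleGraph.Walk.support_cons, List.mem_cons, not_or] at hv
    refine mem_branch_of_walk p hv.2 (mem_branch_of_adj' hu h (Ne.symm hv.1) ?_)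
    rintro rfl
    exact hv.2 p.start_mem_support

/-- A strict extension of the order of the vertices of a digraph, as a function of the labels. -/
structure IsExtension {α : Type*} [LinearOrder α] (D : LabeledDigraph) (r : ℕ → α) : Prop where
  const : ∀ v ∈ D.nodes, ∀ i ∈ v, ∀ j ∈ v, r i = r j
  lt : ∀ v w, (v, w) ∈ D.arcs → ∀ i ∈ v, ∀ j ∈ w, r i < r j

end LabeledDigraph

open LabeledDigraph

/-- The index of a gap counts the elements of `X` on its left. Two points with different counts have
an element of `X` between them, and since the count is constant on a gap, the same element works for
all pairs. -/
theorem gap_separation {n : ℕ} {X : Finset ℕ} {k k' : ℕ} (h : k ≠ k') (hk : (gap n X k).Nonempty)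
    (hk' : (gap n X k').Nonempty) : ∃ c ∈ X,
      (∀ i ∈ gap n X k, ∀ j ∈ gap n X k', i < c ∧ c < j) ∨
      (∀ i ∈ gap n X k, ∀ j ∈ gap n X k', j < c ∧ c < i) := by
  have key : ∀ {k k' : ℕ}, k < k' → (gap n X k).Nonempty → (gap n X k').Nonempty → ∃ c ∈ X,
      (∀ i ∈ gap n X k, ∀ j ∈ gap n X k', i < c ∧ c < j) := by
    intro k k' hlt ⟨i, hi⟩ ⟨j, hj⟩
    simp only [gap, mem_filter, mem_sdiff] at *
    have mono : ∀ {x y : ℕ}, x ≤ y → (X.filter (· < x)).card ≤ (X.filter (· < y)).card :=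
      fun hxy => card_le_card fun z hz => by
        simp only [mem_filter] at *; exact ⟨hz.1, by omega⟩
    have smono : ∀ {x y : ℕ}, x ∈ X → x < y →
        (X.filter (· < x)).card < (X.filter (· < y)).card := fun hx hxy =>
      card_lt_card ((ssubset_iff_of_subset fun z hz => by
        simp only [mem_filter] at *; exact ⟨hz.1, by omega⟩).2
          ⟨_, by simpa using ⟨hx, hxy⟩, by simp⟩)
    obtain ⟨c, hc, hic, hcj⟩ : ∃ c ∈ X, i ≤ c ∧ c < j := by
      by_contra hcon
      push Not at hcon
      have : (X.filter (· < j)).card ≤ (X.filter (· < i)).card := card_le_card fun z hz => by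
        simp only [mem_filter] at *
        refine ⟨hz.1, ?_⟩
        by_contra hz'
        have := hcon z hz.1 (by omega)
        omega
      omega
    refine ⟨c, hc, fun i' hi' j' hj' => ⟨?_, ?_⟩⟩
    · by_contra hlt'
      have hne : i' ≠ c := fun e => hi'.1.2 (e ▸ hc)
      have h1 := smono hc (show c < i' by omega)
      have h2 := mono hic
      omega
    · by_contra hlt'
      have h1 := smono hc hcj
      have h2 := mono (show j' ≤ c by omega)
      omega
  rcases lt_or_gt_of_ne h with h | h
  · obtain ⟨c, hc, hh⟩ := key h hk hk'
    exact ⟨c, hc, Or.inl hh⟩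
  · obtain ⟨c, hc, hh⟩ := key h hk' hk
    exact ⟨c, hc, Or.inr fun i hi j hj => hh j hj i hi⟩

theorem mem_gap_of_between {n : ℕ} {X : Finset ℕ} {k i j c : ℕ} (hi : i ∈ gap n X k)
    (hj : j ∈ gap n X k) (hic : i < c) (hcj : c < j) : c ∉ X := by
  intro hc
  simp only [gap, mem_filter, mem_sdiff] at *
  have h1 : (X.filter (· < i)).card < (X.filter (· < j)).card :=
    card_lt_card ((ssubset_iff_of_subset fun z hz => by
      simp only [mem_filter] at *; exact ⟨hz.1, by omega⟩).2
        ⟨c, by simpa using ⟨hc, hcj⟩, by simp; omega⟩)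
  omega

namespace IsSchroderCambrianTree

variable {e : Signature} {D : LabeledDigraph} (hT : IsSchroderCambrianTree e D)

include hT

theorem adj_iff {v w : D.Vertex} : D.graph.Adj v w ↔ ∃ s, D.Arc s v w := by
  rw [LabeledDigraph.graph, SimpleGraph.fromRel_adj]
  constructor
  · rintro ⟨-, h | h⟩
    · exact ⟨1, arc_one.2 h⟩
    · exact ⟨-1, arc_neg_one.2 h⟩
  · rintro ⟨s, h⟩
    have hself : ∀ v, (v, v) ∉ D.arcs := fun v h => hT.arcs_asymm v v h h
    rcases Int.units_eq_one_or s with rfl | rfl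
    · rw [arc_one] at h
      refine ⟨?_, Or.inl h⟩
      rintro rfl; exact hself _ h
    · rw [arc_neg_one] at h
      refine ⟨?_, Or.inr h⟩
      rintro rfl; exact hself _ h

/-- The axioms for incoming and outgoing subtrees in one form: on the side `s` of a vertex, its
elements of sign `s` are the separators. The symmetry between up and down is used throughout. -/
theorem exists_branch_gap {s : ℤˣ} {v w : D.Vertex} (h : D.Arc s v w) :
    ∃ k, ∀ u ∈ D.branch v w, u.1 ⊆ gap e.length (signPart e s v.1) k := by
  rcases Int.units_eq_one_or s with rfl | rfl
  · exact hT.outgoing v w (arc_one.1 h)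
  · exact hT.incoming v w (arc_neg_one.1 h)

theorem eq_of_gap {s : ℤˣ} {v w w' : D.Vertex} (h : D.Arc s v w) (h' : D.Arc s v w') {k : ℕ}
    (hk : w.1 ⊆ gap e.length (signPart e s v.1) k)
    (hk' : w'.1 ⊆ gap e.length (signPart e s v.1) k) : w = w' := by
  rcases Int.units_eq_one_or s with rfl | rfl
  · exact Subtype.ext (hT.outgoing_unique _ _ _ (arc_one.1 h) (arc_one.1 h') k hk hk')
  · exact Subtype.ext (hT.incoming_unique _ _ _ (arc_neg_one.1 h) (arc_neg_one.1 h') k hk hk')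

theorem not_mem_branch {v w : D.Vertex} (h : D.graph.Adj v w) : v ∉ D.branch v w := fun hv =>
  SimpleGraph.isBridge_iff.1 (SimpleGraph.isAcyclic_iff_forall_adj_isBridge.1 hT.acyclic h)
    (SimpleGraph.Reachable.symm hv)

theorem ne_of_mem_branch {s : ℤˣ} {v w u : D.Vertex} (h : D.Arc s v w) (hu : u ∈ D.branch v w) :
    u ≠ v := by
  rintro rfl
  exact hT.not_mem_branch (hT.adj_iff.2 ⟨s, h⟩) hu

/-- Two distinct branches on the same side of `y` are separated by an element of `y`. -/
theorem exists_separating {s : ℤˣ} {y a b : D.Vertex} (ha : D.Arc s y a) (hb : D.Arc s y b)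
    (hab : a ≠ b) : ∃ c ∈ signPart e s y.1,
      (∀ u ∈ D.branch y a, ∀ x ∈ D.branch y b, ∀ i ∈ u.1, ∀ j ∈ x.1, i < c ∧ c < j) ∨
      (∀ u ∈ D.branch y a, ∀ x ∈ D.branch y b, ∀ i ∈ u.1, ∀ j ∈ x.1, j < c ∧ c < i) := by
  obtain ⟨k, hk⟩ := hT.exists_branch_gap ha
  obtain ⟨k', hk'⟩ := hT.exists_branch_gap hb
  have hka := hk a (mem_branch_self _ _)
  have hkb := hk' b (mem_branch_self _ _)
  have hne : k ≠ k' := by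
    rintro rfl
    exact hab (hT.eq_of_gap ha hb hka hkb)
  obtain ⟨c, hc, h | h⟩ := gap_separation hne ((hT.label_nonempty _ a.2).mono hka)
    ((hT.label_nonempty _ b.2).mono hkb)
  · exact ⟨c, hc, Or.inl fun u hu x hx i hi j hj => h i (hk u hu hi) j (hk' x hx hj)⟩
  · exact ⟨c, hc, Or.inr fun u hu x hx i hi j hj => h i (hk u hu hi) j (hk' x hx hj)⟩

theorem exists_vertex {i : ℕ} (hi : i ∈ Icc 1 e.length) : ∃ v : D.Vertex, i ∈ v.1 := by
  rw [← hT.label_cover, mem_biUnion] at hi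
  obtain ⟨v, hv, hi⟩ := hi
  exact ⟨⟨v, hv⟩, hi⟩

theorem mem_Icc {v : D.Vertex} {i : ℕ} (hi : i ∈ v.1) : i ∈ Icc 1 e.length := by
  rw [← hT.label_cover, mem_biUnion]
  exact ⟨v.1, v.2, hi⟩

theorem vertex_unique {v w : D.Vertex} {i : ℕ} (hv : i ∈ v.1) (hw : i ∈ w.1) : v = w := by
  by_contra h
  exact Finset.disjoint_left.1 (hT.label_disjoint v.1 v.2 w.1 w.2 fun h' => h (Subtype.ext h')) hv hw

end IsSchroderCambrianTree

/-! ### Paths in a tree compared with a strict extension -/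

section Extension

variable {e : Signature} {D : LabeledDigraph} {r : ℕ → ℝ}

/-- `r` compared in the direction `s`. -/
theorem LabeledDigraph.IsExtension.arc_lt (hr : D.IsExtension r) {s : ℤˣ} {v w : D.Vertex}
    (h : D.Arc s v w) {i j : ℕ} (hi : i ∈ v.1) (hj : j ∈ w.1) :
    ((s : ℤ) : ℝ) * r i < ((s : ℤ) : ℝ) * r j := by
  rcases Int.units_eq_one_or s with rfl | rfl
  · simpa using hr.lt _ _ (arc_one.1 h) i hi j hj
  · simpa using hr.lt _ _ (arc_neg_one.1 h) j hj i hi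

variable (hT : IsSchroderCambrianTree e D) (hr : D.IsExtension r)

include hT hr

theorem LabeledDigraph.IsExtension.reflTransGen_le {s : ℤˣ} {v w : D.Vertex}
    (h : Relation.ReflTransGen (D.Arc s) v w) {i j : ℕ} (hi : i ∈ v.1) (hj : j ∈ w.1) :
    ((s : ℤ) : ℝ) * r i ≤ ((s : ℤ) : ℝ) * r j := by
  induction h generalizing j with
  | refl => rw [hr.const _ v.2 i hi j hj]
  | @tail b c _ hbc ih =>
    obtain ⟨m, hm⟩ := hT.label_nonempty _ b.2
    exact (ih hm).trans (hr.arc_lt hbc hm hj).le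

theorem LabeledDigraph.IsExtension.lt_of_arc_of_reflTransGen {s : ℤˣ} {v x w : D.Vertex}
    (h : D.Arc s v x) (h' : Relation.ReflTransGen (D.Arc s) x w) {i j : ℕ} (hi : i ∈ v.1)
    (hj : j ∈ w.1) : ((s : ℤ) : ℝ) * r i < ((s : ℤ) : ℝ) * r j := by
  obtain ⟨m, hm⟩ := hT.label_nonempty _ x.2
  exact (hr.arc_lt h hi hm).trans_le (hr.reflTransGen_le hT h' hm hj)

/-- `u` and `x` lie in two distinct branches of `y`, both on the side opposite to `s`. -/
def LabeledDigraph.Turn (D : LabeledDigraph) (s : ℤˣ) (y u x : D.Vertex) : Prop :=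
  ∃ a b, D.Arc (-s) y a ∧ D.Arc (-s) y b ∧ a ≠ b ∧ u ∈ D.branch y a ∧ x ∈ D.branch y b

/-- Follow the path while its arcs keep the direction `s`. At the first vertex `y` left in the other
direction, the arc of arrival and the arc of departure are both on the side `-s` of `y`, so the ends
lie in two distinct branches there. -/
theorem monotone_or_turn_of_path {s : ℤˣ} : ∀ {u u₁ x : D.Vertex} (p : D.graph.Walk u₁ x),
    p.IsPath → u ∉ p.support → D.Arc s u u₁ → Relation.ReflTransGen (D.Arc s) u₁ x ∨
      ∃ y, Relation.ReflTransGen (D.Arc s) u₁ y ∧ D.Turn s y u x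
  | _, _, _, .nil, _, _, _ => Or.inl .refl
  | u, u₁, x, .cons (v := u₂) h p, hp, hu, hs => by
    rw [SimpleGraph.Walk.cons_isPath_iff] at hp
    rw [SimpleGraph.Walk.support_cons, List.mem_cons, not_or] at hu
    obtain ⟨s', hs'⟩ := hT.adj_iff.1 h
    by_cases hss : s' = s
    · subst hss
      rcases monotone_or_turn_of_path p hp.1 hp.2 hs' with h1 | ⟨y, h1, a, b, ha, hb, hab, h2, h3⟩
      · exact Or.inl (h1.head hs')
      -- The turn found for `u₁` also serves `u`: the vertex `u` is adjacent to `u₁` and differs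
      -- from `y`, since `r` strictly increases in direction `s` from `u` to `y`.
      · refine Or.inr ⟨y, h1.head hs', a, b, ha, hb, hab, ?_, h3⟩
        refine mem_branch_of_adj' h2 (hT.adj_iff.2 ⟨-s', arc_neg.2 hs⟩) (hT.ne_of_mem_branch ha h2) ?_
        rintro rfl
        obtain ⟨i, hi⟩ := hT.label_nonempty _ u.2
        exact lt_irrefl _ (hr.lt_of_arc_of_reflTransGen hT hs (h1.head hs') hi hi)
    · have hs'' : D.Arc (-s) u₁ u₂ := by
        rwa [Int.units_ne_iff_eq_neg.1 hss] at hs'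
      refine Or.inr ⟨u₁, .refl, u, u₂, arc_neg.2 hs, hs'', ?_, mem_branch_self _ _,
        mem_branch_of_walk p hp.2 (mem_branch_self _ _)⟩
      rintro rfl
      exact hu.2 p.start_mem_support

/-- The path from `u` to `x` starts in some direction `s`; either it is monotone, or it turns. -/
theorem monotone_or_turn {u x : D.Vertex} (hux : u ≠ x) : ∃ s q, D.Arc s u q ∧ x ∈ D.branch u q ∧
    (Relation.ReflTransGen (D.Arc s) q x ∨
      ∃ y, Relation.ReflTransGen (D.Arc s) q y ∧ D.Turn s y u x) := by
  obtain ⟨p, hp⟩ := (hT.preconnected u x).exists_isPath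
  cases p with
  | nil => exact absurd rfl hux
  | @cons _ q _ h p =>
    rw [SimpleGraph.Walk.cons_isPath_iff] at hp
    obtain ⟨s, hs⟩ := hT.adj_iff.1 h
    exact ⟨s, q, hs, mem_branch_of_walk p hp.2 (mem_branch_self _ _),
      monotone_or_turn_of_path hT hr p hp.1 hp.2 hs⟩

/-- If an element `c` of `z` lies between elements of two equal or adjacent vertices, and `c` is a
separating wall for the direction opposite to `s`, then these vertices lie in direction `s`. -/
theorem lt_or_turn_of_between {s : ℤˣ} {z v w : D.Vertex} (hvw : v = w ∨ D.graph.Adj v w)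
    (hzv : z ≠ v) (hzw : z ≠ w) {c i j : ℕ} (hc : c ∈ signPart e (-s) z.1) (hi : i ∈ v.1)
    (hj : j ∈ w.1) (hcij : (i < c ∧ c < j) ∨ (j < c ∧ c < i)) :
    ((s : ℤ) : ℝ) * r c < ((s : ℤ) : ℝ) * r i ∨ D.Turn s w z v := by
  have hcz : c ∈ z.1 := (mem_filter.1 hc).1
  have hmem : ∀ {y b : D.Vertex}, v ∈ D.branch y b → v ≠ y → w ≠ y → w ∈ D.branch y b := by
    intro y b hv h1 h2
    rcases hvw with rfl | h
    · exact hv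
    · exact mem_branch_of_adj' hv h h1 h2
  obtain ⟨s', q, hs', hq, hd⟩ := monotone_or_turn hT hr hzv
  -- If the path from `z` started on the side `-s`, then `v` and `w` would lie in one branch there,
  -- hence in one gap of the elements of sign `-s`; but `c` is such an element and lies between
  -- them.
  have hss : s' = s := by
    by_contra hne
    rw [Int.units_ne_iff_eq_neg.1 hne] at hs'
    obtain ⟨k, hk⟩ := hT.exists_branch_gap hs'
    have h1 := hk v hq hi
    have h2 := hk w (hmem hq hzv.symm hzw.symm) hj
    rcases hcij with h | h
    · exact mem_gap_of_between h1 h2 h.1 h.2 hc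
    · exact mem_gap_of_between h2 h1 h.1 h.2 hc
  subst hss
  rcases hd with hd | ⟨y, hy, ht⟩
  · exact Or.inl (hr.lt_of_arc_of_reflTransGen hT hs' hd hcz hi)
  · by_cases hwy : w = y
    · exact Or.inr (hwy ▸ ht)
    -- If `w ≠ y`, then `w` follows `v` into its branch of `y`, so a single element of `y` separates
    -- `c` from both `i` and `j`, which is impossible as `c` lies between them.
    · exfalso
      obtain ⟨a, b, ha, hb, hab, hza, hvb⟩ := ht
      have hwb := hmem hvb (hT.ne_of_mem_branch hb hvb) hwy
      obtain ⟨c', -, h' | h'⟩ := hT.exists_separating ha hb hab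
      · have h1 := h' z hza v hvb c hcz i hi
        have h2 := h' z hza w hwb c hcz j hj
        omega
      · have h1 := h' z hza v hvb c hcz i hi
        have h2 := h' z hza w hwb c hcz j hj
        omega

/-- The case `v = w` of `lt_or_turn_of_between`; the turn is excluded because no vertex lies in one
of its own branches. -/
theorem not_between_of_mem {s : ℤˣ} {z v : D.Vertex} {c i j : ℕ} (hc : c ∈ signPart e (-s) z.1)
    (hi : i ∈ v.1) (hj : j ∈ v.1) (hcij : (i < c ∧ c < j) ∨ (j < c ∧ c < i)) :
    ¬ ((s : ℤ) : ℝ) * r i < ((s : ℤ) : ℝ) * r c := by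
  intro hlt
  have hcz : c ∈ z.1 := (mem_filter.1 hc).1
  have hzv : z ≠ v := by
    rintro rfl
    rw [hr.const _ z.2 i hi c hcz] at hlt
    exact lt_irrefl _ hlt
  rcases lt_or_turn_of_between hT hr (Or.inl rfl) hzv hzv hc hi hj hcij with h | ⟨a, b, -, hb, -, -, h⟩
  · exact lt_asymm h hlt
  · exact hT.ne_of_mem_branch hb h rfl

end Extension

/-! ### A tree is determined by any of its strict extensions -/

section Uniqueness

variable {e : Signature} {D D' : LabeledDigraph} {r : ℕ → ℝ}

/-- In `D'` a monotone path between the two vertices contradicts the equality of levels, and a turn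
provides a separating element lying beyond both, which `not_between_of_mem` forbids in `D`. -/
theorem vertex_eq_of_common_extension (hT : IsSchroderCambrianTree e D) (hr : D.IsExtension r)
    (hT' : IsSchroderCambrianTree e D') (hr' : D'.IsExtension r) {v : D.Vertex} {v' w' : D'.Vertex}
    {i j : ℕ} (hi : i ∈ v.1) (hj : j ∈ v.1) (hi' : i ∈ v'.1) (hj' : j ∈ w'.1) : v' = w' := by
  by_contra hne
  obtain ⟨s, q, hs, -, hd | ⟨y, hy, a, b, ha, hb, hab, hva, hwb⟩⟩ := monotone_or_turn hT' hr' hne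
  · have := hr'.lt_of_arc_of_reflTransGen hT' hs hd hi' hj'
    rw [hr.const _ v.2 i hi j hj] at this
    exact lt_irrefl _ this
  · obtain ⟨c, hc, h⟩ := hT'.exists_separating ha hb hab
    have hcy : c ∈ y.1 := (mem_filter.1 hc).1
    have hlt := hr'.lt_of_arc_of_reflTransGen hT' hs hy hi' hcy
    obtain ⟨z, hz⟩ := hT.exists_vertex (hT'.mem_Icc hcy)
    refine not_between_of_mem hT hr (z := z) (c := c) (s := s)
      (mem_filter.2 ⟨hz, (mem_filter.1 hc).2⟩) hi hj ?_ hlt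
    exact h.imp (fun h => h _ hva _ hwb i hi' j hj') fun h => h _ hva _ hwb i hi' j hj'

theorem nodes_subset_of_common_extension (hT : IsSchroderCambrianTree e D) (hr : D.IsExtension r)
    (hT' : IsSchroderCambrianTree e D') (hr' : D'.IsExtension r) : D.nodes ⊆ D'.nodes := by
  intro v hv
  obtain ⟨i, hi⟩ := hT.label_nonempty v hv
  obtain ⟨v', hi'⟩ := hT'.exists_vertex (hT.mem_Icc (v := ⟨v, hv⟩) hi)
  have : v = v'.1 := by
    ext j
    constructor
    · intro hj
      obtain ⟨w', hj'⟩ := hT'.exists_vertex (hT.mem_Icc (v := ⟨v, hv⟩) hj)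
      rwa [vertex_eq_of_common_extension hT hr hT' hr' (v := ⟨v, hv⟩) hi hj hi' hj']
    · intro hj
      obtain ⟨w, hj'⟩ := hT.exists_vertex (hT'.mem_Icc hj)
      have := vertex_eq_of_common_extension hT' hr' hT hr (v' := ⟨v, hv⟩) hi' hj hi hj'
      rwa [← this] at hj'
  rw [this]; exact v'.2

/-- An arc of one tree becomes a directed path of the other: a turn in `D'` at a vertex containing a
separator `c` is refuted in `D` by `lt_or_turn_of_between`. -/
theorem monotone_of_arc_of_common_extension (hT : IsSchroderCambrianTree e D)
    (hr : D.IsExtension r) (hT' : IsSchroderCambrianTree e D') (hr' : D'.IsExtension r)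
    (hn : D.nodes = D'.nodes) {v w : D.Vertex} (h : D.Arc 1 v w) :
    Relation.TransGen (D'.Arc 1) ⟨v.1, hn ▸ v.2⟩ ⟨w.1, hn ▸ w.2⟩ := by
  have hadj := hT.adj_iff.2 ⟨1, h⟩
  obtain ⟨i, hi⟩ := hT.label_nonempty _ v.2
  obtain ⟨j, hj⟩ := hT.label_nonempty _ w.2
  have hrij : r i < r j := by simpa using hr.arc_lt h hi hj
  obtain ⟨s, q, hs, -, hd | ⟨y, hy, a, b, ha, hb, hab, hva, hwb⟩⟩ :=
    monotone_or_turn hT' hr' (u := ⟨v.1, hn ▸ v.2⟩) (x := ⟨w.1, hn ▸ w.2⟩)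
      (fun h => hadj.ne (Subtype.ext (Subtype.mk.inj h)))
  · rcases Int.units_eq_one_or s with rfl | rfl
    · exact Relation.TransGen.head' hs hd
    · have := hr'.lt_of_arc_of_reflTransGen hT' hs hd hi hj
      simp only [Units.val_neg, Units.val_one, Int.reduceNeg, Int.cast_neg, Int.cast_one, neg_mul,
        one_mul, neg_lt_neg_iff] at this
      exact absurd this (not_lt.2 hrij.le)
  · exfalso
    obtain ⟨c, hc, hsep⟩ := hT'.exists_separating ha hb hab
    have hcy : c ∈ y.1 := (mem_filter.1 hc).1
    have hlt := hr'.lt_of_arc_of_reflTransGen hT' hs hy hi hcy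
    have hne1 := hT'.ne_of_mem_branch ha hva
    have hne2 := hT'.ne_of_mem_branch hb hwb
    set z : D.Vertex := ⟨y.1, by rw [hn]; exact y.2⟩ with hz
    rcases lt_or_turn_of_between hT hr (z := z) (s := s) (Or.inr hadj)
      (fun h => hne1 (Subtype.ext (congrArg Subtype.val h).symm))
      (fun h => hne2 (Subtype.ext (congrArg Subtype.val h).symm)) hc hi hj
      (hsep.imp (fun h => h _ hva _ hwb i hi j hj) fun h => h _ hva _ hwb i hi j hj) with
      h1 | ⟨a', b', ha', hb', hab', hza, hvb⟩
    · exact lt_asymm h1 hlt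
    · obtain ⟨c', hc', hsep'⟩ := hT.exists_separating ha' hb' hab'
      have hcw : c' ∈ w.1 := (mem_filter.1 hc').1
      -- Both turns at once are impossible: `c` would lie between `i` and `c'`, and `c'` between `c`
      -- and `i`.
      have h1 := hsep.imp (fun h => h _ hva _ hwb i hi c' hcw) fun h => h _ hva _ hwb i hi c' hcw
      have h2 := hsep'.imp (fun h => h _ hza _ hvb c hcy i hi) fun h => h _ hza _ hvb c hcy i hi
      omega

/-- The endpoints of an arc of a tree are not joined by another monotone path. -/
theorem IsSchroderCambrianTree.not_transGen_transGen (hT : IsSchroderCambrianTree e D)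
    (hr : D.IsExtension r) {v x w : D.Vertex} (h : D.Arc 1 v w)
    (h1 : Relation.TransGen (D.Arc 1) v x) (h2 : Relation.TransGen (D.Arc 1) x w) : False := by
  have lt : ∀ {u u' : D.Vertex}, Relation.TransGen (D.Arc 1) u u' → ∀ {i j : ℕ}, i ∈ u.1 →
      j ∈ u'.1 → r i < r j := by
    intro u u' hu i j hi hj
    obtain ⟨q, hq, hq'⟩ := Relation.TransGen.head'_iff.1 hu
    simpa using hr.lt_of_arc_of_reflTransGen hT hq hq' hi hj
  -- A directed path avoids the edge `v w` if it starts strictly above `v` or ends strictly below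
  -- `w`. The two halves of a detour through `x` satisfy one condition each, so together they
  -- contradict that `v w` is a bridge.
  have key : ∀ {u u' : D.Vertex}, Relation.TransGen (D.Arc 1) u u' →
      (∀ i ∈ u.1, ∀ j ∈ v.1, r j < r i) ∨ (∀ i ∈ u'.1, ∀ j ∈ w.1, r i < r j) →
      (D.graph.deleteEdges {s(v, w)}).Reachable u u' := by
    intro u u' hu
    induction hu using Relation.TransGen.head_induction_on with
    | @single a ha =>
      intro hh
      refine SimpleGraph.Adj.reachable ?_
      rw [SimpleGraph.deleteEdges_adj]
      refine ⟨hT.adj_iff.2 ⟨1, ha⟩, ?_⟩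
      obtain ⟨i, hi⟩ := hT.label_nonempty _ a.2
      obtain ⟨j, hj⟩ := hT.label_nonempty _ u'.2
      have hij : r i < r j := by simpa using hr.arc_lt ha hi hj
      intro he
      rw [Set.mem_singleton_iff, Sym2.eq_iff] at he
      rcases he with ⟨rfl, rfl⟩ | ⟨rfl, rfl⟩
      · rcases hh with hh | hh
        · exact lt_irrefl _ (hh i hi i hi)
        · exact lt_irrefl _ (hh j hj j hj)
      · rcases hh with hh | hh
        · exact lt_asymm hij (hh i hi j hj)
        · exact lt_asymm hij (hh j hj i hi)
    | @head a c ha hc ih =>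
      intro hh
      obtain ⟨i, hi⟩ := hT.label_nonempty _ a.2
      obtain ⟨j, hj⟩ := hT.label_nonempty _ c.2
      obtain ⟨m, hm⟩ := hT.label_nonempty _ u'.2
      have hij : r i < r j := by simpa using hr.arc_lt ha hi hj
      have hjm := lt hc hj hm
      refine SimpleGraph.Reachable.trans (v := c) (SimpleGraph.Adj.reachable ?_) (ih ?_)
      · rw [SimpleGraph.deleteEdges_adj]
        refine ⟨hT.adj_iff.2 ⟨1, ha⟩, ?_⟩
        intro he
        rw [Set.mem_singleton_iff, Sym2.eq_iff] at he
        rcases he with ⟨rfl, rfl⟩ | ⟨rfl, rfl⟩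
        · rcases hh with hh | hh
          · exact lt_irrefl _ (hh i hi i hi)
          · exact lt_asymm hjm (hh m hm j hj)
        · rcases hh with hh | hh
          · exact lt_asymm hij (hh i hi j hj)
          · exact lt_asymm (hij.trans hjm) (hh m hm i hi)
      · refine hh.imp (fun hh i' hi' j' hj' => ?_) id
        rw [← hr.const _ c.2 j hj i' hi']
        exact (hh i hi j' hj').trans hij
  obtain ⟨m, hm⟩ := hT.label_nonempty _ x.2
  exact SimpleGraph.isBridge_iff.1 (SimpleGraph.isAcyclic_iff_forall_adj_isBridge.1 hT.acyclic
    (hT.adj_iff.2 ⟨1, h⟩)) ((key h1 (Or.inr fun i hi j hj => lt h2 hi hj)).trans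
      (key h2 (Or.inl fun i hi j hj => lt h1 hj hi)))

/-- An arc of `D` yields a directed path in `D'`. If that path had an intermediate vertex, its arcs
would lift to directed paths of `D` forming a detour, which `not_transGen_transGen` excludes. -/
theorem arcs_subset_of_common_extension (hT : IsSchroderCambrianTree e D)
    (hr : D.IsExtension r) (hT' : IsSchroderCambrianTree e D') (hr' : D'.IsExtension r)
    (hn : D.nodes = D'.nodes) : D.arcs ⊆ D'.arcs := by
  rintro ⟨v, w⟩ h
  have hvw := mem_product.1 (hT.arcs_subset h)
  have htr := monotone_of_arc_of_common_extension hT hr hT' hr' hn (v := ⟨v, hvw.1⟩)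
    (w := ⟨w, hvw.2⟩) (arc_one.2 h)
  have lift : ∀ {x y : D'.Vertex}, Relation.TransGen (D'.Arc 1) x y →
      Relation.TransGen (D.Arc 1) ⟨x.1, by rw [hn]; exact x.2⟩ ⟨y.1, by rw [hn]; exact y.2⟩ := by
    intro x y hxy
    induction hxy with
    | single h => exact monotone_of_arc_of_common_extension hT' hr' hT hr hn.symm h
    | tail _ h ih => exact ih.trans (monotone_of_arc_of_common_extension hT' hr' hT hr hn.symm h)
  obtain ⟨q, hq, hq'⟩ := Relation.TransGen.head'_iff.1 htr
  rcases Relation.ReflTransGen.cases_head hq' with rfl | hq''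
  · exact arc_one.1 hq
  · obtain ⟨x, hx, hx'⟩ := hq''
    exact (hT.not_transGen_transGen hr (v := ⟨v, hvw.1⟩) (w := ⟨w, hvw.2⟩) (arc_one.2 h)
      (lift (.single hq)) (lift (Relation.TransGen.head' hx hx'))).elim

/-- Two Schröder-Cambrian trees with a common strict extension are equal. -/
theorem eq_of_common_extension (hT : IsSchroderCambrianTree e D)
    (hr : D.IsExtension r) (hT' : IsSchroderCambrianTree e D') (hr' : D'.IsExtension r) :
    D = D' := by
  have hn : D.nodes = D'.nodes := (nodes_subset_of_common_extension hT hr hT' hr').antisymm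
    (nodes_subset_of_common_extension hT' hr' hT hr)
  have ha : D.arcs = D'.arcs := (arcs_subset_of_common_extension hT hr hT' hr' hn).antisymm
    (arcs_subset_of_common_extension hT' hr' hT hr hn.symm)
  cases D; cases D'
  simp only at hn ha
  rw [hn, ha]

end Uniqueness

/-! ### Existence of strict extensions -/

section Existence

variable {e : Signature} {D : LabeledDigraph}

open Classical in
/-- The number of arcs below a vertex, in the sense that the vertex is on the upper side. -/
noncomputable def LabeledDigraph.height (D : LabeledDigraph) (u : D.Vertex) : ℕ :=
  (D.arcs.filter fun p => ∃ (hv : p.1 ∈ D.nodes) (hw : p.2 ∈ D.nodes),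
    u ∈ D.branch ⟨p.1, hv⟩ ⟨p.2, hw⟩).card

/-- Moving along an arc changes the side with respect to that arc only, and from its lower to its
upper side. -/
theorem IsSchroderCambrianTree.height_lt (hT : IsSchroderCambrianTree e D) {x y : D.Vertex}
    (h : D.Arc 1 x y) : D.height x < D.height y := by
  classical
  refine card_lt_card ((ssubset_iff_of_subset ?_).2 ⟨(x.1, y.1), ?_, ?_⟩)
  · rintro ⟨v, w⟩ hvw
    simp only [mem_filter] at hvw ⊢
    obtain ⟨ha, hv, hw, hx⟩ := hvw
    refine ⟨ha, hv, hw, mem_branch_of_adj hx (hT.adj_iff.2 ⟨1, h⟩) ?_⟩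
    intro he
    rw [Sym2.eq_iff] at he
    rcases he with ⟨rfl, rfl⟩ | ⟨rfl, rfl⟩
    · exact hT.not_mem_branch (hT.adj_iff.2 ⟨1, h⟩) hx
    · exact hT.arcs_asymm _ _ ha (arc_one.1 h)
  · exact mem_filter.2 ⟨arc_one.1 h, x.2, y.2, mem_branch_self _ _⟩
  · simp only [mem_filter, not_and, not_exists]
    exact fun _ _ _ => hT.not_mem_branch (hT.adj_iff.2 ⟨1, h⟩)

theorem IsSchroderCambrianTree.exists_extension (hT : IsSchroderCambrianTree e D) :
    ∃ r : ℕ → ℕ, D.IsExtension r := by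
  classical
  refine ⟨fun i => if h : ∃ v : D.Vertex, i ∈ v.1 then D.height h.choose else 0, ?_, ?_⟩
  · intro v hv i hi j hj
    have h : ∀ {i}, i ∈ v → ∃ v : D.Vertex, i ∈ v.1 := fun hi => ⟨⟨v, hv⟩, hi⟩
    have e1 : ∀ {i} (hi : i ∈ v), (h hi).choose = ⟨v, hv⟩ := fun hi =>
      hT.vertex_unique (h hi).choose_spec hi
    simp only [dif_pos (h hi), dif_pos (h hj)]
    rw [e1 hi, e1 hj]
  · intro v w hvw i hi j hj
    have hm := mem_product.1 (hT.arcs_subset hvw)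
    have hi' : ∃ v : D.Vertex, i ∈ v.1 := ⟨⟨v, hm.1⟩, hi⟩
    have hj' : ∃ v : D.Vertex, j ∈ v.1 := ⟨⟨w, hm.2⟩, hj⟩
    simp only [dif_pos hi', dif_pos hj']
    rw [hT.vertex_unique hi'.choose_spec (w := ⟨v, hm.1⟩) hi,
      hT.vertex_unique hj'.choose_spec (w := ⟨w, hm.2⟩) hj]
    exact hT.height_lt (arc_one.2 hvw)

end Existence

end SchroderCambrian
namespace SchroderCambrian
open Finset
open SignedOrdPart LabeledDigraph

/-! ### Walls, visibility and strands of a table -/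

namespace SignedOrdPart

variable {l : SignedOrdPart}

theorem length_signature (l : SignedOrdPart) : l.signature.length = l.size := by
  simp [signature, size]

/-- The dot of column `c` is negative. -/
def Neg (l : SignedOrdPart) (c : ℕ) : Prop := l.signature.sign c = -1

theorem sign_eq_one_iff {l : SignedOrdPart} {c : ℕ} : l.signature.sign c = 1 ↔ ¬ l.Neg c := by
  rw [Neg]
  rcases Int.units_eq_one_or (l.signature.sign c) with h | h <;> rw [h] <;> decide

theorem wallAtRow_iff {r c : ℕ} : l.WallAtRow r c ↔ (1 ≤ c ∧ c ≤ l.size) ∧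
    ((l.Neg c ∧ r < l.row c) ∨ (¬ l.Neg c ∧ l.row c < r)) := by
  rw [WallAtRow, sign_eq_one_iff, mem_Icc, Neg]

theorem wallAtLine_iff {h c : ℕ} : l.WallAtLine h c ↔ c = 0 ∨ c = l.size + 1 ∨
    (1 ≤ c ∧ c ≤ l.size) ∧ ((l.Neg c ∧ h ≤ l.row c) ∨ (¬ l.Neg c ∧ l.row c < h)) := by
  rw [WallAtLine, sign_eq_one_iff, mem_Icc, Neg]

theorem wallAtLine_succ_of_wallAtRow {r c : ℕ} (h : l.WallAtRow r c) : l.WallAtLine (r + 1) c := by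
  grind [wallAtRow_iff, wallAtLine_iff]

theorem wallAtLine_of_wallAtRow {r c : ℕ} (h : l.WallAtRow r c) : l.WallAtLine r c := by
  grind [wallAtRow_iff, wallAtLine_iff]

theorem wallAtRow_of_wallAtLine {r c : ℕ} (h : l.WallAtLine r c) (h' : l.WallAtLine (r + 1) c)
    (h1 : 1 ≤ c) (h2 : c ≤ l.size) : l.WallAtRow r c := by
  grind [wallAtRow_iff, wallAtLine_iff]

/-- A wall begins or ends only at its own dot, so the walls of consecutive lines differ only at the
columns of the dots between them. -/
theorem row_eq_of_wallAtLine_iff {r c : ℕ} (h : ¬ (l.WallAtLine r c ↔ l.WallAtLine (r + 1) c)) :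
    (1 ≤ c ∧ c ≤ l.size) ∧ l.row c = r := by
  grind [wallAtRow_iff, wallAtLine_iff]

theorem not_wallAtRow_row (c : ℕ) : ¬ l.WallAtRow (l.row c) c := by
  grind [wallAtRow_iff]

theorem mem_nodeOf {i j : ℕ} : j ∈ l.nodeOf i ↔ (1 ≤ j ∧ j ≤ l.size) ∧ l.row j = l.row i ∧
    ∀ c, min i j < c → c < max i j → ¬ l.WallAtRow (l.row i) c := by
  simp only [nodeOf, mem_filter, mem_Icc]

theorem mem_nodeOf_self {i : ℕ} (hi : i ∈ Icc 1 l.size) : i ∈ l.nodeOf i := by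
  rw [mem_nodeOf]
  rw [mem_Icc] at hi
  exact ⟨hi, rfl, fun c h1 h2 => by omega⟩

theorem row_eq_of_mem_nodeOf {i j : ℕ} (h : j ∈ l.nodeOf i) : l.row j = l.row i :=
  (mem_nodeOf.1 h).2.1

theorem mem_Icc_of_mem_nodeOf {i j : ℕ} (h : j ∈ l.nodeOf i) : j ∈ Icc 1 l.size :=
  mem_Icc.2 (mem_nodeOf.1 h).1

theorem not_wallAtRow_of_row_eq {r c : ℕ} (h : l.row c = r) : ¬ l.WallAtRow r c := by
  rw [← h]; exact not_wallAtRow_row c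

theorem nodeOf_eq_of_mem {i j : ℕ} (h : j ∈ l.nodeOf i) : l.nodeOf j = l.nodeOf i := by
  ext m
  rw [mem_nodeOf, mem_nodeOf]
  obtain ⟨h1, h2, h3⟩ := mem_nodeOf.1 h
  rw [h2]
  refine and_congr_right fun hm => and_congr_right fun hr => ?_
  have hi := not_wallAtRow_row (l := l) i
  have hj := not_wallAtRow_of_row_eq h2
  have hm := not_wallAtRow_of_row_eq hr
  have hmm : ∀ {a b c : ℕ}, ¬ l.WallAtRow (l.row i) b →
      (∀ c, min a b < c → c < max a b → ¬ l.WallAtRow (l.row i) c) →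
      (∀ c, min b m < c → c < max b m → ¬ l.WallAtRow (l.row i) c) →
      min a m < c → c < max a m → ¬ l.WallAtRow (l.row i) c := by
    intro a b c hb h1 h2 h3 h4 hc
    have : c ≠ b := by rintro rfl; exact hb hc
    by_cases h5 : min a b < c ∧ c < max a b
    · exact h1 c h5.1 h5.2 hc
    · exact h2 c (by omega) (by omega) hc
  constructor
  · intro h4 c
    exact hmm (b := j) hj h3 h4
  · intro h4 c
    exact hmm (b := i) hi (fun c h5 h6 => h3 c (by omega) (by omega)) h4

/-- A wall between the two dots would hide the cell between columns `x` and `x + 1` from one of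
them. Seeing such a unit cell is the form of visibility used from here on, since it does not depend
on the walls of a line. -/
theorem mem_nodeOf_of_visible {i j x : ℕ} (hj : j ∈ Icc 1 l.size) (hr : l.row j = l.row i)
    (h : l.Visible i x (x + 1)) (h' : l.Visible j x (x + 1)) : j ∈ l.nodeOf i := by
  rw [mem_nodeOf]
  rw [mem_Icc] at hj
  refine ⟨hj, hr, fun c h1 h2 hc => ?_⟩
  have a1 := h c hc
  rw [Visible, hr] at h'
  have a2 := h' c hc
  omega

theorem visible_of_mem_nodeOf {i j a b : ℕ} (hj : j ∈ l.nodeOf i) (h : l.Visible i a b) :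
    l.Visible j a b := by
  obtain ⟨h1, h2, h3⟩ := mem_nodeOf.1 hj
  intro c hc
  rw [h2] at hc
  have a1 := h c hc
  have a2 : ¬ (min i j < c ∧ c < max i j) := fun h => h3 c h.1 h.2 hc
  have a3 : c ≠ i := by rintro rfl; exact not_wallAtRow_row _ hc
  omega

theorem visible_mono {i a b a' b' : ℕ} (h : l.Visible i a' b') (ha : a ≤ a') (hb : b' ≤ b) :
    l.Visible i a b := by
  intro c hc
  have := h c hc
  omega

/-- The nodes reached by a strand see every point of the region of this strand. -/
theorem visible_of_isStrand_succ {i a b x : ℕ} (h : l.Visible i a b)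
    (hs : l.IsStrand (l.row i + 1) a b) (hax : a ≤ x) (hxb : x < b) : l.Visible i x (x + 1) := by
  intro c hc
  have h1 := h c hc
  have h2 : ¬ (a < c ∧ c < b) := fun hh => hs.2.2.2 c hh.1 hh.2 (wallAtLine_succ_of_wallAtRow hc)
  omega

theorem visible_of_isStrand {i a b x : ℕ} (h : l.Visible i a b)
    (hs : l.IsStrand (l.row i) a b) (hax : a ≤ x) (hxb : x < b) : l.Visible i x (x + 1) := by
  intro c hc
  have h1 := h c hc
  have h2 : ¬ (a < c ∧ c < b) := fun hh => hs.2.2.2 c hh.1 hh.2 (wallAtLine_of_wallAtRow hc)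
  omega

/-- A node which sees the region of a strand interrupts it. -/
theorem not_visible_of_isStrand {m a b : ℕ} (hm : m ∈ Icc 1 l.size)
    (h : l.IsStrand (l.row m) a b) (h' : l.IsStrand (l.row m + 1) a b) : ¬ l.Visible m a b := by
  intro hv
  rw [mem_Icc] at hm
  obtain ⟨hab, ha, hb, hn⟩ := h
  obtain ⟨-, ha', hb', hn'⟩ := h'
  have tog : ¬ (l.WallAtLine (l.row m) m ↔ l.WallAtLine (l.row m + 1) m) := by
    grind [wallAtLine_iff]
  have h1 : ¬ (a < m ∧ m < b) := fun hh => by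
    have := hn m hh.1 hh.2; have := hn' m hh.1 hh.2; tauto
  have h2 : m ≠ a := by rintro rfl; tauto
  have h3 : m ≠ b := by rintro rfl; tauto
  rcases lt_or_gt_of_ne h2 with h4 | h4
  · have := hv a (wallAtRow_of_wallAtLine ha ha' (by omega)
      (by rcases wallAtLine_iff.1 hb with h | h | h <;> omega))
    omega
  · have := hv b (wallAtRow_of_wallAtLine hb hb' (by omega) (by omega))
    omega

theorem exists_isStrand (h : ℕ) {x : ℕ} (hx : x ≤ l.size) :
    ∃ a b, l.IsStrand h a b ∧ a ≤ x ∧ x < b := by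
  classical
  have hA : ((range (x + 1)).filter (l.WallAtLine h)).Nonempty :=
    ⟨0, by simp [WallAtLine]⟩
  have hB : ((Icc (x + 1) (l.size + 1)).filter (l.WallAtLine h)).Nonempty :=
    ⟨l.size + 1, by simp [WallAtLine]; omega⟩
  have hA' := mem_filter.1 (max'_mem _ hA)
  have hB' := mem_filter.1 (min'_mem _ hB)
  have h1 := mem_range.1 hA'.1
  have h2 := mem_Icc.1 hB'.1
  refine ⟨_, _, ⟨by omega, hA'.2, hB'.2, fun c hac hcb hc => ?_⟩, by omega, by omega⟩
  by_cases hcx : c ≤ x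
  · have := le_max' ((range (x + 1)).filter (l.WallAtLine h)) c
      (mem_filter.2 ⟨mem_range.2 (by omega), hc⟩)
    omega
  · have := min'_le ((Icc (x + 1) (l.size + 1)).filter (l.WallAtLine h)) c
      (mem_filter.2 ⟨mem_Icc.2 ⟨by omega, by omega⟩, hc⟩)
    omega

theorem visible_of_toggle {k a b c x : ℕ} (hs : l.IsStrand k a b) (hax : a ≤ x) (hxb : x < b)
    (hac : a ≤ c) (hcb : c ≤ b) (hc : l.row c = k) : l.Visible c x (x + 1) := by
  intro w hw
  rw [hc] at hw
  have h2 : ¬ (a < w ∧ w < b) := fun hh => hs.2.2.2 w hh.1 hh.2 (wallAtLine_of_wallAtRow hw)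
  omega

/-- Only a dot of row `k` with column in `[a, b]` could change the region, and by
`visible_of_toggle` such a dot sees every cell of it. -/
theorem isStrand_succ {k a b x : ℕ} (hs : l.IsStrand k a b) (hax : a ≤ x) (hxb : x < b)
    (hno : ∀ m ∈ Icc 1 l.size, l.row m = k → ¬ l.Visible m x (x + 1)) : l.IsStrand (k + 1) a b := by
  have key : ∀ c, a ≤ c → c ≤ b → (l.WallAtLine k c ↔ l.WallAtLine (k + 1) c) := by
    intro c hac hcb
    by_contra hcon
    obtain ⟨h1, h2⟩ := row_eq_of_wallAtLine_iff hcon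
    exact hno c (mem_Icc.2 h1) h2 (visible_of_toggle hs hax hxb hac hcb h2)
  obtain ⟨hab, ha, hb, hn⟩ := hs
  exact ⟨hab, (key a le_rfl hab.le).1 ha, (key b hab.le le_rfl).1 hb,
    fun c h1 h2 => mt (key c h1.le h2.le).2 (hn c h1 h2)⟩

/-- The strand through the cell `x` just above the row of `i` survives every intermediate row, as no
dot there sees the cell. -/
theorem joined_of_forall_not_visible {i j x : ℕ} (hx : x ≤ l.size) (hij : l.row i < l.row j)
    (hi : l.Visible i x (x + 1)) (hj : l.Visible j x (x + 1))
    (hno : ∀ m ∈ Icc 1 l.size, l.row i < l.row m → l.row m < l.row j → ¬ l.Visible m x (x + 1)) :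
    l.Joined i j := by
  obtain ⟨a, b, hs, hax, hxb⟩ := exists_isStrand (l.row i + 1) hx
  refine ⟨hij, a, b, fun h h1 h2 => ?_, visible_mono hi hax hxb, visible_mono hj hax hxb⟩
  induction h, (show l.row i + 1 ≤ h from h1) using Nat.le_induction with
  | base => exact hs
  | succ h hh ih =>
    exact isStrand_succ (ih (by omega) (by omega)) hax hxb fun m hm hm' =>
      hno m hm (by omega) (by omega)

theorem Joined.exists_visible {i j : ℕ} (h : l.Joined i j) :
    ∃ x ≤ l.size, l.Visible i x (x + 1) ∧ l.Visible j x (x + 1) := by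
  obtain ⟨hij, a, b, hs, hi, hj⟩ := h
  have h1 := hs (l.row i + 1) (by omega) (by omega)
  have h2 := hs (l.row j) (by omega) le_rfl
  refine ⟨a, ?_, visible_of_isStrand_succ hi h1 le_rfl h1.1, visible_of_isStrand hj h2 le_rfl h2.1⟩
  have := h1.1
  rcases wallAtLine_iff.1 h1.2.2.1 with h | h | h <;> omega

theorem mem_arcs {v w : Finset ℕ} : (v, w) ∈ l.pSymbol.arcs ↔ ∃ i ∈ Icc 1 l.size,
    ∃ j ∈ Icc 1 l.size, l.Joined i j ∧ l.nodeOf i = v ∧ l.nodeOf j = w := by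
  simp only [pSymbol, mem_image, mem_filter, mem_product, Prod.mk.injEq, Prod.exists]
  constructor
  · rintro ⟨i, j, ⟨⟨h1, h2⟩, h3⟩, h4, h5⟩
    exact ⟨i, h1, j, h2, h3, h4, h5⟩
  · rintro ⟨i, h1, j, h2, h3, h4, h5⟩
    exact ⟨i, j, ⟨⟨h1, h2⟩, h3⟩, h4, h5⟩

theorem mem_nodes {v : Finset ℕ} : v ∈ l.pSymbol.nodes ↔ ∃ i ∈ Icc 1 l.size, l.nodeOf i = v := by
  simp only [pSymbol, mem_image]

theorem nodeOf_mem_nodes {i : ℕ} (hi : i ∈ Icc 1 l.size) : l.nodeOf i ∈ l.pSymbol.nodes :=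
  mem_nodes.2 ⟨i, hi, rfl⟩

/-- Two dots in different rows that see a common point are comparable in the `P`-symbol. -/
theorem transGen_of_visible {i j x : ℕ} (hx : x ≤ l.size) (hi : i ∈ Icc 1 l.size)
    (hj : j ∈ Icc 1 l.size) (hij : l.row i < l.row j)
    (hvi : l.Visible i x (x + 1)) (hvj : l.Visible j x (x + 1)) :
    Relation.TransGen (fun v w => (v, w) ∈ l.pSymbol.arcs) (l.nodeOf i) (l.nodeOf j) := by
  induction hd : l.row j - l.row i using Nat.strong_induction_on generalizing i j with
  | _ d ih =>
    by_cases hno : ∀ m ∈ Icc 1 l.size, l.row i < l.row m → l.row m < l.row j →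
        ¬ l.Visible m x (x + 1)
    · exact .single (mem_arcs.2 ⟨i, hi, j, hj,
        joined_of_forall_not_visible hx hij hvi hvj hno, rfl, rfl⟩)
    -- A dot of an intermediate row that sees the same cell splits the interval of rows; the
    -- induction is on the difference of the rows.
    · push Not at hno
      obtain ⟨m, hm, h1, h2, hvm⟩ := hno
      exact (ih _ (by omega) hi hm h1 hvi hvm rfl).trans (ih _ (by omega) hm hj h2 hvm hvj rfl)

/-- The elements of `[n]` below the diagonal of a strand. -/
theorem mem_belowDiagonal {a b i : ℕ} : i ∈ belowDiagonal l.signature a b ↔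
    (1 ≤ i ∧ i ≤ l.size) ∧ ((a < i ∧ i < b ∧ l.Neg i) ∨ (i ≤ a ∧ ¬ l.Neg a) ∨
      (b ≤ i ∧ ¬ l.Neg b)) := by
  rw [belowDiagonal, mem_filter, mem_Icc, length_signature, sign_eq_one_iff, sign_eq_one_iff]
  rfl

/-- A dot that sees a point of the region of a strand at line `h` is below the strand if and only
if its row is below the line `h`. -/
theorem mem_belowDiagonal_iff_row_lt {h a b i x : ℕ} (hs : l.IsStrand h a b)
    (hi : i ∈ Icc 1 l.size) (hv : l.Visible i x (x + 1)) (hax : a ≤ x) (hxb : x < b) :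
    i ∈ belowDiagonal l.signature a b ↔ l.row i < h := by
  rw [mem_belowDiagonal]
  -- Inside the region `i` is no wall of line `h`, so its sign tells its side. Outside, visibility
  -- says that the nearer end of the strand does not wall off the row of `i`, and the sign of that
  -- end decides.
  obtain ⟨hab, ha, hb, hn⟩ := hs
  have h1 := hn i
  have h2 := hv a
  have h3 := hv b
  rw [wallAtLine_iff] at ha hb h1
  rw [wallAtRow_iff] at h2 h3
  rw [mem_Icc] at hi
  grind

/-- Two dots that see a common point outside of the region of a strand are on the same side. -/
theorem mem_belowDiagonal_iff_of_le {h a b i x : ℕ} (hs : l.IsStrand h a b)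
    (hi : i ∈ Icc 1 l.size) (hv : l.Visible i x (x + 1)) (hxa : x < a) :
    i ∈ belowDiagonal l.signature a b ↔ ¬ l.Neg a := by
  rw [mem_belowDiagonal]
  obtain ⟨hab, ha, hb, hn⟩ := hs
  have h1 := hn i
  have h2 := hv a
  have h3 := hv b
  rw [wallAtLine_iff] at ha hb h1
  rw [wallAtRow_iff] at h2 h3
  rw [mem_Icc] at hi
  grind

theorem mem_belowDiagonal_iff_of_ge {h a b i x : ℕ} (hs : l.IsStrand h a b)
    (hi : i ∈ Icc 1 l.size) (hv : l.Visible i x (x + 1)) (hx : x ≤ l.size) (hbx : b ≤ x) :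
    i ∈ belowDiagonal l.signature a b ↔ ¬ l.Neg b := by
  rw [mem_belowDiagonal]
  obtain ⟨hab, ha, hb, hn⟩ := hs
  have h1 := hn i
  have h2 := hv a
  have h3 := hv b
  rw [wallAtLine_iff] at ha hb h1
  rw [wallAtRow_iff] at h2 h3
  rw [mem_Icc] at hi
  grind

/-- If the common cell is left of `a` or right of `b`, the side of each dot is decided by the sign
of that same end, so both dots are on the same side. -/
theorem region_of_mem_of_not_mem {h a b i j x : ℕ} (hs : l.IsStrand h a b)
    (hi : i ∈ Icc 1 l.size) (hj : j ∈ Icc 1 l.size) (hx : x ≤ l.size)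
    (hvi : l.Visible i x (x + 1)) (hvj : l.Visible j x (x + 1))
    (hB : ¬ (i ∈ belowDiagonal l.signature a b ↔ j ∈ belowDiagonal l.signature a b)) :
    a ≤ x ∧ x < b := by
  constructor
  · by_contra hcon
    rw [mem_belowDiagonal_iff_of_le hs hi hvi (by omega),
      mem_belowDiagonal_iff_of_le hs hj hvj (by omega)] at hB
    exact hB Iff.rfl
  · by_contra hcon
    rw [mem_belowDiagonal_iff_of_ge hs hi hvi hx (by omega),
      mem_belowDiagonal_iff_of_ge hs hj hvj hx (by omega)] at hB
    exact hB Iff.rfl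

theorem IsStrand.right_le {h a b : ℕ} (hs : l.IsStrand h a b) : b ≤ l.size + 1 := by
  rcases wallAtLine_iff.1 hs.2.2.1 with h | h | h <;> omega

/-- Nodes do not cross strands. -/
theorem mem_belowDiagonal_iff_of_mem_nodeOf {h a b i j : ℕ} (hs : l.IsStrand h a b)
    (hi : i ∈ Icc 1 l.size) (hj : j ∈ l.nodeOf i) :
    i ∈ belowDiagonal l.signature a b ↔ j ∈ belowDiagonal l.signature a b := by
  by_contra hB
  have hj' := mem_Icc_of_mem_nodeOf hj
  have hv : l.Visible i i (i + 1) := fun c hc => by omega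
  have hv' := visible_of_mem_nodeOf hj hv
  have hx : i ≤ l.size := (mem_Icc.1 hi).2
  have hr := region_of_mem_of_not_mem hs hi hj' hx hv hv' hB
  rw [mem_belowDiagonal_iff_row_lt hs hi hv hr.1 hr.2,
    mem_belowDiagonal_iff_row_lt hs hj' hv' hr.1 hr.2, row_eq_of_mem_nodeOf hj] at hB
  exact hB Iff.rfl

theorem isStrand_unique {h a b a' b' x : ℕ} (hs : l.IsStrand h a b) (hs' : l.IsStrand h a' b')
    (h1 : a ≤ x) (h2 : x < b) (h1' : a' ≤ x) (h2' : x < b') : a = a' ∧ b = b' := by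
  obtain ⟨-, ha, hb, hn⟩ := hs
  obtain ⟨-, ha', hb', hn'⟩ := hs'
  constructor
  · rcases lt_trichotomy a a' with h | h | h
    · exact absurd ha' (hn a' h (by omega))
    · exact h
    · exact absurd ha (hn' a h (by omega))
  · rcases lt_trichotomy b b' with h | h | h
    · exact absurd hb (hn' b (by omega) h)
    · exact h
    · exact absurd hb' (hn b' (by omega) h)

/-- The only node producing the strand `(a, b)` crossing line `h`. -/
theorem nodeOf_eq_of_producer {h a b i i' : ℕ} (hi : i ∈ Icc 1 l.size) (hi' : i' ∈ Icc 1 l.size)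
    (hs : ∀ k, l.row i < k → k ≤ h → l.IsStrand k a b)
    (hs' : ∀ k, l.row i' < k → k ≤ h → l.IsStrand k a b)
    (hih : l.row i < h) (hih' : l.row i' < h)
    (hv : l.Visible i a b) (hv' : l.Visible i' a b) : l.nodeOf i = l.nodeOf i' := by
  -- If the rows differed, the higher producer would see a strand that keeps the same walls below
  -- and above its row, against `not_visible_of_isStrand`.
  have hr : l.row i = l.row i' := by
    rcases lt_trichotomy (l.row i) (l.row i') with hlt | heq | hlt
    · exact absurd hv' (not_visible_of_isStrand hi' (hs _ hlt hih'.le) (hs _ (by omega) (by omega)))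
    · exact heq
    · exact absurd hv (not_visible_of_isStrand hi (hs' _ hlt hih.le) (hs' _ (by omega) (by omega)))
  have h1 := hs (l.row i + 1) (by omega) (by omega)
  have h1' := hs' (l.row i' + 1) (by omega) (by omega)
  exact nodeOf_eq_of_mem (mem_nodeOf_of_visible hi hr
    (visible_of_isStrand_succ hv' h1' le_rfl h1.1) (visible_of_isStrand_succ hv h1 le_rfl h1.1))

/-- The only node gathering the strand `(a, b)` crossing line `h`. -/
theorem nodeOf_eq_of_gatherer {h a b j j' : ℕ} (hj : j ∈ Icc 1 l.size) (hj' : j' ∈ Icc 1 l.size)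
    (hs : ∀ k, h ≤ k → k ≤ l.row j → l.IsStrand k a b)
    (hs' : ∀ k, h ≤ k → k ≤ l.row j' → l.IsStrand k a b)
    (hjh : h ≤ l.row j) (hjh' : h ≤ l.row j')
    (hv : l.Visible j a b) (hv' : l.Visible j' a b) : l.nodeOf j = l.nodeOf j' := by
  have hr : l.row j = l.row j' := by
    rcases lt_trichotomy (l.row j) (l.row j') with hlt | heq | hlt
    · exact absurd hv (not_visible_of_isStrand hj (hs' _ hjh (by omega)) (hs' _ (by omega) (by omega)))
    · exact heq
    · exact absurd hv' (not_visible_of_isStrand hj' (hs _ hjh' (by omega)) (hs _ (by omega) (by omega)))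
  have h1 := hs (l.row j) (by omega) (by omega)
  have h1' := hs' (l.row j') (by omega) (by omega)
  exact nodeOf_eq_of_mem (mem_nodeOf_of_visible hj hr
    (visible_of_isStrand hv' h1' le_rfl h1.1) (visible_of_isStrand hv h1 le_rfl h1.1))

/-- An arc crosses the diagonal of a strand only if it carries this strand. -/
theorem Joined.crosses {h a b i j : ℕ} (hJ : l.Joined i j) (hs : l.IsStrand h a b)
    (hi : i ∈ Icc 1 l.size) (hj : j ∈ Icc 1 l.size)
    (hB : ¬ (i ∈ belowDiagonal l.signature a b ↔ j ∈ belowDiagonal l.signature a b)) :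
    l.row i < h ∧ h ≤ l.row j ∧ (∀ k, l.row i < k → k ≤ l.row j → l.IsStrand k a b) ∧
      l.Visible i a b ∧ l.Visible j a b := by
  obtain ⟨hij, a', b', hs', hvi, hvj⟩ := hJ
  have h1 := hs' (l.row i + 1) (by omega) (by omega)
  have h2 := hs' (l.row j) (by omega) le_rfl
  have hx : a' ≤ l.size := by have := h1.right_le; have := h1.1; omega
  have v1 := visible_of_isStrand_succ hvi h1 le_rfl h1.1
  have v2 := visible_of_isStrand hvj h2 le_rfl h1.1
  have hr := region_of_mem_of_not_mem hs hi hj hx v1 v2 hB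
  rw [mem_belowDiagonal_iff_row_lt hs hi v1 hr.1 hr.2,
    mem_belowDiagonal_iff_row_lt hs hj v2 hr.1 hr.2] at hB
  have h3 : l.row i < h ∧ h ≤ l.row j := by omega
  obtain ⟨rfl, rfl⟩ := isStrand_unique hs (hs' h h3.1 h3.2) hr.1 hr.2 le_rfl h1.1
  exact ⟨h3.1, h3.2, hs', hvi, hvj⟩

theorem Joined.mem_belowDiagonal {i j a b : ℕ} (hi : i ∈ Icc 1 l.size) (hj : j ∈ Icc 1 l.size)
    (hij : l.row i < l.row j) (hs : ∀ k, l.row i < k → k ≤ l.row j → l.IsStrand k a b)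
    (hvi : l.Visible i a b) (hvj : l.Visible j a b) :
    i ∈ belowDiagonal l.signature a b ∧ j ∉ belowDiagonal l.signature a b := by
  have h1 := hs (l.row i + 1) (by omega) (by omega)
  have h2 := hs (l.row j) (by omega) le_rfl
  rw [mem_belowDiagonal_iff_row_lt h2 hi (visible_of_isStrand_succ hvi h1 le_rfl h1.1) le_rfl h1.1,
    mem_belowDiagonal_iff_row_lt h2 hj (visible_of_isStrand hvj h2 le_rfl h1.1) le_rfl h1.1]
  omega

end SignedOrdPart
end SchroderCambrian
namespace SchroderCambrian
open Finset
open SignedOrdPart LabeledDigraph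

/-! ### The P-symbol is a Schröder-Cambrian tree -/

namespace SignedOrdPart

variable {l : SignedOrdPart}

theorem isExtension_pSymbol (l : SignedOrdPart) : l.pSymbol.IsExtension l.row where
  const := by
    intro v hv i hi j hj
    obtain ⟨m, hm, rfl⟩ := mem_nodes.1 hv
    rw [row_eq_of_mem_nodeOf hi, row_eq_of_mem_nodeOf hj]
  lt := by
    intro v w hvw i hi j hj
    obtain ⟨m, hm, m', hm', hJ, rfl, rfl⟩ := mem_arcs.1 hvw
    rw [row_eq_of_mem_nodeOf hi, row_eq_of_mem_nodeOf hj]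
    exact hJ.1

theorem adj_pSymbol {v w : l.pSymbol.Vertex} (h : l.pSymbol.graph.Adj v w) :
    (v.1, w.1) ∈ l.pSymbol.arcs ∨ (w.1, v.1) ∈ l.pSymbol.arcs := by
  rw [LabeledDigraph.graph, SimpleGraph.fromRel_adj] at h
  exact h.2

theorem adj_pSymbol_of_mem {v w : l.pSymbol.Vertex} (h : (v.1, w.1) ∈ l.pSymbol.arcs) :
    l.pSymbol.graph.Adj v w := by
  rw [LabeledDigraph.graph, SimpleGraph.fromRel_adj]
  refine ⟨?_, Or.inl h⟩
  rintro rfl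
  obtain ⟨m, hm, m', hm', hJ, h1, h2⟩ := mem_arcs.1 h
  have := row_eq_of_mem_nodeOf (h2 ▸ h1 ▸ mem_nodeOf_self hm : m ∈ l.nodeOf m')
  have := hJ.1
  omega

theorem reachable_pSymbol_of_transGen {v w : Finset ℕ}
    (h : Relation.TransGen (fun v w => (v, w) ∈ l.pSymbol.arcs) v w)
    (hv : v ∈ l.pSymbol.nodes) (hw : w ∈ l.pSymbol.nodes) :
    l.pSymbol.graph.Reachable ⟨v, hv⟩ ⟨w, hw⟩ := by
  induction h with
  | single h => exact (adj_pSymbol_of_mem (v := ⟨v, hv⟩) (w := ⟨_, hw⟩) h).reachable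
  | @tail b c _ h ih =>
    have hb : b ∈ l.pSymbol.nodes := by
      obtain ⟨i, hi, j, hj, -, rfl, -⟩ := mem_arcs.1 h
      exact nodeOf_mem_nodes hi
    exact (ih hb).trans (adj_pSymbol_of_mem (v := ⟨b, hb⟩) (w := ⟨c, hw⟩) h).reachable

/-- Adjacent columns both see the cell between them, so their nodes are equal or comparable. This
gives connectedness. -/
theorem reachable_nodeOf_succ {c : ℕ} (hc : c ∈ Icc 1 l.size) (hc' : c + 1 ∈ Icc 1 l.size) :
    l.pSymbol.graph.Reachable ⟨l.nodeOf c, nodeOf_mem_nodes hc⟩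
      ⟨l.nodeOf (c + 1), nodeOf_mem_nodes hc'⟩ := by
  have hv : l.Visible c c (c + 1) := fun w _ => by omega
  have hv' : l.Visible (c + 1) c (c + 1) := fun w _ => by omega
  have hx : c ≤ l.size := (mem_Icc.1 hc).2
  rcases lt_trichotomy (l.row c) (l.row (c + 1)) with h | h | h
  · exact reachable_pSymbol_of_transGen (transGen_of_visible hx hc hc' h hv hv') _ _
  · have := nodeOf_eq_of_mem (mem_nodeOf_of_visible hc' h.symm hv hv')
    simp only [this]
    exact SimpleGraph.Reachable.refl _
  · exact (reachable_pSymbol_of_transGen (transGen_of_visible hx hc' hc h hv' hv) _ _).symm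

theorem preconnected_pSymbol (l : SignedOrdPart) : l.pSymbol.graph.Preconnected := by
  have key : ∀ i (hi : i ∈ Icc 1 l.size) j (hj : j ∈ Icc 1 l.size), i ≤ j →
      l.pSymbol.graph.Reachable ⟨l.nodeOf i, nodeOf_mem_nodes hi⟩
        ⟨l.nodeOf j, nodeOf_mem_nodes hj⟩ := by
    intro i hi j hj hij
    induction j, hij using Nat.le_induction with
    | base => exact SimpleGraph.Reachable.refl _
    | succ j hij ih =>
      have hj' : j ∈ Icc 1 l.size := by rw [mem_Icc] at *; omega
      exact (ih hj').trans (reachable_nodeOf_succ hj' hj)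
  rintro ⟨v, hv⟩ ⟨w, hw⟩
  obtain ⟨i, hi, rfl⟩ := mem_nodes.1 hv
  obtain ⟨j, hj, rfl⟩ := mem_nodes.1 hw
  rcases le_total i j with h | h
  · exact key i hi j hj h
  · exact (key j hj i hi h).symm

/-- If `(v, w)` carries the strand `(a, b)`, then every other edge is on one side of this strand. -/
theorem subset_belowDiagonal_iff_of_reachable {i j a b : ℕ} (hi : i ∈ Icc 1 l.size)
    (hj : j ∈ Icc 1 l.size) (hij : l.row i < l.row j)
    (hs : ∀ k, l.row i < k → k ≤ l.row j → l.IsStrand k a b)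
    (hvi : l.Visible i a b) (hvj : l.Visible j a b) {v w : l.pSymbol.Vertex}
    (hv : v.1 = l.nodeOf i) (hw : w.1 = l.nodeOf j) {u u' : l.pSymbol.Vertex}
    (h : (l.pSymbol.graph.deleteEdges {s(v, w)}).Reachable u u') {m m' : ℕ} (hm : m ∈ u.1)
    (hm' : m' ∈ u'.1) :
    m ∈ belowDiagonal l.signature a b ↔ m' ∈ belowDiagonal l.signature a b := by
  have hst := hs (l.row j) hij le_rfl
  have node : ∀ {u : l.pSymbol.Vertex} {m m' : ℕ}, m ∈ u.1 → m' ∈ u.1 →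
      (m ∈ belowDiagonal l.signature a b ↔ m' ∈ belowDiagonal l.signature a b) := by
    rintro ⟨u, hu⟩ m m' hm hm'
    obtain ⟨p, hp, rfl⟩ := mem_nodes.1 hu
    rw [← mem_belowDiagonal_iff_of_mem_nodeOf hst hp hm,
      ← mem_belowDiagonal_iff_of_mem_nodeOf hst hp hm']
  have arc : ∀ {u u' : l.pSymbol.Vertex}, (u.1, u'.1) ∈ l.pSymbol.arcs → ¬ (u = v ∧ u' = w) →
      ∀ {m m' : ℕ}, m ∈ u.1 → m' ∈ u'.1 →
      (m ∈ belowDiagonal l.signature a b ↔ m' ∈ belowDiagonal l.signature a b) := by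
    intro u u' h hne m m' hm hm'
    obtain ⟨p, hp, q, hq, hJ, h1, h2⟩ := mem_arcs.1 h
    have hpu : p ∈ u.1 := h1 ▸ mem_nodeOf_self hp
    have hqu : q ∈ u'.1 := h2 ▸ mem_nodeOf_self hq
    rw [node hm hpu, node hm' hqu]
    by_contra hB
    -- An arc crossing the diagonal carries the same strand as the arc from `v` to `w`, and the
    -- producer and the gatherer of a strand at a given line are unique; so it is that arc.
    obtain ⟨c1, c2, c3, c4, c5⟩ := hJ.crosses hst hp hq hB
    obtain ⟨d1, d2, d3, d4, d5⟩ := Joined.crosses ⟨hij, a, b, hs, hvi, hvj⟩ hst hi hj (by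
      have := Joined.mem_belowDiagonal hi hj hij hs hvi hvj
      tauto)
    refine hne ⟨Subtype.ext ?_, Subtype.ext ?_⟩
    · rw [← h1, hv]
      exact nodeOf_eq_of_producer hp hi (h := l.row j) (fun k k1 k2 => c3 k k1 (by omega))
        (fun k k1 k2 => d3 k k1 (by omega)) c1 d1 c4 d4
    · rw [← h2, hw]
      exact nodeOf_eq_of_gatherer hq hj (h := l.row j) (fun k k1 k2 => c3 k (by omega) (by omega))
        (fun k k1 k2 => d3 k (by omega) (by omega)) c2 d2 c5 d5
  obtain ⟨p⟩ := h
  induction p generalizing m with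
  | nil => exact node hm hm'
  | @cons u x u' hux p ih =>
    rw [SimpleGraph.deleteEdges_adj, Set.mem_singleton_iff, Sym2.eq_iff, not_or] at hux
    obtain ⟨y, hy, hy'⟩ := mem_nodes.1 x.2
    have hyx : y ∈ x.1 := hy' ▸ mem_nodeOf_self hy
    refine Iff.trans ?_ (ih hyx hm')
    rcases adj_pSymbol hux.1 with h | h
    · exact arc h hux.2.1 hm hyx
    · exact (arc h (fun hh => hux.2.2 ⟨hh.2, hh.1⟩) hyx hm).symm

theorem mem_pSymbol_arc {v w : l.pSymbol.Vertex} (h : (v.1, w.1) ∈ l.pSymbol.arcs) :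
    ∃ i ∈ Icc 1 l.size, ∃ j ∈ Icc 1 l.size, l.row i < l.row j ∧ v.1 = l.nodeOf i ∧
      w.1 = l.nodeOf j ∧ ∃ a b, (∀ k, l.row i < k → k ≤ l.row j → l.IsStrand k a b) ∧
        l.Visible i a b ∧ l.Visible j a b := by
  obtain ⟨i, hi, j, hj, ⟨hij, hJ⟩, h1, h2⟩ := mem_arcs.1 h
  exact ⟨i, hi, j, hj, hij, h1.symm, h2.symm, hJ⟩

/-- Each edge is a bridge: its ends are on opposite sides of the diagonal of its strand, and no
other edge crosses this diagonal. -/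
theorem isAcyclic_pSymbol (l : SignedOrdPart) : l.pSymbol.graph.IsAcyclic := by
  rw [SimpleGraph.isAcyclic_iff_forall_adj_isBridge]
  have key : ∀ {v w : l.pSymbol.Vertex}, (v.1, w.1) ∈ l.pSymbol.arcs →
      l.pSymbol.graph.IsBridge s(v, w) := by
    intro v w h
    rw [SimpleGraph.isBridge_iff]
    intro hr
    obtain ⟨i, hi, j, hj, hij, hv, hw, a, b, hs, hvi, hvj⟩ := mem_pSymbol_arc h
    have h1 := subset_belowDiagonal_iff_of_reachable hi hj hij hs hvi hvj hv hw hr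
      (m := i) (m' := j) (hv ▸ mem_nodeOf_self hi) (hw ▸ mem_nodeOf_self hj)
    have h2 := Joined.mem_belowDiagonal hi hj hij hs hvi hvj
    tauto
  intro v w h
  rcases adj_pSymbol h with h | h
  · exact key h
  · rw [Sym2.eq_swap]; exact key h

theorem gap_of_forall {n k : ℕ} {X : Finset ℕ} {c : ℕ} (hc : c ∈ Icc 1 n) (hcX : c ∉ X)
    {p : ℕ → Prop} [DecidablePred p] (hp : (X.filter p).card = k) (h : ∀ x ∈ X, x < c ↔ p x) :
    c ∈ gap n X k := by
  rw [gap, mem_filter, mem_sdiff]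
  exact ⟨⟨hc, hcX⟩, by rw [← hp, filter_congr h]⟩

theorem mem_signPart_neg {v : Finset ℕ} {c : ℕ} :
    c ∈ signPart l.signature (-1) v ↔ c ∈ v ∧ l.Neg c := mem_filter

theorem mem_signPart_pos {v : Finset ℕ} {c : ℕ} :
    c ∈ signPart l.signature 1 v ↔ c ∈ v ∧ ¬ l.Neg c := by
  rw [signPart, mem_filter, sign_eq_one_iff]

/-- The positive elements of the node producing the strand `(a, b)` are outside of `(a, b)`, and
on the side of negative walls they do not exist. -/
theorem mem_gap_of_producer {i a b : ℕ} (hs : l.IsStrand (l.row i + 1) a b)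
    (hvi : l.Visible i a b) (hi : i ∈ Icc 1 l.size) {c : ℕ} (hc : c ∈ Icc 1 l.size)
    (hcB : c ∉ belowDiagonal l.signature a b) :
    c ∈ gap l.signature.length (signPart l.signature 1 (l.nodeOf i))
      ((signPart l.signature 1 (l.nodeOf i)).filter (· ≤ a)).card := by
  have hs' := hs
  obtain ⟨hab, ha, hb, hn⟩ := hs
  have hB := mem_belowDiagonal (l := l) (a := a) (b := b) (i := c)
  rw [wallAtLine_iff] at ha hb
  rw [mem_Icc] at hc
  have hX : ∀ x ∈ signPart l.signature 1 (l.nodeOf i), x ∈ l.nodeOf i ∧ ¬ l.Neg x ∧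
      l.row x = l.row i ∧ (1 ≤ x ∧ x ≤ l.size) ∧ l.Visible x a b ∧ (x ≤ a ∨ b ≤ x) := by
    intro x hx
    obtain ⟨hx, hx'⟩ := mem_signPart_pos.1 hx
    have h1 := row_eq_of_mem_nodeOf hx
    have h2 := mem_Icc.1 (mem_Icc_of_mem_nodeOf hx)
    have h3 := hn x
    rw [wallAtLine_iff] at h3
    refine ⟨hx, hx', h1, h2, visible_of_mem_nodeOf hx hvi, ?_⟩
    by_contra hcon
    exact h3 (by omega) (by omega) (Or.inr (Or.inr ⟨h2, Or.inr ⟨hx', by omega⟩⟩))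
  refine gap_of_forall (by rw [length_signature, mem_Icc]; exact hc) ?_ rfl ?_
  · intro hcX
    obtain ⟨h1, -⟩ := hX c hcX
    rw [← mem_belowDiagonal_iff_of_mem_nodeOf hs' hi h1, mem_belowDiagonal_iff_row_lt hs' hi
      (visible_of_isStrand_succ hvi hs' le_rfl hab) le_rfl hab] at hcB
    omega
  · intro x hx
    obtain ⟨h1, h2, h3, h4, h5, h6⟩ := hX x hx
    have h7 := h5 a
    have h8 := h5 b
    rw [wallAtRow_iff] at h7 h8
    grind

theorem mem_gap_of_gatherer {j a b : ℕ} (hs : l.IsStrand (l.row j) a b)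
    (hvj : l.Visible j a b) (hj : j ∈ Icc 1 l.size) {c : ℕ}
    (hcB : c ∈ belowDiagonal l.signature a b) :
    c ∈ gap l.signature.length (signPart l.signature (-1) (l.nodeOf j))
      ((signPart l.signature (-1) (l.nodeOf j)).filter (· ≤ a)).card := by
  have hs' := hs
  obtain ⟨hab, ha, hb, hn⟩ := hs
  have hB := (mem_belowDiagonal (l := l) (a := a) (b := b) (i := c)).1 hcB
  rw [wallAtLine_iff] at ha hb
  have hX : ∀ x ∈ signPart l.signature (-1) (l.nodeOf j), x ∈ l.nodeOf j ∧ l.Neg x ∧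
      l.row x = l.row j ∧ (1 ≤ x ∧ x ≤ l.size) ∧ l.Visible x a b ∧ (x ≤ a ∨ b ≤ x) := by
    intro x hx
    obtain ⟨hx, hx'⟩ := mem_signPart_neg.1 hx
    have h1 := row_eq_of_mem_nodeOf hx
    have h2 := mem_Icc.1 (mem_Icc_of_mem_nodeOf hx)
    have h3 := hn x
    rw [wallAtLine_iff] at h3
    refine ⟨hx, hx', h1, h2, visible_of_mem_nodeOf hx hvj, ?_⟩
    by_contra hcon
    exact h3 (by omega) (by omega) (Or.inr (Or.inr ⟨h2, Or.inl ⟨hx', by omega⟩⟩))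
  refine gap_of_forall (by rw [length_signature, mem_Icc]; exact hB.1) ?_ rfl ?_
  · intro hcX
    obtain ⟨h1, -⟩ := hX c hcX
    rw [← mem_belowDiagonal_iff_of_mem_nodeOf hs' hj h1, mem_belowDiagonal_iff_row_lt hs' hj
      (visible_of_isStrand hvj hs' le_rfl hab) le_rfl hab] at hcB
    omega
  · intro x hx
    obtain ⟨h1, h2, h3, h4, h5, h6⟩ := hX x hx
    have h7 := h5 a
    have h8 := h5 b
    rw [wallAtRow_iff] at h7 h8
    grind

/-- Of two strands leaving a node, the right end `b` of the left one is a positive dot of the node,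
and it separates the columns above one diagonal from those above the other. Hence two outgoing
branches never share a gap. -/
theorem outgoing_unique_aux {i i' a b a' b' : ℕ} (hi' : i' ∈ Icc 1 l.size)
    (hii : i ∈ l.nodeOf i') (hs : l.IsStrand (l.row i + 1) a b)
    (hs' : l.IsStrand (l.row i' + 1) a' b') (hvi : l.Visible i a b) (hvi' : l.Visible i' a' b')
    (hlt : a < a') {c c' : ℕ} (hc : c ∈ Icc 1 l.size) (hc' : c' ∈ Icc 1 l.size)
    (hcB : c ∉ belowDiagonal l.signature a b) (hcB' : c' ∉ belowDiagonal l.signature a' b') :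
    ∃ x ∈ signPart l.signature 1 (l.nodeOf i'), c < x ∧ x < c' := by
  have hr := row_eq_of_mem_nodeOf hii
  rw [hr] at hs
  obtain ⟨hab, ha, hb, hn⟩ := id hs
  obtain ⟨hab', ha', hb', hn'⟩ := id hs'
  have hba : b ≤ a' := by
    by_contra hcon
    exact hn a' hlt (by omega) ha'
  have hb1 : 1 ≤ b ∧ b ≤ l.size := by have := hs'.right_le; omega
  have hv1 : l.Visible i' a b := visible_of_mem_nodeOf
    (by rw [nodeOf_eq_of_mem hii]; exact mem_nodeOf_self hi') hvi
  have hvb := hv1 b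
  have hvb' := hvi' b
  have hva' := hvi' a'
  -- If the wall of `b` crossed the row, it would hide one of the two strands from `i'`. Being a
  -- wall just above the row without crossing it, `b` is a positive dot of the row.
  have hrow : ¬ l.Neg b ∧ l.row b = l.row i' := by
    rw [wallAtLine_iff] at hb
    rw [wallAtRow_iff] at hvb hvb'
    grind
  have hbv : l.Visible b a (a + 1) := by
    intro w hw
    rw [hrow.2] at hw
    have := hn w
    have := wallAtLine_succ_of_wallAtRow hw
    grind
  have hbn : b ∈ l.nodeOf i' := mem_nodeOf_of_visible (mem_Icc.2 hb1) hrow.2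
    (visible_of_isStrand_succ hv1 hs le_rfl hab) hbv
  refine ⟨b, mem_signPart_pos.2 ⟨hbn, hrow.1⟩, ?_, ?_⟩
  · rw [mem_belowDiagonal] at hcB
    rw [mem_Icc] at hc
    grind
  · have hbv' := visible_of_mem_nodeOf hbn hvi' a'
    rw [mem_belowDiagonal] at hcB'
    rw [mem_Icc] at hc'
    rw [wallAtLine_iff] at ha'
    rw [wallAtRow_iff] at hbv'
    have := hs'.right_le
    grind

/-- The mirror argument: the wall between two strands gathered by one node is a negative dot of that
node. -/
theorem incoming_unique_aux {j j' a b a' b' : ℕ} (hj' : j' ∈ Icc 1 l.size)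
    (hjj : j ∈ l.nodeOf j') (hs : l.IsStrand (l.row j) a b)
    (hs' : l.IsStrand (l.row j') a' b') (hvj : l.Visible j a b) (hvj' : l.Visible j' a' b')
    (hlt : a < a') {c c' : ℕ}
    (hcB : c ∈ belowDiagonal l.signature a b) (hcB' : c' ∈ belowDiagonal l.signature a' b') :
    ∃ x ∈ signPart l.signature (-1) (l.nodeOf j'), c < x ∧ x < c' := by
  have hr := row_eq_of_mem_nodeOf hjj
  rw [hr] at hs
  obtain ⟨hab, ha, hb, hn⟩ := id hs
  obtain ⟨hab', ha', hb', hn'⟩ := id hs'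
  have hba : b ≤ a' := by
    by_contra hcon
    exact hn a' hlt (by omega) ha'
  have hb1 : 1 ≤ b ∧ b ≤ l.size := by have := hs'.right_le; omega
  have hv1 : l.Visible j' a b := visible_of_mem_nodeOf
    (by rw [nodeOf_eq_of_mem hjj]; exact mem_nodeOf_self hj') hvj
  have hvb := hv1 b
  have hvb' := hvj' b
  have hva' := hvj' a'
  have hrow : l.Neg b ∧ l.row b = l.row j' := by
    rw [wallAtLine_iff] at hb
    rw [wallAtRow_iff] at hvb hvb'
    grind
  have hbv : l.Visible b a (a + 1) := by
    intro w hw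
    rw [hrow.2] at hw
    have := hn w
    have := wallAtLine_of_wallAtRow hw
    grind
  have hbn : b ∈ l.nodeOf j' := mem_nodeOf_of_visible (mem_Icc.2 hb1) hrow.2
    (visible_of_isStrand hv1 hs le_rfl hab) hbv
  refine ⟨b, mem_signPart_neg.2 ⟨hbn, hrow.1⟩, ?_, ?_⟩
  · rw [mem_belowDiagonal] at hcB
    grind
  · have hbv' := visible_of_mem_nodeOf hbn hvj' a'
    rw [mem_belowDiagonal] at hcB'
    rw [wallAtLine_iff] at ha'
    rw [wallAtRow_iff] at hbv'
    have := hs'.right_le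
    grind

theorem outgoing_unique_pSymbol {v w w' : l.pSymbol.Vertex} (h : (v.1, w.1) ∈ l.pSymbol.arcs)
    (h' : (v.1, w'.1) ∈ l.pSymbol.arcs) {k : ℕ}
    (hk : w.1 ⊆ gap l.signature.length (signPart l.signature 1 v.1) k)
    (hk' : w'.1 ⊆ gap l.signature.length (signPart l.signature 1 v.1) k) : w = w' := by
  obtain ⟨i, hi, j, hj, hij, hv, hw, a, b, hs, hvi, hvj⟩ := mem_pSymbol_arc h
  obtain ⟨i', hi', j', hj', hij', hv', hw', a', b', hs', hvi', hvj'⟩ := mem_pSymbol_arc h'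
  have hii : i ∈ l.nodeOf i' := hv' ▸ hv ▸ mem_nodeOf_self hi
  have hii' : i' ∈ l.nodeOf i := hv ▸ hv' ▸ mem_nodeOf_self hi'
  have hr := row_eq_of_mem_nodeOf hii
  have hjw : j ∈ w.1 := hw ▸ mem_nodeOf_self hj
  have hjw' : j' ∈ w'.1 := hw' ▸ mem_nodeOf_self hj'
  have hs1 := hs (l.row i + 1) (by omega) (by omega)
  have hs1' := hs' (l.row i' + 1) (by omega) (by omega)
  have hB := (Joined.mem_belowDiagonal hi hj hij hs hvi hvj).2
  have hB' := (Joined.mem_belowDiagonal hi' hj' hij' hs' hvi' hvj').2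
  rcases lt_trichotomy a a' with hlt | rfl | hlt
  · obtain ⟨x, hx, h1, h2⟩ := outgoing_unique_aux hi' hii hs1 hs1' hvi hvi' hlt hj hj' hB hB'
    rw [← hv'] at hx
    exact absurd hx (mem_gap_of_between (hk hjw) (hk' hjw') h1 h2)
  · obtain ⟨-, rfl⟩ := isStrand_unique (x := a) (hr ▸ hs1) hs1' le_rfl hs1.1 le_rfl hs1'.1
    refine Subtype.ext ?_
    rw [hw, hw']
    exact nodeOf_eq_of_gatherer hj hj' (h := l.row i + 1) (fun k k1 k2 => hs k (by omega) k2)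
      (fun k k1 k2 => hs' k (by omega) k2) (by omega) (by omega) hvj hvj'
  · obtain ⟨x, hx, h1, h2⟩ := outgoing_unique_aux hi hii' hs1' hs1 hvi' hvi hlt hj' hj hB' hB
    rw [← hv] at hx
    exact absurd hx (mem_gap_of_between (hk' hjw') (hk hjw) h1 h2)

theorem incoming_unique_pSymbol {v w w' : l.pSymbol.Vertex} (h : (w.1, v.1) ∈ l.pSymbol.arcs)
    (h' : (w'.1, v.1) ∈ l.pSymbol.arcs) {k : ℕ}
    (hk : w.1 ⊆ gap l.signature.length (signPart l.signature (-1) v.1) k)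
    (hk' : w'.1 ⊆ gap l.signature.length (signPart l.signature (-1) v.1) k) : w = w' := by
  obtain ⟨i, hi, j, hj, hij, hw, hv, a, b, hs, hvi, hvj⟩ := mem_pSymbol_arc h
  obtain ⟨i', hi', j', hj', hij', hw', hv', a', b', hs', hvi', hvj'⟩ := mem_pSymbol_arc h'
  have hjj : j ∈ l.nodeOf j' := hv' ▸ hv ▸ mem_nodeOf_self hj
  have hjj' : j' ∈ l.nodeOf j := hv ▸ hv' ▸ mem_nodeOf_self hj'
  have hr := row_eq_of_mem_nodeOf hjj
  have hiw : i ∈ w.1 := hw ▸ mem_nodeOf_self hi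
  have hiw' : i' ∈ w'.1 := hw' ▸ mem_nodeOf_self hi'
  have hs1 := hs (l.row j) (by omega) (by omega)
  have hs1' := hs' (l.row j') (by omega) (by omega)
  have hB := (Joined.mem_belowDiagonal hi hj hij hs hvi hvj).1
  have hB' := (Joined.mem_belowDiagonal hi' hj' hij' hs' hvi' hvj').1
  rcases lt_trichotomy a a' with hlt | rfl | hlt
  · obtain ⟨x, hx, h1, h2⟩ := incoming_unique_aux hj' hjj hs1 hs1' hvj hvj' hlt hB hB'
    rw [← hv'] at hx
    exact absurd hx (mem_gap_of_between (hk hiw) (hk' hiw') h1 h2)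
  · obtain ⟨-, rfl⟩ := isStrand_unique (x := a) (hr ▸ hs1) hs1' le_rfl hs1.1 le_rfl hs1'.1
    refine Subtype.ext ?_
    rw [hw, hw']
    exact nodeOf_eq_of_producer hi hi' (h := l.row j) (fun k k1 k2 => hs k k1 k2)
      (fun k k1 k2 => hs' k k1 (by omega)) (by omega) (by omega) hvi hvi'
  · obtain ⟨x, hx, h1, h2⟩ := incoming_unique_aux hj hjj' hs1' hs1 hvj' hvj hlt hB' hB
    rw [← hv] at hx
    exact absurd hx (mem_gap_of_between (hk' hiw') (hk hiw) h1 h2)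

theorem arcs_pSymbol_subset (l : SignedOrdPart) :
    l.pSymbol.arcs ⊆ l.pSymbol.nodes ×ˢ l.pSymbol.nodes := by
  rintro ⟨v, w⟩ h
  obtain ⟨i, hi, j, hj, -, rfl, rfl⟩ := mem_arcs.1 h
  exact mem_product.2 ⟨nodeOf_mem_nodes hi, nodeOf_mem_nodes hj⟩

/-- The `P`-symbol of a signed ordered partition is a Schröder-Cambrian tree. -/
theorem isSchroderCambrianTree_pSymbol (l : SignedOrdPart) :
    IsSchroderCambrianTree l.signature l.pSymbol where
  label_nonempty v hv := by
    obtain ⟨i, hi, rfl⟩ := mem_nodes.1 hv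
    exact ⟨i, mem_nodeOf_self hi⟩
  label_disjoint v hv w hw hne := by
    obtain ⟨i, hi, rfl⟩ := mem_nodes.1 hv
    obtain ⟨j, hj, rfl⟩ := mem_nodes.1 hw
    rw [Finset.disjoint_left]
    intro m h1 h2
    exact hne (by rw [← nodeOf_eq_of_mem h1, nodeOf_eq_of_mem h2])
  label_cover := by
    ext m
    rw [length_signature, mem_biUnion]
    constructor
    · rintro ⟨v, hv, hm⟩
      obtain ⟨i, hi, rfl⟩ := mem_nodes.1 hv
      exact mem_Icc_of_mem_nodeOf hm
    · exact fun hm => ⟨_, nodeOf_mem_nodes hm, mem_nodeOf_self hm⟩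
  arcs_subset := arcs_pSymbol_subset l
  arcs_asymm v w h h' := by
    obtain ⟨i, hi, j, hj, -, rfl, rfl⟩ := mem_arcs.1 h
    have h1 := (isExtension_pSymbol l).lt _ _ h i (mem_nodeOf_self hi) j (mem_nodeOf_self hj)
    have h2 := (isExtension_pSymbol l).lt _ _ h' j (mem_nodeOf_self hj) i (mem_nodeOf_self hi)
    omega
  preconnected := preconnected_pSymbol l
  acyclic := isAcyclic_pSymbol l
  incoming v w h := by
    obtain ⟨i, hi, j, hj, hij, hw, hv, a, b, hs, hvi, hvj⟩ := mem_pSymbol_arc h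
    refine ⟨((signPart l.signature (-1) (l.nodeOf j)).filter (· ≤ a)).card, fun u hu c hc => ?_⟩
    rw [hv]
    refine mem_gap_of_gatherer (hs _ hij le_rfl) hvj hj ?_
    have hu' : (l.pSymbol.graph.deleteEdges {s(w, v)}).Reachable w u := by
      rw [Sym2.eq_swap]; exact hu
    rw [← subset_belowDiagonal_iff_of_reachable hi hj hij hs hvi hvj hw hv hu'
      (hw ▸ mem_nodeOf_self hi) hc]
    exact (Joined.mem_belowDiagonal hi hj hij hs hvi hvj).1
  incoming_unique v w w' h h' k hk hk' := by
    have h1 := mem_product.1 (arcs_pSymbol_subset l h)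
    have h2 := mem_product.1 (arcs_pSymbol_subset l h')
    exact congrArg Subtype.val (incoming_unique_pSymbol (v := ⟨v, h1.2⟩) (w := ⟨w, h1.1⟩)
      (w' := ⟨w', h2.1⟩) h h' hk hk')
  outgoing v w h := by
    obtain ⟨i, hi, j, hj, hij, hv, hw, a, b, hs, hvi, hvj⟩ := mem_pSymbol_arc h
    refine ⟨((signPart l.signature 1 (l.nodeOf i)).filter (· ≤ a)).card, fun u hu c hc => ?_⟩
    rw [hv]
    obtain ⟨m, hm, hm'⟩ := mem_nodes.1 u.2
    refine mem_gap_of_producer (hs _ (by omega) (by omega)) hvi hi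
      (mem_Icc_of_mem_nodeOf (i := m) (hm' ▸ hc)) ?_
    rw [← subset_belowDiagonal_iff_of_reachable hi hj hij hs hvi hvj hv hw hu
      (hw ▸ mem_nodeOf_self hj) hc]
    exact (Joined.mem_belowDiagonal hi hj hij hs hvi hvj).2
  outgoing_unique v w w' h h' k hk hk' := by
    have h1 := mem_product.1 (arcs_pSymbol_subset l h)
    have h2 := mem_product.1 (arcs_pSymbol_subset l h')
    exact congrArg Subtype.val (outgoing_unique_pSymbol (v := ⟨v, h1.1⟩) (w := ⟨w, h1.2⟩)
      (w' := ⟨w', h2.2⟩) h h' hk hk')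

end SignedOrdPart
end SchroderCambrian
namespace SchroderCambrian
open Finset
open SignedOrdPart LabeledDigraph Table

/-! ### Fibres of the P-symbol as sets of strict extensions -/

theorem LabeledDigraph.IsExtension.comp {α β : Type*} [LinearOrder α] [LinearOrder β]
    {D : LabeledDigraph} {r : ℕ → α} (hr : D.IsExtension r) {f : α → β} (hf : StrictMono f) :
    D.IsExtension (fun i => f (r i)) where
  const v hv i hi j hj := congrArg f (hr.const v hv i hi j hj)
  lt v w h i hi j hj := hf (hr.lt v w h i hi j hj)

/-- `r` and `r'` order the labels in the same way. -/
theorem IsSchroderCambrianTree.isExtension_congr {α β : Type*} [LinearOrder α] [LinearOrder β]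
    {e : Signature} {D : LabeledDigraph} (hT : IsSchroderCambrianTree e D) {r : ℕ → α} {r' : ℕ → β}
    (h : ∀ i ∈ Icc 1 e.length, ∀ j ∈ Icc 1 e.length, r i < r j ↔ r' i < r' j)
    (hr : D.IsExtension r) : D.IsExtension r' where
  const v hv i hi j hj := by
    have hi' := hT.mem_Icc (v := ⟨v, hv⟩) hi
    have hj' := hT.mem_Icc (v := ⟨v, hv⟩) hj
    have h1 := h i hi' j hj'
    have h2 := h j hj' i hi'
    rw [hr.const v hv i hi j hj] at h1 h2
    exact le_antisymm (not_lt.1 fun h => lt_irrefl _ (h2.2 h))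
      (not_lt.1 fun h => lt_irrefl _ (h1.2 h))
  lt v w hvw i hi j hj := by
    have hm := mem_product.1 (hT.arcs_subset hvw)
    exact (h i (hT.mem_Icc (v := ⟨v, hm.1⟩) hi) j (hT.mem_Icc (v := ⟨w, hm.2⟩) hj)).1
      (hr.lt v w hvw i hi j hj)

namespace SignedOrdPart

/-- Two dots seeing a common cell are comparable in the P-symbol or in the same node; conversely
arcs, and equalities inside a node, are witnessed by a cell seen from both dots. This removes
strands from the description of congruence and leaves only comparisons of rows. -/
theorem isExtension_pSymbol_iff {α : Type*} [LinearOrder α] {l : SignedOrdPart} {r : ℕ → α} :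
    l.pSymbol.IsExtension r ↔ ∀ i ∈ Icc 1 l.size, ∀ j ∈ Icc 1 l.size, ∀ x ≤ l.size,
      l.Visible i x (x + 1) → l.Visible j x (x + 1) →
        (l.row i < l.row j → r i < r j) ∧ (l.row i = l.row j → r i = r j) := by
  constructor
  · intro h i hi j hj x hx hvi hvj
    constructor
    · intro hij
      have key : ∀ {v w : Finset ℕ}, Relation.TransGen (fun v w => (v, w) ∈ l.pSymbol.arcs) v w →
          ∀ i ∈ v, ∀ j ∈ w, r i < r j := by
        intro v w hvw
        induction hvw with
        | single h1 => exact fun i hi j hj => h.lt _ _ h1 i hi j hj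
        | @tail b c _ h1 ih =>
          intro i hi j hj
          obtain ⟨m, hm, -, -, -, hm', -⟩ := mem_arcs.1 h1
          have hmb : m ∈ b := hm' ▸ mem_nodeOf_self hm
          exact (ih i hi m hmb).trans (h.lt _ _ h1 m hmb j hj)
      exact key (transGen_of_visible hx hi hj hij hvi hvj) i (mem_nodeOf_self hi) j
        (mem_nodeOf_self hj)
    · intro hij
      exact h.const _ (nodeOf_mem_nodes hi) i (mem_nodeOf_self hi) j
        (mem_nodeOf_of_visible hj hij.symm hvi hvj)
  · intro h
    have const : ∀ v ∈ l.pSymbol.nodes, ∀ i ∈ v, ∀ j ∈ v, r i = r j := by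
      intro v hv i hi j hj
      obtain ⟨m, hm, rfl⟩ := mem_nodes.1 hv
      have hi' := mem_Icc_of_mem_nodeOf hi
      have hv : l.Visible i i (i + 1) := fun c hc => by omega
      rw [← nodeOf_eq_of_mem hi] at hj
      exact (h i hi' j (mem_Icc_of_mem_nodeOf hj) i (mem_Icc.1 hi').2 hv
        (visible_of_mem_nodeOf hj hv)).2 (row_eq_of_mem_nodeOf hj).symm
    refine ⟨const, ?_⟩
    intro v w hvw i hi j hj
    obtain ⟨m, hm, m', hm', hJ, rfl, rfl⟩ := mem_arcs.1 hvw
    obtain ⟨x, hx, h1, h2⟩ := hJ.exists_visible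
    rw [const _ (nodeOf_mem_nodes hm) i hi m (mem_nodeOf_self hm),
      const _ (nodeOf_mem_nodes hm') j hj m' (mem_nodeOf_self hm')]
    exact (h m hm m' hm' x hx h1 h2).1 hJ.1

/-- The rows are a common strict extension of `l.pSymbol` and `D`. They are cast to the reals
because uniqueness is stated for real-valued extensions. -/
theorem pSymbol_eq_of_isExtension {l : SignedOrdPart} {D : LabeledDigraph}
    (hT : IsSchroderCambrianTree l.signature D) (h : D.IsExtension l.row) : l.pSymbol = D :=
  eq_of_common_extension (isSchroderCambrianTree_pSymbol l)
    ((isExtension_pSymbol l).comp (f := fun k : ℕ => (k : ℝ)) Nat.strictMono_cast) hT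
    (h.comp (f := fun k : ℕ => (k : ℝ)) Nat.strictMono_cast)

/-- The tree of a signed ordered partition, as an element of the type of trees. -/
noncomputable def tree (l : SignedOrdPart) : SchroderCambrianTree l.signature :=
  ⟨l.pSymbol, isSchroderCambrianTree_pSymbol l⟩

/-- Two signed ordered partitions with the same signature and the same `P`-symbol. -/
def Congruent (l l' : SignedOrdPart) : Prop := l.signature = l'.signature ∧ l.pSymbol = l'.pSymbol

theorem Congruent.size_eq {l l' : SignedOrdPart} (h : Congruent l l') : l.size = l'.size := by
  rw [← length_signature, ← length_signature, h.1]

theorem Congruent.isExtension {l l' : SignedOrdPart} (h : Congruent l l') :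
    l.pSymbol.IsExtension l'.row := by
  rw [h.2]; exact isExtension_pSymbol l'

theorem congruent_of_isExtension {l l' : SignedOrdPart} (hs : l.signature = l'.signature)
    (h : l.pSymbol.IsExtension l'.row) : Congruent l l' :=
  ⟨hs, (pSymbol_eq_of_isExtension (hs ▸ isSchroderCambrianTree_pSymbol l) h).symm⟩

end SignedOrdPart

/-- The row of the dot of column `i`. -/
def Table.rowAt (w : Table) (i : ℕ) : ℕ := (w.getD (i - 1) (0, 1)).1

theorem Table.rowAt_eq {w : Table} {i : ℕ} (hi : i ∈ Icc 1 w.length) :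
    ∃ h : i - 1 < w.length, w.rowAt i = w[i - 1].1 := by
  rw [mem_Icc] at hi
  have h : i - 1 < w.length := by omega
  exact ⟨h, by rw [rowAt, List.getD_eq_getElem _ _ h]⟩

theorem Table.rowAt_mem {w : Table} {i : ℕ} (hi : i ∈ Icc 1 w.length) : w.rowAt i ∈ rowSet w := by
  obtain ⟨h, e⟩ := rowAt_eq hi
  rw [e]
  exact fst_mem_rowSet (List.getElem_mem h)

theorem Table.rowAt_relabel {w : Table} {f : ℕ → ℕ} {i : ℕ} (hi : i ∈ Icc 1 w.length) :
    rowAt (relabel f w) i = f (rowAt w i) := by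
  obtain ⟨h, e⟩ := rowAt_eq hi
  obtain ⟨h', e'⟩ := rowAt_eq (w := relabel f w) (i := i) (by rwa [length_relabel])
  rw [e, e']
  simp [relabel]

namespace SignedOrdPart

theorem row_eq_rowAt (l : SignedOrdPart) (i : ℕ) : l.row i = rowAt l.table i := rfl

theorem row_std_lt_iff {w : Table} {i j : ℕ} (hi : i ∈ Icc 1 w.length) (hj : j ∈ Icc 1 w.length) :
    (std w).row i < (std w).row j ↔ rowAt w i < rowAt w j := by
  rw [row_eq_rowAt, row_eq_rowAt]
  change rowAt (relabel (rank w) w) i < rowAt (relabel (rank w) w) j ↔ _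
  rw [rowAt_relabel hi, rowAt_relabel hj, rank_lt_rank_iff (rowAt_mem hi)]

theorem signature_std (w : Table) : (std w).signature = w.map Prod.snd := by
  change (relabel (rank w) w).map Prod.snd = _
  simp [relabel]

/-- The signed ordered partition of signature `e` with the columns ordered by `r`. -/
noncomputable def ofRow (e : Signature) (r : ℕ → ℕ) : SignedOrdPart :=
  std (e.mapIdx fun k s => (r (k + 1), s))

theorem signature_ofRow (e : Signature) (r : ℕ → ℕ) : (ofRow e r).signature = e := by
  rw [ofRow, signature_std]
  refine List.ext_getElem (by simp) fun k h1 h2 => by simp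

theorem row_ofRow_lt_iff {e : Signature} {r : ℕ → ℕ} {i j : ℕ} (hi : i ∈ Icc 1 e.length)
    (hj : j ∈ Icc 1 e.length) : (ofRow e r).row i < (ofRow e r).row j ↔ r i < r j := by
  have key : ∀ {i}, i ∈ Icc 1 e.length → rowAt (e.mapIdx fun k s => (r (k + 1), s)) i = r i := by
    intro i hi
    obtain ⟨h, e'⟩ := rowAt_eq (w := e.mapIdx fun k s => (r (k + 1), s)) (i := i) (by simpa using hi)
    rw [e']
    rw [mem_Icc] at hi
    simp only [List.getElem_mapIdx]
    congr 1; omega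
  rw [ofRow, row_std_lt_iff (by simpa using hi) (by simpa using hj), key hi, key hj]

/-- Place the dots at the levels of a strict extension of the tree. -/
theorem exists_pSymbol_eq {e : Signature} {D : LabeledDigraph} (hT : IsSchroderCambrianTree e D) :
    ∃ l : SignedOrdPart, l.signature = e ∧ l.pSymbol = D := by
  obtain ⟨r, hr⟩ := hT.exists_extension
  refine ⟨ofRow e r, signature_ofRow e r, pSymbol_eq_of_isExtension ?_ ?_⟩
  · rwa [signature_ofRow]
  · exact hT.isExtension_congr (fun i hi j hj => (row_ofRow_lt_iff hi hj).symm) hr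

/-! ### Restriction to columns -/

theorem sign_eq (l : SignedOrdPart) {i : ℕ} (hi : i ∈ Icc 1 l.size) :
    l.signature.sign i = (l.table.getD (i - 1) (0, 1)).2 := by
  rw [mem_Icc] at hi
  have h : i - 1 < l.table.length := by change i - 1 < l.size; omega
  rw [Signature.sign, signature, List.getD_eq_getElem _ _ (by simpa using h),
    List.getD_eq_getElem _ _ h, List.getElem_map]

/-- Deleting columns outside an interval does not change visibility inside it, so the local
comparisons for the restriction are among those for `m`. The window after column `k` of width `q`
covers both `firstCols` and `lastCols`. -/
theorem congruent_restrict {m m' : SignedOrdPart} (h : Congruent m m') (k q : ℕ) :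
    Congruent (std ((m.table.drop k).take q)) (std ((m'.table.drop k).take q)) := by
  have hsig : ∀ m : SignedOrdPart, (std ((m.table.drop k).take q)).signature =
      (m.signature.drop k).take q := by
    intro m
    rw [signature_std, List.map_take, List.map_drop]; rfl
  have hsize : ∀ m : SignedOrdPart, (std ((m.table.drop k).take q)).size = min q (m.size - k) := by
    intro m
    rw [size_std, List.length_take, List.length_drop]; rfl
  have hrow : ∀ (m : SignedOrdPart) i, i ∈ Icc 1 (min q (m.size - k)) →
      ∀ j, j ∈ Icc 1 (min q (m.size - k)) →
      ((std ((m.table.drop k).take q)).row i < (std ((m.table.drop k).take q)).row j ↔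
        m.row (i + k) < m.row (j + k)) := by
    intro m i hi j hj
    have hlen : ((m.table.drop k).take q).length = min q (m.size - k) := by
      rw [List.length_take, List.length_drop]; rfl
    have key : ∀ {i}, i ∈ Icc 1 (min q (m.size - k)) →
        rowAt ((m.table.drop k).take q) i = m.row (i + k) := by
      intro i hi
      obtain ⟨h1, e1⟩ := rowAt_eq (w := (m.table.drop k).take q) (i := i) (by rwa [hlen])
      obtain ⟨h2, e2⟩ := rowAt_eq (w := m.table) (i := i + k) (by
        rw [mem_Icc] at *; change _ ∧ _ ≤ m.size; omega)
      rw [e1, row_eq_rowAt, e2]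
      simp only [List.getElem_take, List.getElem_drop]
      rw [mem_Icc] at hi
      congr 2; omega
    rw [row_std_lt_iff (by rwa [hlen]) (by rwa [hlen]), key hi, key hj]
  have hneg : ∀ {i}, i ∈ Icc 1 (min q (m.size - k)) →
      ((std ((m.table.drop k).take q)).Neg i ↔ m.Neg (i + k)) := by
    intro i hi
    rw [mem_Icc] at hi
    have hl := length_signature m
    rw [Neg, Neg, hsig, Signature.sign, Signature.sign,
      List.getD_eq_getElem _ _ (by rw [List.length_take, List.length_drop]; omega),
      List.getD_eq_getElem _ _ (by omega)]
    simp only [List.getElem_take, List.getElem_drop]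
    have : k + (i - 1) = i + k - 1 := by omega
    simp only [this]
  refine congruent_of_isExtension (by rw [hsig, hsig, h.1]) ?_
  have hext := isExtension_pSymbol_iff.1 h.isExtension
  rw [isExtension_pSymbol_iff, hsize]
  -- A wall hiding the cell from the dot in `m` lies between them, hence within the window.
  have hvis : ∀ {i x}, i ∈ Icc 1 (min q (m.size - k)) → x ≤ min q (m.size - k) →
      (std ((m.table.drop k).take q)).Visible i x (x + 1) → m.Visible (i + k) (x + k) (x + k + 1) := by
    intro i x hi hx hv c hc
    by_contra hcon
    have hi' := mem_Icc.1 hi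
    have hck : c - k ∈ Icc 1 (min q (m.size - k)) := by rw [mem_Icc]; omega
    have e : c = c - k + k := by rw [mem_Icc] at hck; omega
    have hw : (std ((m.table.drop k).take q)).WallAtRow
        ((std ((m.table.drop k).take q)).row i) (c - k) := by
      rw [wallAtRow_iff] at hc ⊢
      rw [hneg hck, hrow _ _ hi _ hck, hrow _ _ hck _ hi, ← e, hsize]
      exact ⟨mem_Icc.1 hck, hc.2⟩
    have := hv _ hw
    omega
  intro i hi j hj x hx hvi hvj
  have hi' := hi
  have hj' := hj
  rw [h.size_eq] at hi' hj'
  rw [mem_Icc] at hi' hj'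
  have hs := h.size_eq
  have := hext (i + k) (by rw [mem_Icc]; omega) (j + k) (by rw [mem_Icc]; omega) (x + k) (by
    rw [mem_Icc] at hi; omega) (hvis hi hx hvi) (hvis hj hx hvj)
  rw [h.size_eq] at hi hj
  have r1 := hrow m i (by rwa [h.size_eq]) j (by rwa [h.size_eq])
  have r2 := hrow m j (by rwa [h.size_eq]) i (by rwa [h.size_eq])
  have r3 := hrow m' i hi j hj
  have r4 := hrow m' j hj i hi
  omega

theorem congruent_firstCols {m m' : SignedOrdPart} (h : Congruent m m') (k : ℕ) :
    Congruent (firstCols k m) (firstCols k m') := by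
  have := congruent_restrict h 0 k
  simpa [firstCols] using this

theorem congruent_lastCols {m m' : SignedOrdPart} (h : Congruent m m') (k : ℕ) :
    Congruent (lastCols k m) (lastCols k m') := by
  have := congruent_restrict h k m.size
  rw [List.take_of_length_le (by rw [List.length_drop]; exact Nat.sub_le _ _),
    List.take_of_length_le (by rw [List.length_drop, h.size_eq]; exact Nat.sub_le _ _)] at this
  exact this

end SignedOrdPart
end SchroderCambrian
namespace SchroderCambrian
open Finset TensorProduct
open SignedOrdPart LabeledDigraph Table

/-! ### Shuffling tables along a word -/

/-- The table obtained by interleaving the columns of `u` (letters `true`) and of `v`. -/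
def Table.merge : List Bool → Table → Table → Table
  | true :: b, x :: u, v => x :: merge b u v
  | false :: b, u, y :: v => y :: merge b u v
  | _, _, _ => []

theorem Table.merge_map_snd : ∀ (b : List Bool) {u v u' v' : Table},
    u.map Prod.snd = u'.map Prod.snd → v.map Prod.snd = v'.map Prod.snd →
    (merge b u v).map Prod.snd = (merge b u' v').map Prod.snd
  | [], _, _, _, _, _, _ => by simp [merge]
  | true :: b, [], v, [], v', _, _ => by simp [merge]
  | true :: b, x :: u, v, x' :: u', v', h, h' => by
    simp only [List.map_cons, List.cons.injEq] at h
    simp only [merge, List.map_cons, List.cons.injEq]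
    exact ⟨h.1, merge_map_snd b h.2 h'⟩
  | false :: b, u, [], u', [], _, _ => by simp [merge]
  | false :: b, u, y :: v, u', y' :: v', h, h' => by
    simp only [List.map_cons, List.cons.injEq] at h'
    simp only [merge, List.map_cons, List.cons.injEq]
    exact ⟨h'.1, merge_map_snd b h h'.2⟩

theorem Table.merge_spec {k : ℕ} : ∀ {b : List Bool} {u v : Table},
    b.count true = u.length → b.count false = v.length → (∀ x ∈ u, x.1 < k) → (∀ x ∈ v, k ≤ x.1) →
    (merge b u v).map (fun x => decide (x.1 < k)) = b ∧ rowsOf (· < k) (merge b u v) = u ∧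
      rowsOf (k ≤ ·) (merge b u v) = v
  | [], u, v, h, h', _, _ => by
    simp only [List.count_nil] at h h'
    rw [List.length_eq_zero_iff.1 h.symm, List.length_eq_zero_iff.1 h'.symm]
    simp [merge, rowsOf]
  | true :: b, [], v, h, _, _, _ => by simp at h
  | true :: b, x :: u, v, h, h', hu, hv => by
    obtain ⟨h1, h2, h3⟩ := merge_spec (b := b) (u := u) (v := v) (by simpa using h)
      (by simpa using h') (fun y hy => hu y (List.mem_cons_of_mem _ hy)) hv
    have hx : x.1 < k := hu x List.mem_cons_self
    refine ⟨?_, ?_, ?_⟩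
    · simp [merge, hx, h1]
    · rw [rowsOf] at h2 ⊢
      simp [merge, hx, h2]
    · rw [rowsOf] at h3 ⊢
      simp [merge, hx, h3]
  | false :: b, u, [], _, h', _, _ => by simp at h'
  | false :: b, u, y :: v, h, h', hu, hv => by
    obtain ⟨h1, h2, h3⟩ := merge_spec (b := b) (u := u) (v := v) (by simpa using h)
      (by simpa using h') hu (fun z hz => hv z (List.mem_cons_of_mem _ hz))
    have hy : k ≤ y.1 := hv y List.mem_cons_self
    refine ⟨?_, ?_, ?_⟩
    · simp [merge, hy, h1]
    · rw [rowsOf] at h2 ⊢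
      simp [merge, hy, h2]
    · rw [rowsOf] at h3 ⊢
      simp [merge, hy, h3]

/-- An entry kept by the filter moves to the position given by the number of kept entries before it;
this is the column numbering of a restriction. -/
theorem Table.getElem?_filter_countP {α : Type*} (p : α → Bool) : ∀ (w : List α) (i : ℕ)
    (hi : i < w.length), p w[i] = true → (w.filter p)[(w.take i).countP p]? = some w[i]
  | [], i, hi, _ => by simp at hi
  | x :: w, 0, _, h => by
    simp only [List.getElem_cons_zero] at h
    simp [h]
  | x :: w, i + 1, hi, h => by
    have hi' : i < w.length := by simpa using hi
    have ih := getElem?_filter_countP p w i hi' (by simpa using h)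
    by_cases hx : p x = true
    · simp [hx, ih]
    · simp [hx, ih]

theorem Table.exists_countP_take_eq {α : Type*} (p : α → Bool) : ∀ (w : List α) (d : ℕ),
    d < w.countP p → ∃ (i : ℕ) (hi : i < w.length), p w[i] = true ∧ (w.take i).countP p = d
  | [], d, h => by simp at h
  | x :: w, d, h => by
    by_cases hx : p x = true
    · rcases d with _ | d
      · exact ⟨0, by simp, by simpa using hx, by simp⟩
      · obtain ⟨i, hi, h1, h2⟩ := exists_countP_take_eq p w d (by simpa [hx] using h)
        exact ⟨i + 1, by simpa using hi, by simpa using h1, by simp [hx, h2]⟩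
    · obtain ⟨i, hi, h1, h2⟩ := exists_countP_take_eq p w d (by simpa [hx] using h)
      exact ⟨i + 1, by simpa using hi, by simpa using h1, by simp [hx, h2]⟩

namespace SignedOrdPart

/-- `φ` numbers the columns of `m` satisfying `p`, and `l` is the restriction of `m` to them. -/
structure IsRestriction (l m : SignedOrdPart) (p : ℕ → Prop) (φ : ℕ → ℕ) : Prop where
  mono : Monotone φ
  lt_of_lt : ∀ c ∈ Icc 1 m.size, p c → ∀ x < c, φ x < φ c
  mem : ∀ c ∈ Icc 1 m.size, p c → φ c ∈ Icc 1 l.size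
  le : ∀ x, φ x ≤ l.size
  surj : ∀ d ∈ Icc 1 l.size, ∃ c ∈ Icc 1 m.size, p c ∧ φ c = d
  row : ∀ c ∈ Icc 1 m.size, p c → ∀ d ∈ Icc 1 m.size, p d →
    (l.row (φ c) < l.row (φ d) ↔ m.row c < m.row d)
  neg : ∀ c ∈ Icc 1 m.size, p c → (l.Neg (φ c) ↔ m.Neg c)

/-- Deleting dots only removes walls, so what is visible in `m` stays visible in the restriction. -/
theorem IsRestriction.visible {l m : SignedOrdPart} {p : ℕ → Prop} {φ : ℕ → ℕ}
    (h : IsRestriction l m p φ) {i x : ℕ} (hi : i ∈ Icc 1 m.size) (hp : p i)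
    (hv : m.Visible i x (x + 1)) : l.Visible (φ i) (φ x) (φ x + 1) := by
  intro d hd
  have hd' := (wallAtRow_iff.1 hd).1
  obtain ⟨c, hc, hpc, rfl⟩ := h.surj d (mem_Icc.2 hd')
  have hw : m.WallAtRow (m.row i) c := by
    rw [wallAtRow_iff] at hd ⊢
    rw [h.neg c hc hpc, h.row i hi hp c hc hpc, h.row c hc hpc i hi hp] at hd
    exact ⟨mem_Icc.1 hc, hd.2⟩
  have := hv c hw
  constructor
  · rintro ⟨h1, h2⟩
    have h3 : i < c := by
      by_contra hcon
      have := h.mono (not_lt.1 hcon)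
      omega
    have h4 : c ≤ x := by
      by_contra hcon
      have := h.lt_of_lt c hc hpc x (by omega)
      omega
    omega
  · rintro ⟨h1, h2⟩
    have h3 : x < c := by
      by_contra hcon
      have := h.mono (not_lt.1 hcon)
      omega
    have h4 : c < i := by
      by_contra hcon
      have := h.mono (not_lt.1 hcon)
      omega
    omega

/-- The local comparison in the glued tables is pulled back from the congruent restrictions `l` and
`l'`, through their common column numbering. -/
theorem IsRestriction.compare {l m l' m' : SignedOrdPart} {p : ℕ → Prop} {φ : ℕ → ℕ}
    (h : IsRestriction l m p φ) (h' : IsRestriction l' m' p φ) (hm : m.size = m'.size)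
    (hl : Congruent l l') {i j x : ℕ} (hi : i ∈ Icc 1 m.size) (hpi : p i) (hj : j ∈ Icc 1 m.size)
    (hpj : p j) (hvi : m.Visible i x (x + 1)) (hvj : m.Visible j x (x + 1)) :
    (m.row i < m.row j → m'.row i < m'.row j) ∧ (m.row i = m.row j → m'.row i = m'.row j) := by
  have key := isExtension_pSymbol_iff.1 hl.isExtension (φ i) (h.mem i hi hpi) (φ j) (h.mem j hj hpj)
    (φ x) (h.le x) (h.visible hi hpi hvi) (h.visible hj hpj hvj)
  have r1 := h.row i hi hpi j hj hpj
  have r2 := h.row j hj hpj i hi hpi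
  rw [hm] at hi hj
  have r3 := h'.row i hi hpi j hj hpj
  have r4 := h'.row j hj hpj i hi hpi
  omega

/-- The numbering of the kept columns depends only on the word `b`, so two tables with the same word
are restricted along the same map. The increasing map `f` absorbs the shift of the row numbers. -/
theorem isRestriction_filter {l m : SignedOrdPart} {f : ℕ → ℕ} {q : ℕ × ℤˣ → Bool}
    (hf : StrictMono f) (ht : relabel f l.table = m.table.filter q) {b : List Bool}
    (hb : m.table.map q = b) :
    IsRestriction l m (fun c => b.getD (c - 1) false = true) (fun c => (b.take c).countP id) := by
  have hcount : ∀ c, (b.take c).countP id = (m.table.take c).countP q := by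
    intro c
    rw [← hb, ← List.map_take, List.countP_map]; rfl
  have hsize : l.size = m.table.countP q := by
    rw [List.countP_eq_length_filter, ← ht, length_relabel]; rfl
  have hmem : ∀ c ∈ Icc 1 m.size, b.getD (c - 1) false = true →
      ∃ h : c - 1 < m.table.length, q m.table[c - 1] = true := by
    intro c hc hp
    rw [mem_Icc] at hc
    have h : c - 1 < m.table.length := by change _ < m.size; omega
    refine ⟨h, ?_⟩
    rw [← hb, List.getD_eq_getElem _ _ (by simpa using h)] at hp
    simpa using hp
  -- Columns are numbered from 1 and list entries from 0, so the kept column `c` gets the number of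
  -- kept entries before position `c - 1`, plus one.
  have hstep : ∀ c ∈ Icc 1 m.size, b.getD (c - 1) false = true →
      (b.take c).countP id = (m.table.take (c - 1)).countP q + 1 := by
    intro c hc hp
    obtain ⟨h, hq⟩ := hmem c hc hp
    rw [mem_Icc] at hc
    rw [hcount]
    obtain ⟨c, rfl⟩ : ∃ d, c = d + 1 := ⟨c - 1, by omega⟩
    simp only [Nat.add_sub_cancel] at h hq ⊢
    rw [List.take_add_one, List.getElem?_eq_getElem h, List.countP_append]
    simp [hq]
  have hle : ∀ x, (b.take x).countP id ≤ l.size := fun x => by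
    rw [hcount, hsize]
    exact (List.take_sublist _ _).countP_le
  have hmono : Monotone fun c => (b.take c).countP id := fun c d hcd =>
    (List.take_prefix_take_left hcd).sublist.countP_le
  have hcell : ∀ c ∈ Icc 1 m.size, b.getD (c - 1) false = true →
      f (l.row ((b.take c).countP id)) = m.row c ∧ (l.Neg ((b.take c).countP id) ↔ m.Neg c) := by
    intro c hc hp
    obtain ⟨h, hq⟩ := hmem c hc hp
    have h1 := getElem?_filter_countP q m.table (c - 1) h hq
    rw [← ht, relabel, List.getElem?_map] at h1
    obtain ⟨y, hy, hy'⟩ := Option.map_eq_some_iff.1 h1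
    have hl : l.table.getD ((b.take c).countP id - 1) (0, 1) = y := by
      rw [hstep c hc hp, Nat.add_sub_cancel, List.getD_eq_getElem?_getD, hy]; rfl
    have hin : (b.take c).countP id ∈ Icc 1 l.size := by
      rw [mem_Icc]
      exact ⟨by rw [hstep c hc hp]; omega, hle c⟩
    have hm : m.table.getD (c - 1) (0, 1) = m.table[c - 1] := List.getD_eq_getElem _ _ h
    refine ⟨?_, ?_⟩
    · rw [row, row, hl, hm, ← hy']; rfl
    · rw [Neg, Neg, sign_eq _ hin, sign_eq _ hc, hl, hm, ← hy']; rfl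
  refine ⟨hmono, ?_, ?_, hle, ?_, ?_, ?_⟩
  · intro c hc hp x hx
    rw [hstep c hc hp]
    have := hmono (show x ≤ c - 1 by omega)
    simp only at this
    rw [hcount (c - 1)] at this
    omega
  · intro c hc hp
    rw [mem_Icc]
    exact ⟨by rw [hstep c hc hp]; omega, hle c⟩
  · intro d hd
    rw [mem_Icc, hsize] at hd
    obtain ⟨i, hi, h1, h2⟩ := exists_countP_take_eq q m.table (d - 1) (by omega)
    have hi1 : i + 1 ∈ Icc 1 m.size := mem_Icc.2 ⟨by omega, hi⟩
    have hp : b.getD (i + 1 - 1) false = true := by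
      rw [Nat.add_sub_cancel, ← hb, List.getD_eq_getElem _ _ (by simpa using hi)]
      simpa using h1
    refine ⟨i + 1, hi1, hp, ?_⟩
    rw [hstep _ hi1 hp, Nat.add_sub_cancel, h2]
    omega
  · intro c hc hp d hd hp'
    rw [← (hcell c hc hp).1, ← (hcell d hd hp').1, hf.lt_iff_lt]
  · exact fun c hc hp => (hcell c hc hp).2

/-! ### The elements of a convolution product, indexed by words -/

/-- The element of the convolution product of `l` and `l'` whose word of columns is `b`. -/
noncomputable def glue (b : List Bool) (l l' : SignedOrdPart) : SignedOrdPart :=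
  std (merge b l.table (relabel (l.numParts + ·) l'.table))

/-- The word telling which columns have their dot in the first `k` rows. -/
def word (k : ℕ) (m : SignedOrdPart) : List Bool := m.table.map fun x => decide (x.1 < k)

section Glue

variable {b : List Bool} {l l' : SignedOrdPart}

theorem merge_glue_spec (h : b.count true = l.size) (h' : b.count false = l'.size) :
    (merge b l.table (relabel (l.numParts + ·) l'.table)).map
        (fun x => decide (x.1 < l.numParts)) = b ∧
      rowsOf (· < l.numParts) (merge b l.table (relabel (l.numParts + ·) l'.table)) = l.table ∧
      rowsOf (l.numParts ≤ ·) (merge b l.table (relabel (l.numParts + ·) l'.table)) =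
        relabel (l.numParts + ·) l'.table := by
  refine merge_spec h (by rw [length_relabel]; exact h') ?_ ?_
  · exact fun x hx => mem_rowSet_table.1 (fst_mem_rowSet hx)
  · intro x hx
    rw [relabel, List.mem_map] at hx
    obtain ⟨y, -, rfl⟩ := hx
    exact Nat.le_add_right _ _

theorem table_glue (h : b.count true = l.size) (h' : b.count false = l'.size) :
    (glue b l l').table = merge b l.table (relabel (l.numParts + ·) l'.table) := by
  obtain ⟨-, h2, h3⟩ := merge_glue_spec h h'
  refine pack_eq_self (packed_of_rowSet_eq_range (k := l.numParts + l'.numParts) ?_)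
  have e : ∀ M : Table, rowSet M = rowSet (rowsOf (· < l.numParts) M) ∪
      rowSet (rowsOf (l.numParts ≤ ·) M) := by
    intro M
    rw [rowSet_rowsOf, rowSet_rowsOf]
    ext x; simp only [mem_union, mem_filter]
    have := lt_or_ge x l.numParts
    tauto
  rw [e, h2, h3, rowSet_relabel, rowSet_table, rowSet_table]
  ext x; simp only [mem_union, mem_range, mem_image]
  constructor
  · rintro (h | ⟨y, hy, rfl⟩) <;> omega
  · intro h
    rcases lt_or_ge x l.numParts with h' | h'
    · exact Or.inl h'
    · exact Or.inr ⟨x - l.numParts, by omega, by omega⟩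

theorem word_glue (h : b.count true = l.size) (h' : b.count false = l'.size) :
    word l.numParts (glue b l l') = b := by
  rw [word, table_glue h h']
  exact (merge_glue_spec h h').1

theorem length_word (k : ℕ) (m : SignedOrdPart) : (word k m).length = m.size := by
  simp [word, size]

theorem size_glue (h : b.count true = l.size) (h' : b.count false = l'.size) :
    (glue b l l').size = l.size + l'.size := by
  rw [← length_word l.numParts, word_glue h h', ← h, ← h', List.count_true_add_count_false]

theorem memConvolution_glue (h : b.count true = l.size) (h' : b.count false = l'.size) :
    MemConvolution (glue b l l') l l' := by
  obtain ⟨-, h2, h3⟩ := merge_glue_spec h h'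
  refine ⟨size_glue h h', ?_, ?_⟩
  · rw [rows, table_glue h h', h2, std_table]
  · rw [rows, table_glue h h', h3, std_relabel, std_table]
    exact fun x _ y _ hxy => by simpa using hxy

/-- Two columns from the same factor are compared through the congruence of that factor. A column of
the lower factor is below any column of the upper one in both tables, because the tables share their
word. -/
theorem congruent_glue {l₁ l₁' : SignedOrdPart} (hl : Congruent l l₁) (hl' : Congruent l' l₁')
    (h : b.count true = l.size) (h' : b.count false = l'.size) :
    Congruent (glue b l l') (glue b l₁ l₁') := by
  have g : b.count true = l₁.size := by rw [h, hl.size_eq]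
  have g' : b.count false = l₁'.size := by rw [h', hl'.size_eq]
  have hsize : (glue b l l').size = (glue b l₁ l₁').size := by
    rw [size_glue h h', size_glue g g', hl.size_eq, hl'.size_eq]
  have res : ∀ {l l' : SignedOrdPart}, b.count true = l.size → b.count false = l'.size →
      IsRestriction l (glue b l l') (fun c => b.getD (c - 1) false = true)
        (fun c => (b.take c).countP id) ∧
      IsRestriction l' (glue b l l') (fun c => (b.map not).getD (c - 1) false = true)
        (fun c => ((b.map not).take c).countP id) ∧
      ∀ c ∈ Icc 1 (glue b l l').size,
        (b.getD (c - 1) false = true ∧ (glue b l l').row c < l.numParts) ∨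
        ((b.map not).getD (c - 1) false = true ∧ l.numParts ≤ (glue b l l').row c) := by
    intro l l' h h'
    obtain ⟨h1, h2, h3⟩ := merge_glue_spec h h'
    rw [← table_glue h h'] at h1 h2 h3
    refine ⟨isRestriction_filter (f := id) (q := fun x => decide (x.1 < l.numParts)) strictMono_id
      ?_ h1, isRestriction_filter (f := (l.numParts + ·)) (q := fun x => decide (l.numParts ≤ x.1))
      (fun x y hxy => by simpa using hxy) h3.symm ?_, ?_⟩
    · rw [relabel_eq_self (f := id) (fun _ _ => rfl)]; exact h2.symm
    · conv_rhs => rw [← h1]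
      rw [List.map_map]
      refine List.map_congr_left fun x _ => ?_
      by_cases hx : x.1 < l.numParts
      · simp [hx]
      · simp [hx, not_lt.1 hx]
    · intro c hc
      rw [mem_Icc] at hc
      have hc' : c - 1 < (glue b l l').table.length := by change _ < (glue b l l').size; omega
      have hr : (glue b l l').row c = (glue b l l').table[c - 1].1 := by
        rw [row, List.getD_eq_getElem _ _ hc']
      have hlen : c - 1 < b.length := by rw [← h1]; simpa using hc'
      have hb : b[c - 1] = decide ((glue b l l').row c < l.numParts) := by
        have e : ((glue b l l').table.map (fun x => decide (x.1 < l.numParts)))[c - 1]? =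
            b[c - 1]? := by rw [h1]
        rw [List.getElem?_map, List.getElem?_eq_getElem hc', List.getElem?_eq_getElem hlen] at e
        rw [hr]
        simpa using e.symm
      rw [List.getD_eq_getElem _ _ hlen, List.getD_eq_getElem _ _ (by simpa using hlen),
        List.getElem_map, hb]
      rcases lt_or_ge ((glue b l l').row c) l.numParts with hlt | hge
      · left; simp [hlt]
      · right; simp [hge]
  obtain ⟨a1, a2, a3⟩ := res h h'
  obtain ⟨b1, b2, b3⟩ := res g g'
  refine congruent_of_isExtension ?_ (isExtension_pSymbol_iff.2 ?_)
  · rw [signature, signature, table_glue h h', table_glue g g']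
    refine merge_map_snd b hl.1 ?_
    have e : ∀ k (w : Table), (relabel k w).map Prod.snd = w.map Prod.snd := by
      intro k w; simp [relabel]
    rw [e, e]; exact hl'.1
  · intro i hi j hj x hx hvi hvj
    have excl : ∀ c ∈ Icc 1 (glue b l l').size,
        ¬ (b.getD (c - 1) false = true ∧ (b.map not).getD (c - 1) false = true) := by
      rintro c hc ⟨e1, e2⟩
      rcases lt_or_ge (c - 1) b.length with hlt | hge
      · rw [List.getD_eq_getElem _ _ hlt] at e1
        rw [List.getD_eq_getElem _ _ (by simpa using hlt), List.getElem_map, e1] at e2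
        simp at e2
      · rw [List.getD_eq_default _ _ hge] at e1
        simp at e1
    have hi' := hi
    have hj' := hj
    rw [hsize] at hi' hj'
    have ei := excl i hi
    have ej := excl j hj
    rcases a3 i hi with ⟨p1, p2⟩ | ⟨p1, p2⟩ <;> rcases a3 j hj with ⟨q1, q2⟩ | ⟨q1, q2⟩
    · exact a1.compare b1 hsize hl hi p1 hj q1 hvi hvj
    · rcases b3 i hi' with ⟨r1, r2⟩ | ⟨r1, r2⟩ <;> rcases b3 j hj' with ⟨s1, s2⟩ | ⟨s1, s2⟩
      · exact absurd ⟨s1, q1⟩ ej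
      · omega
      · exact absurd ⟨p1, r1⟩ ei
      · exact absurd ⟨p1, r1⟩ ei
    · omega
    · exact a2.compare b2 hsize hl' hi p1 hj q1 hvi hvj

/-- A table is recovered from its bottom rows, its top rows and the word telling which columns
belong to which; so words with the right letter counts parametrize a convolution. -/
theorem eq_glue {m : SignedOrdPart} (h : MemConvolution m l l') :
    (word l.numParts m).count true = l.size ∧ (word l.numParts m).count false = l'.size ∧
      glue (word l.numParts m) l l' = m := by
  obtain ⟨h0, h1, h2⟩ := h
  have hk : l.numParts ≤ m.numParts := by
    conv_lhs => rw [← h1]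
    rw [rows, numParts_std, numParts, numRows, numRows, rowSet_rowsOf]
    exact card_filter_le _ _
  have t1 : l.table = rowsOf (· < l.numParts) m.table := by
    conv_lhs => rw [← h1]
    exact rows_lt_table hk
  have t2 : relabel (fun k => k - l.numParts) (rowsOf (l.numParts ≤ ·) m.table) = l'.table := by
    rw [← rows_ge_table, h2]
  have c1 : (word l.numParts m).count true = l.size := by
    rw [size, t1, rowsOf, ← List.countP_eq_length_filter, word, List.count, List.countP_map]
    congr 1
    funext x
    simp
  have c2 : (word l.numParts m).count false = l'.size := by
    have := List.count_true_add_count_false (l := word l.numParts m)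
    rw [length_word] at this
    omega
  refine ⟨c1, c2, SignedOrdPart.ext (eq_of_rowsOf_eq l.numParts ?_ ?_ ?_)⟩
  · exact word_glue c1 c2
  · rw [table_glue c1 c2, (merge_glue_spec c1 c2).2.1, t1]
  · rw [table_glue c1 c2]
    refine rowsOf_ge_eq_of_relabel_eq ?_
    rw [(merge_glue_spec c1 c2).2.2, t2, relabel_relabel, relabel_eq_self]
    intro x _
    simp

end Glue

-- Words depend only on the sizes, so replacing the factors by congruent ones matches the two
-- convolutions bijectively, congruent element by congruent element.
open Classical in
theorem sum_memConvolution_congr {M : Type*} [AddCommMonoid M] {f : SignedOrdPart → M}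
    (hf : ∀ m m', Congruent m m' → f m = f m') {l l' l₁ l₁' : SignedOrdPart}
    (hl : Congruent l l₁) (hl' : Congruent l' l₁') :
    ∑ m ∈ (ofSize (l.size + l'.size)).filter (fun m => MemConvolution m l l'), f m =
      ∑ m ∈ (ofSize (l₁.size + l₁'.size)).filter (fun m => MemConvolution m l₁ l₁'), f m := by
  refine sum_bij' (fun m _ => glue (word l.numParts m) l₁ l₁')
    (fun m _ => glue (word l₁.numParts m) l l') ?_ ?_ ?_ ?_ ?_
  · intro m hm
    obtain ⟨h1, h2, h3⟩ := eq_glue (mem_filter.1 hm).2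
    rw [hl.size_eq] at h1
    rw [hl'.size_eq] at h2
    exact mem_filter.2 ⟨mem_ofSize.2 (size_glue h1 h2), memConvolution_glue h1 h2⟩
  · intro m hm
    obtain ⟨h1, h2, h3⟩ := eq_glue (mem_filter.1 hm).2
    rw [← hl.size_eq] at h1
    rw [← hl'.size_eq] at h2
    exact mem_filter.2 ⟨mem_ofSize.2 (size_glue h1 h2), memConvolution_glue h1 h2⟩
  · intro m hm
    obtain ⟨h1, h2, h3⟩ := eq_glue (mem_filter.1 hm).2
    rw [hl.size_eq] at h1
    rw [hl'.size_eq] at h2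
    rw [word_glue h1 h2, h3]
  · intro m hm
    obtain ⟨h1, h2, h3⟩ := eq_glue (mem_filter.1 hm).2
    rw [← hl.size_eq] at h1
    rw [← hl'.size_eq] at h2
    rw [word_glue h1 h2, h3]
  · intro m hm
    obtain ⟨h1, h2, h3⟩ := eq_glue (mem_filter.1 hm).2
    conv_lhs => rw [← h3]
    exact hf _ _ (congruent_glue hl hl' h1 h2)

end SignedOrdPart
end SchroderCambrian
namespace SchroderCambrian
open Finset TensorProduct
open SignedOrdPart OrdPart Coalgebra

/-! ### The Hopf subalgebra -/

/-- A signature together with a Schröder-Cambrian tree for it. -/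
abbrev SignedTree : Type := Σ e : Signature, SchroderCambrianTree e

namespace SignedOrdPart

/-- The signature and the `P`-symbol of a signed ordered partition. -/
noncomputable def signedTree (l : SignedOrdPart) : SignedTree := ⟨l.signature, l.tree⟩

theorem signedTree_eq_iff {l : SignedOrdPart} {e : Signature} {T : SchroderCambrianTree e} :
    l.signedTree = ⟨e, T⟩ ↔ l.signature = e ∧ l.pSymbol = T.1 := by
  constructor
  · intro h
    have h1 : l.signature = e := congrArg Sigma.fst h
    refine ⟨h1, ?_⟩
    have : ∀ t t' : SignedTree, t = t' → t.2.1 = t'.2.1 := fun t t' h => h ▸ rfl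
    exact this _ _ h
  · rintro ⟨rfl, h⟩
    exact Sigma.ext rfl (heq_of_eq (Subtype.ext h))

theorem congruent_iff_signedTree_eq {l l' : SignedOrdPart} :
    Congruent l l' ↔ l.signedTree = l'.signedTree :=
  (signedTree_eq_iff (T := l'.tree)).symm

theorem exists_signedTree_eq (T : SignedTree) : ∃ l : SignedOrdPart, l.signedTree = T := by
  obtain ⟨l, h, h'⟩ := exists_pSymbol_eq T.2.2
  exact ⟨l, signedTree_eq_iff.2 ⟨h, h'⟩⟩

/-- A signed ordered partition with prescribed signature and `P`-symbol. -/
noncomputable def ofTree (T : SignedTree) : SignedOrdPart := (exists_signedTree_eq T).choose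

theorem signedTree_ofTree (T : SignedTree) : (ofTree T).signedTree = T :=
  (exists_signedTree_eq T).choose_spec

end SignedOrdPart

section

variable {K : Type*} [CommRing K]

/-- The coefficient of `F_l`. -/
noncomputable def OrdPart.coeff (l : SignedOrdPart) : OrdPart K →ₗ[K] K := (basisF K).coord l

theorem OrdPart.coeff_F [DecidableEq SignedOrdPart] (l m : SignedOrdPart) :
    coeff l (F K m) = if m = l then 1 else 0 := by
  rw [coeff, F, Module.Basis.coord_apply, Module.Basis.repr_self, Finsupp.single_apply]

theorem OrdPart.ext_coeff {x y : OrdPart K} (h : ∀ l, coeff l x = coeff l y) : x = y :=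
  (basisF K).ext_elem h

theorem coeff_PCamb [DecidableEq SignedTree] (T : SignedTree) (l : SignedOrdPart) :
    coeff l (PCamb K T.1 T.2) = if l.signedTree = T then 1 else 0 := by
  classical
  rw [PCamb, map_sum]
  simp only [coeff_F]
  rw [sum_ite_eq']
  refine if_congr ?_ rfl rfl
  obtain ⟨e, T⟩ := T
  rw [signedTree_eq_iff, mem_filter, mem_ofSize]
  refine ⟨fun h => h.2, fun h => ⟨?_, h⟩⟩
  rw [← length_signature, h.1]

theorem coeff_eq_of_mem_SchrCamb {x : OrdPart K} (hx : x ∈ SchrCamb K) {l l' : SignedOrdPart}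
    (h : Congruent l l') : coeff l x = coeff l' x := by
  classical
  induction hx using Submodule.span_induction with
  | mem x hx =>
    obtain ⟨T, rfl⟩ := hx
    rw [coeff_PCamb, coeff_PCamb, congruent_iff_signedTree_eq.1 h]
  | zero => simp
  | add x y _ _ hx hy => rw [map_add, map_add, hx, hy]
  | smul a x _ hx => rw [map_smul, map_smul, hx]

variable (K) in
open Classical in
/-- A projection of the vector space of signed ordered partitions onto `SchrCamb`. -/
noncomputable def projSchrCamb : OrdPart K →ₗ[K] OrdPart K :=
  (basisF K).constr K fun l =>
    if ofTree l.signedTree = l then PCamb K l.signedTree.1 l.signedTree.2 else 0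

theorem PCamb_mem (T : SignedTree) : PCamb K T.1 T.2 ∈ SchrCamb K := Submodule.subset_span ⟨T, rfl⟩

theorem projSchrCamb_mem (x : OrdPart K) : projSchrCamb K x ∈ SchrCamb K := by
  rw [projSchrCamb, Module.Basis.constr_apply]
  refine Submodule.sum_mem _ fun l _ => Submodule.smul_mem _ _ ?_
  split_ifs
  · exact PCamb_mem _
  · exact Submodule.zero_mem _

/-- The projection copies the coefficient of the chosen representative to its whole congruence
class. -/
theorem coeff_projSchrCamb (x : OrdPart K) (m : SignedOrdPart) :
    coeff m (projSchrCamb K x) = coeff (ofTree m.signedTree) x := by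
  classical
  have : coeff m ∘ₗ projSchrCamb K = coeff (ofTree m.signedTree) := by
    refine hom_ext fun l => ?_
    rw [LinearMap.comp_apply, projSchrCamb, F, Module.Basis.constr_basis, ← F, coeff_F]
    by_cases h : ofTree l.signedTree = l
    · rw [if_pos h, coeff_PCamb]
      refine if_congr ⟨fun h' => ?_, fun h' => ?_⟩ rfl rfl
      · rw [h', h]
      · rw [h', signedTree_ofTree]
    · rw [if_neg h, map_zero, if_neg]
      intro h'
      rw [h', signedTree_ofTree] at h
      exact h rfl
  exact LinearMap.congr_fun this x

/-- An element with coefficients constant on classes is fixed by `projSchrCamb`, whose values lie in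
the span. Closure properties thereby become statements about coefficients. -/
theorem mem_SchrCamb_iff {x : OrdPart K} :
    x ∈ SchrCamb K ↔ ∀ l l', Congruent l l' → coeff l x = coeff l' x := by
  refine ⟨fun h l l' => coeff_eq_of_mem_SchrCamb h, fun h => ?_⟩
  have : projSchrCamb K x = x := by
    refine ext_coeff fun l => ?_
    rw [coeff_projSchrCamb]
    exact h _ _ (congruent_iff_signedTree_eq.2 (signedTree_ofTree _))
  rw [← this]
  exact projSchrCamb_mem x

/-- Given the size of the left factor, a table belongs to the shifted shuffle of only one pair,
namely its two column restrictions. -/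
theorem coeff_mul (x y : OrdPart K) (m : SignedOrdPart) :
    coeff m (x * y) =
      ∑ k ∈ range (m.size + 1), coeff (firstCols k m) x * coeff (lastCols k m) y := by
  classical
  have : (LinearMap.mul K (OrdPart K)).compr₂ (coeff m) = ∑ k ∈ range (m.size + 1),
      (LinearMap.mul K K).compl₁₂ (coeff (firstCols k m)) (coeff (lastCols k m)) := by
    refine hom_ext fun l => hom_ext fun l' => ?_
    simp only [LinearMap.compr₂_apply, LinearMap.mul_apply', LinearMap.sum_apply,
      LinearMap.compl₁₂_apply, F_mul_F, map_sum, coeff_F, sum_ite_eq', mem_shiftedShuffle]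
    rw [sum_eq_single l.size]
    · by_cases h : firstCols l.size m = l
      · by_cases h' : lastCols l.size m = l'
        · rw [if_pos h.symm, if_pos h'.symm, if_pos, mul_one]
          refine ⟨?_, h, h'⟩
          have h1 := size_firstCols l.size m
          have h2 := size_lastCols l.size m
          rw [h] at h1
          rw [h'] at h2
          omega
        · rw [if_neg (fun h => h' h.2.2), if_neg (c := l' = _) (fun h => h' h.symm), mul_zero]
      · rw [if_neg (fun h' => h h'.2.1), if_neg (fun h' => h h'.symm), zero_mul]
    · intro k hk hkl
      rw [mem_range] at hk
      rw [if_neg, zero_mul]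
      intro h
      apply hkl
      rw [h, size_firstCols]
      omega
    · intro hl
      rw [mem_range] at hl
      rw [if_neg, zero_mul]
      intro h
      have := size_firstCols l.size m
      rw [← h] at this
      omega
  have := LinearMap.congr_fun (LinearMap.congr_fun this x) y
  simpa using this

theorem mul_mem_SchrCamb {x y : OrdPart K} (hx : x ∈ SchrCamb K) (hy : y ∈ SchrCamb K) :
    x * y ∈ SchrCamb K := by
  refine mem_SchrCamb_iff.2 fun l l' h => ?_
  rw [coeff_mul, coeff_mul, h.size_eq]
  refine sum_congr rfl fun k _ => ?_
  rw [coeff_eq_of_mem_SchrCamb hx (congruent_firstCols h k),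
    coeff_eq_of_mem_SchrCamb hy (congruent_lastCols h k)]

theorem one_mem_SchrCamb : (1 : OrdPart K) ∈ SchrCamb K := by
  classical
  refine mem_SchrCamb_iff.2 fun l l' h => ?_
  rw [one_eq_F, coeff_F, coeff_F]
  refine if_congr ?_ rfl rfl
  rw [eq_comm, eq_comm (b := l'), ← size_eq_zero, ← size_eq_zero, h.size_eq]

/-- The coefficient of `F_l ⊗ F_l'`. -/
noncomputable def OrdPart.coeffTensor (l l' : SignedOrdPart) : OrdPart K ⊗[K] OrdPart K →ₗ[K] K :=
  LinearMap.mul' K K ∘ₗ TensorProduct.map (coeff l) (coeff l')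

theorem OrdPart.ext_coeffTensor {x y : OrdPart K ⊗[K] OrdPart K}
    (h : ∀ l l', coeffTensor l l' x = coeffTensor l l' y) : x = y := by
  have key : ∀ l l', (((basisF K).tensorProduct (basisF K)).coord (l, l')) = coeffTensor l l' := by
    intro l l'
    refine TensorProduct.ext' fun x y => ?_
    simp [coeffTensor, coeff, Module.Basis.tensorProduct_repr_tmul_apply, mul_comm]
  refine ((basisF K).tensorProduct (basisF K)).ext_elem fun ⟨l, l'⟩ => ?_
  rw [← Module.Basis.coord_apply, ← Module.Basis.coord_apply, key, h]

theorem coeffTensor_comul (x : OrdPart K) (l l' : SignedOrdPart)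
    [DecidablePred (MemConvolution · l l')] :
    coeffTensor l l' (comul (R := K) x) =
      ∑ m ∈ (ofSize (l.size + l'.size)).filter (fun m => MemConvolution m l l'), coeff m x := by
  classical
  have : coeffTensor l l' ∘ₗ comul (R := K) =
      ∑ m ∈ (ofSize (l.size + l'.size)).filter (fun m => MemConvolution m l l'),
        coeff (K := K) m := by
    refine hom_ext fun m => ?_
    rw [LinearMap.comp_apply, comul_F, map_sum, LinearMap.sum_apply]
    simp only [coeff_F, coeffTensor, LinearMap.comp_apply, TensorProduct.map_tmul,
      LinearMap.mul'_apply, sum_ite_eq, mem_filter, mem_ofSize]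
    simp only [← ite_and, mul_ite, mul_one, mul_zero]
    have h : ∀ p : SignedOrdPart × SignedOrdPart, (p.2 = l' ∧ p.1 = l) ↔ p = (l, l') := by
      rintro ⟨a, b⟩
      rw [Prod.mk.injEq, and_comm]
    simp only [h, sum_ite_eq', mem_convolutionPairs]
    refine if_congr ⟨fun h => ⟨h.1, h⟩, fun h => h.2⟩ rfl rfl
  have := LinearMap.congr_fun this x
  simpa using this

/-- The coefficient of the coproduct at `(l, l')` sums the coefficients of `x` over the convolution,
so it depends only on the classes of `l` and `l'`. Hence the tensor square of the projection fixes
the coproduct, and this projection factors through `SchrCamb`. -/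
theorem comul_mem_SchrCamb {x : OrdPart K} (hx : x ∈ SchrCamb K) :
    comul (R := K) x ∈
      LinearMap.range (TensorProduct.map (SchrCamb K).subtype (SchrCamb K).subtype) := by
  classical
  have key : TensorProduct.map (projSchrCamb K) (projSchrCamb K) (comul (R := K) x) =
      comul (R := K) x := by
    refine ext_coeffTensor fun l l' => ?_
    have h : ∀ l l', coeffTensor l l' ∘ₗ TensorProduct.map (projSchrCamb K) (projSchrCamb K) =
        coeffTensor (K := K) (ofTree l.signedTree) (ofTree l'.signedTree) := by
      intro l l'
      refine TensorProduct.ext' fun x y => ?_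
      simp [coeffTensor, coeff_projSchrCamb]
    have := LinearMap.congr_fun (h l l') (comul (R := K) x)
    rw [LinearMap.comp_apply] at this
    rw [this, coeffTensor_comul, coeffTensor_comul]
    exact sum_memConvolution_congr (fun m m' h => coeff_eq_of_mem_SchrCamb hx h)
      (congruent_iff_signedTree_eq.2 (signedTree_ofTree _))
      (congruent_iff_signedTree_eq.2 (signedTree_ofTree _))
  let p : OrdPart K →ₗ[K] SchrCamb K := (projSchrCamb K).codRestrict _ projSchrCamb_mem
  have hp : projSchrCamb K = (SchrCamb K).subtype ∘ₗ p := rfl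
  rw [hp, TensorProduct.map_comp] at key
  exact ⟨_, key⟩

theorem conv_mem_SchrCamb {f g : WithConv (OrdPart K →ₗ[K] OrdPart K)}
    (hf : ∀ x ∈ SchrCamb K, f x ∈ SchrCamb K) (hg : ∀ x ∈ SchrCamb K, g x ∈ SchrCamb K)
    {x : OrdPart K} (hx : x ∈ SchrCamb K) : (f * g) x ∈ SchrCamb K := by
  rw [LinearMap.convMul_apply]
  obtain ⟨z, hz⟩ := comul_mem_SchrCamb hx
  rw [← hz]
  clear hz
  induction z using TensorProduct.induction_on with
  | zero => simp
  | tmul a b => simpa using mul_mem_SchrCamb (hf _ a.2) (hg _ b.2)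
  | add a b ha hb =>
    rw [map_add, map_add, map_add]
    exact Submodule.add_mem _ ha hb

theorem algebraMap_mem_SchrCamb (a : K) : algebraMap K (OrdPart K) a ∈ SchrCamb K := by
  rw [Algebra.algebraMap_eq_smul_one]
  exact Submodule.smul_mem _ _ one_mem_SchrCamb

/-- The convolution unit is the counit followed by the unit, so it and the identity preserve
`SchrCamb`; convolution keeps this property by stability under product and coproduct. -/
theorem convDefect_pow_mem_SchrCamb (n : ℕ) {x : OrdPart K} (hx : x ∈ SchrCamb K) :
    (convDefect K ^ n) x ∈ SchrCamb K := by
  induction n generalizing x with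
  | zero =>
    rw [pow_zero]
    exact algebraMap_mem_SchrCamb (counit (R := K) x)
  | succ n ih =>
    rw [pow_succ]
    refine conv_mem_SchrCamb (fun x hx => ih hx) (fun x hx => ?_) hx
    exact Submodule.sub_mem _ (algebraMap_mem_SchrCamb (counit (R := K) x)) hx

/-- The series for the antipode is finite on each basis element; a bound on the numbers of parts in
the support truncates it uniformly for `x`. -/
theorem antipodeMap_eq_sum (x : OrdPart K) :
    ∃ N, antipodeMap K x = ∑ n ∈ range N, (convDefect K ^ n) x := by
  let N := ((basisF K).repr x).support.sup numParts + 1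
  have h : ∀ n, (convDefect K ^ n) x =
      ∑ l ∈ ((basisF K).repr x).support, (basisF K).repr x l • (convDefect K ^ n) (F K l) := by
    intro n
    conv_lhs => rw [← (basisF K).linearCombination_repr x, Finsupp.linearCombination_apply,
      Finsupp.sum, map_sum]
    simp only [map_smul, F]
  refine ⟨N, ?_⟩
  simp only [h]
  rw [sum_comm]
  conv_lhs => rw [← (basisF K).linearCombination_repr x, Finsupp.linearCombination_apply,
    Finsupp.sum, map_sum]
  refine sum_congr rfl fun l hl => ?_
  rw [map_smul, ← F, antipodeMap_F (N := N) l, sum_apply_F, smul_sum]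
  exact Nat.lt_succ_of_le (le_sup (f := numParts) hl)

theorem antipode_mem_SchrCamb {x : OrdPart K} (hx : x ∈ SchrCamb K) :
    HopfAlgebra.antipode K x ∈ SchrCamb K := by
  obtain ⟨N, hN⟩ := antipodeMap_eq_sum x
  change antipodeMap K x ∈ _
  rw [hN]
  exact Submodule.sum_mem _ fun n _ => convDefect_pow_mem_SchrCamb n hx

variable (K) in
theorem isHopfSubalgebra_SchrCamb : IsHopfSubalgebra (SchrCamb K) where
  one_mem := one_mem_SchrCamb
  mul_mem _ hx _ hy := mul_mem_SchrCamb hx hy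
  comul_mem _ hx := comul_mem_SchrCamb hx
  antipode_mem _ hx := antipode_mem_SchrCamb hx

/-- The coefficient at a representative of `T` isolates the scalar of `T`, since each table belongs
to exactly one class and no class is empty. -/
theorem linearIndependent_PCamb :
    LinearIndependent K fun T : SignedTree => PCamb K T.1 T.2 := by
  classical
  rw [linearIndependent_iff]
  intro c hc
  ext T
  have := congrArg (coeff (ofTree T)) hc
  rw [Finsupp.linearCombination_apply, Finsupp.sum, map_sum, map_zero] at this
  simp only [map_smul, coeff_PCamb, signedTree_ofTree, smul_eq_mul, mul_ite, mul_one, mul_zero,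
    sum_ite_eq, Finsupp.mem_support_iff] at this
  by_contra h
  exact h (by simpa [h] using this)

variable (K) in
theorem exists_basis_SchrCamb : ∃ b : Module.Basis SignedTree K (SchrCamb K),
    ∀ e T, (b ⟨e, T⟩ : OrdPart K) = PCamb K e T :=
  ⟨Module.Basis.span linearIndependent_PCamb, fun e T =>
    congrArg Subtype.val (Module.Basis.span_apply linearIndependent_PCamb (⟨e, T⟩ : SignedTree))⟩

end

end SchroderCambrian
namespace SchroderCambrian
open Finset

/-! ### Sums over pairs of consecutive walls -/

/-- The pairs of consecutive elements of `W`. -/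
def consecutivePairs (W : Finset ℕ) : Finset (ℕ × ℕ) :=
  (W ×ˢ W).filter fun p => p.1 < p.2 ∧ ∀ c ∈ W, p.1 < c → ¬ c < p.2

theorem mem_consecutivePairs {W : Finset ℕ} {a b : ℕ} : (a, b) ∈ consecutivePairs W ↔
    a ∈ W ∧ b ∈ W ∧ a < b ∧ ∀ c ∈ W, a < c → ¬ c < b := by
  simp [consecutivePairs, and_assoc]

theorem consecutivePairs_insert {W : Finset ℕ} {a b c : ℕ} (h : (a, b) ∈ consecutivePairs W)
    (hac : a < c) (hcb : c < b) : consecutivePairs (insert c W) =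
      insert (a, c) (insert (c, b) ((consecutivePairs W).erase (a, b))) := by
  rw [mem_consecutivePairs] at h
  ext ⟨u, v⟩
  simp only [mem_insert, mem_erase, mem_consecutivePairs, Prod.mk.injEq, forall_eq_or_imp]
  obtain ⟨h1, h2, h3, h4⟩ := h
  constructor
  · rintro ⟨hu, hv, huv, hc, h⟩
    have := h a h1
    have := h b h2
    have := h4 u
    have := h4 v
    grind
  · rintro (⟨rfl, rfl⟩ | ⟨rfl, rfl⟩ | ⟨hne, hu, hv, huv, h⟩)
    · grind
    · grind
    · have := h a h1
      have := h b h2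
      have := h4 u hu
      have := h4 v hv
      grind

theorem sum_consecutivePairs_insert {W : Finset ℕ} {a b c : ℕ} (h : (a, b) ∈ consecutivePairs W)
    (hac : a < c) (hcb : c < b) (f : ℕ → ℕ → ℝ) : ∑ p ∈ consecutivePairs (insert c W), f p.1 p.2 =
      ∑ p ∈ consecutivePairs W, f p.1 p.2 + (f a c + f c b - f a b) := by
  have hc : c ∉ W := fun hc => (mem_consecutivePairs.1 h).2.2.2 c hc hac hcb
  rw [consecutivePairs_insert h hac hcb, sum_insert, sum_insert, ← sum_erase_add _ _ h]
  · ring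
  · simp [mem_consecutivePairs, hc]
  · simp [mem_consecutivePairs, hc]
    omega

/-! ### The walls of a set of columns -/

namespace Signature

variable (e : Signature)

/-- The sign of `i` is negative. -/
abbrev Neg (i : ℕ) : Prop := e.sign i = -1

theorem sign_eq_one_iff {i : ℕ} : e.sign i = 1 ↔ ¬ e.Neg i := by
  rcases Int.units_eq_one_or (e.sign i) with h | h <;> simp [Neg, h]

/-- The walls met just above the dots of `P` and just below the other dots. -/
def walls (P : Finset ℕ) : Finset ℕ :=
  (range (e.length + 2)).filter fun c => c = 0 ∨ c = e.length + 1 ∨ (e.Neg c ↔ c ∉ P)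

variable {e}

theorem mem_walls {P : Finset ℕ} {c : ℕ} : c ∈ e.walls P ↔
    c ≤ e.length + 1 ∧ (c = 0 ∨ c = e.length + 1 ∨ (e.Neg c ↔ c ∉ P)) := by
  rw [walls, mem_filter, mem_range, Nat.lt_succ_iff]

theorem mem_walls_iff {P : Finset ℕ} {c : ℕ} (hc : c ∈ Icc 1 e.length) :
    c ∈ e.walls P ↔ (e.Neg c ↔ c ∉ P) := by
  rw [mem_Icc] at hc
  rw [mem_walls]
  constructor
  · rintro ⟨_, h | h | h⟩
    · omega
    · omega
    · exact h
  · exact fun h => ⟨by omega, Or.inr (Or.inr h)⟩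

theorem mem_belowDiagonal {a b i : ℕ} : i ∈ belowDiagonal e a b ↔ i ∈ Icc 1 e.length ∧
    ((a < i ∧ i < b ∧ e.Neg i) ∨ (i ≤ a ∧ ¬ e.Neg a) ∨ (b ≤ i ∧ ¬ e.Neg b)) := by
  rw [belowDiagonal, mem_filter, sign_eq_one_iff, sign_eq_one_iff]

variable (e)

/-- The contribution of the left end of a diagonal to the sum of `x` below the diagonal. -/
noncomputable def leftSum (x : ℕ → ℝ) (a : ℕ) : ℝ :=
  ∑ i ∈ Icc 1 e.length,
    ((if ¬ e.Neg a ∧ i ≤ a then x i else 0) - if e.Neg i ∧ i ≤ a then x i else 0)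

/-- The contribution of the right end of a diagonal to the sum of `x` below the diagonal. -/
noncomputable def rightSum (x : ℕ → ℝ) (b : ℕ) : ℝ :=
  ∑ i ∈ Icc 1 e.length,
    ((if e.Neg i ∧ i < b then x i else 0) + if ¬ e.Neg b ∧ b ≤ i then x i else 0)

/-- Splitting the sum into one term per end makes sums over consecutive walls telescope: changing
one wall affects only its own terms. The signs of the borders 0 and n + 1 are default values without
effect, as no column is at most 0 or at least n + 1. -/
theorem sum_belowDiagonal (x : ℕ → ℝ) {a b : ℕ} (hab : a < b) :
    ∑ i ∈ belowDiagonal e a b, x i = e.leftSum x a + e.rightSum x b := by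
  rw [leftSum, rightSum, ← sum_add_distrib, belowDiagonal, sum_filter]
  refine sum_congr rfl fun i _ => ?_
  simp only [sign_eq_one_iff]
  rcases Nat.lt_or_ge a i with h | h
  · rcases Nat.lt_or_ge i b with h' | h'
    · simp [h, h', h.not_ge, h'.not_ge]
    · simp [h, h', h.not_ge, h'.not_gt]
  · have := h.trans_lt hab
    simp [h, this, h.not_gt, this.not_ge]

variable {e}

theorem leftSum_add_rightSum_of_neg (x : ℕ → ℝ) {i : ℕ} (hi : i ∈ Icc 1 e.length) (h : e.Neg i) :
    e.leftSum x i + e.rightSum x i = - x i := by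
  have : - x i = ∑ j ∈ Icc 1 e.length, if j = i then - x j else 0 := by rw [sum_ite_eq', if_pos hi]
  rw [leftSum, rightSum, ← sum_add_distrib, this]
  refine sum_congr rfl fun j _ => ?_
  rcases lt_trichotomy j i with hj | rfl | hj
  · simp [h, hj, hj.le, hj.ne]
  · simp [h]
  · simp [h, hj.not_gt, hj.not_ge, hj.ne']

theorem leftSum_add_rightSum_of_pos (x : ℕ → ℝ) {i : ℕ} (hi : i ∈ Icc 1 e.length)
    (h : ¬ e.Neg i) : e.leftSum x i + e.rightSum x i = ∑ j ∈ Icc 1 e.length, x j + x i := by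
  have : x i = ∑ j ∈ Icc 1 e.length, if j = i then x j else 0 := by rw [sum_ite_eq', if_pos hi]
  rw [leftSum, rightSum, ← sum_add_distrib, this, ← sum_add_distrib]
  refine sum_congr rfl fun j _ => ?_
  rcases lt_trichotomy j i with hj | rfl | hj
  · simp [h, hj, hj.le, hj.ne, hj.not_ge]
  · simp [h]
  · simp [h, hj.not_gt, hj.not_ge, hj.ne', hj.le]

/-- Moving the left end to a negative wall further right shrinks the set below the diagonal; moving
it to a positive one enlarges it. -/
theorem leftSum_one_lt {a a' : ℕ} (h : a < a') (ha' : a' ∈ Icc 1 e.length) :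
    (e.Neg a' → e.leftSum 1 a' < e.leftSum 1 a) ∧ (¬ e.Neg a' → e.leftSum 1 a < e.leftSum 1 a') := by
  constructor
  · intro hn
    refine sum_lt_sum (fun i _ => ?_) ⟨a', ha', ?_⟩
    · simp only [Pi.one_apply]
      grind
    · simp only [Pi.one_apply]
      grind
  · intro hn
    refine sum_lt_sum (fun i _ => ?_) ⟨a', ha', ?_⟩
    · simp only [Pi.one_apply]
      grind
    · simp only [Pi.one_apply]
      grind

theorem rightSum_one_lt {b b' : ℕ} (h : b' < b) (hb' : b' ∈ Icc 1 e.length) :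
    (e.Neg b' → e.rightSum 1 b' < e.rightSum 1 b) ∧
      (¬ e.Neg b' → e.rightSum 1 b < e.rightSum 1 b') := by
  constructor
  · intro hn
    refine sum_lt_sum (fun i _ => ?_) ⟨b', hb', ?_⟩
    · simp only [Pi.one_apply]
      grind
    · simp only [Pi.one_apply]
      grind
  · intro hn
    refine sum_lt_sum (fun i _ => ?_) ⟨b', hb', ?_⟩
    · simp only [Pi.one_apply]
      grind
    · simp only [Pi.one_apply]
      grind

/-! ### Slacks -/

/-- The right-hand side of the inequality of the permutahedron for a set of `t` coordinates. -/
noncomputable def triangular (t : ℝ) : ℝ := t * (t + 1) / 2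

theorem card_belowDiagonal {a b : ℕ} (hab : a < b) :
    ((belowDiagonal e a b).card : ℝ) = e.leftSum 1 a + e.rightSum 1 b := by
  rw [← sum_belowDiagonal e 1 hab]
  simp

variable (e)

/-- The difference of both sides of the inequality of the diagonal `[a, b]`. -/
noncomputable def slack (x : ℕ → ℝ) (a b : ℕ) : ℝ :=
  ∑ i ∈ belowDiagonal e a b, x i - triangular (belowDiagonal e a b).card

/-- The difference of both sides of the equation of the hyperplane. -/
noncomputable def defect (x : ℕ → ℝ) : ℝ := ∑ i ∈ Icc 1 e.length, x i - triangular e.length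

/-- The sum of the slacks of the diagonals joining consecutive walls of `P`, corrected so that its
variations are given by `totalSlack_insert` outside the hyperplane as well. -/
noncomputable def totalSlack (x : ℕ → ℝ) (P : Finset ℕ) : ℝ :=
  ∑ p ∈ consecutivePairs (e.walls P),
    -- The left border must be excluded explicitly: the sign of 0 is, by truncated subtraction, that
    -- of column 1.
    (e.slack x p.1 p.2 - if p.1 ≠ 0 ∧ ¬ e.Neg p.1 then e.defect x else 0)

/-- The last wall of `P` on the left of `i`. -/
noncomputable def prevWall (P : Finset ℕ) (i : ℕ) : ℕ := ((e.walls P).filter (· < i)).sup id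

/-- The first wall of `P` on the right of `i`. -/
noncomputable def nextWall (P : Finset ℕ) (i : ℕ) : ℕ := sInf {c | c ∈ e.walls P ∧ i < c}

/-- The increase of the optimal value when `i` is added to `P`. -/
noncomputable def marginal (P : Finset ℕ) (i : ℕ) : ℝ :=
  if e.Neg i then
    (e.leftSum 1 (e.prevWall P i) - e.leftSum 1 i) * (e.rightSum 1 (e.nextWall P i) - e.rightSum 1 i)
  else e.length + 1 -
    (e.leftSum 1 i - e.leftSum 1 (e.prevWall P i)) * (e.rightSum 1 i - e.rightSum 1 (e.nextWall P i))

variable {e}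

theorem zero_mem_walls (P : Finset ℕ) : 0 ∈ e.walls P := mem_walls.2 ⟨by omega, Or.inl rfl⟩

theorem length_add_one_mem_walls (P : Finset ℕ) : e.length + 1 ∈ e.walls P :=
  mem_walls.2 ⟨le_rfl, Or.inr (Or.inl rfl)⟩

theorem prevWall_spec (P : Finset ℕ) {i : ℕ} (hi : i ∈ Icc 1 e.length) :
    e.prevWall P i ∈ e.walls P ∧ e.prevWall P i < i ∧
      ∀ c ∈ e.walls P, c < i → c ≤ e.prevWall P i := by
  rw [mem_Icc] at hi
  have h : e.prevWall P i ∈ (e.walls P).filter (· < i) := by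
    obtain ⟨c, hc, h⟩ := exists_mem_eq_sup ((e.walls P).filter (· < i))
      ⟨0, mem_filter.2 ⟨zero_mem_walls P, by omega⟩⟩ id
    rw [prevWall, h]
    exact hc
  rw [mem_filter] at h
  exact ⟨h.1, h.2, fun c hc hci => le_sup (f := id) (mem_filter.2 ⟨hc, hci⟩)⟩

theorem nextWall_spec (P : Finset ℕ) {i : ℕ} (hi : i ∈ Icc 1 e.length) :
    e.nextWall P i ∈ e.walls P ∧ i < e.nextWall P i ∧
      ∀ c ∈ e.walls P, i < c → e.nextWall P i ≤ c := by
  rw [mem_Icc] at hi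
  have h : e.nextWall P i ∈ {c | c ∈ e.walls P ∧ i < c} :=
    Nat.sInf_mem ⟨e.length + 1, length_add_one_mem_walls P, by omega⟩
  exact ⟨h.1, h.2, fun c hc hci => Nat.sInf_le ⟨hc, hci⟩⟩

theorem walls_insert_of_pos {P : Finset ℕ} {i : ℕ} (hi : i ∈ Icc 1 e.length) (hn : ¬ e.Neg i) :
    e.walls (insert i P) = insert i (e.walls P) := by
  rw [mem_Icc] at hi
  ext c
  rw [mem_insert, mem_walls, mem_walls, mem_insert]
  by_cases h : c = i
  · subst h
    simp [hn]
    omega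
  · simp [h]

theorem walls_of_neg {P : Finset ℕ} {i : ℕ} (hi : i ∈ Icc 1 e.length) (hn : e.Neg i)
    (hP : i ∉ P) : e.walls P = insert i (e.walls (insert i P)) := by
  rw [mem_Icc] at hi
  ext c
  rw [mem_insert, mem_walls, mem_walls, mem_insert]
  by_cases h : c = i
  · subst h
    exact iff_of_true ⟨by omega, by tauto⟩ (Or.inl rfl)
  · simp [h]

theorem pair_mem_of_pos {P : Finset ℕ} {i : ℕ} (hi : i ∈ Icc 1 e.length) (hn : ¬ e.Neg i)
    (hP : i ∉ P) : (e.prevWall P i, e.nextWall P i) ∈ consecutivePairs (e.walls P) := by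
  obtain ⟨h1, h2, h3⟩ := prevWall_spec P hi
  obtain ⟨h1', h2', h3'⟩ := nextWall_spec P hi
  have hiw : i ∉ e.walls P := by
    rw [mem_walls_iff hi]
    simp [hn, hP]
  refine mem_consecutivePairs.2 ⟨h1, h1', h2.trans h2', fun c hc h h' => ?_⟩
  have := h3 c hc
  have := h3' c hc
  rcases lt_trichotomy c i with hci | rfl | hci
  · omega
  · exact hiw hc
  · omega

theorem pair_mem_of_neg {P : Finset ℕ} {i : ℕ} (hi : i ∈ Icc 1 e.length) (hn : e.Neg i)
    (hP : i ∉ P) :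
    (e.prevWall P i, e.nextWall P i) ∈ consecutivePairs (e.walls (insert i P)) := by
  obtain ⟨h1, h2, h3⟩ := prevWall_spec P hi
  obtain ⟨h1', h2', h3'⟩ := nextWall_spec P hi
  have hiw : i ∉ e.walls (insert i P) := by
    rw [mem_walls_iff hi]
    simp [hn]
  rw [walls_of_neg hi hn hP, mem_insert] at h1 h1'
  refine mem_consecutivePairs.2 ⟨h1.resolve_left h2.ne, h1'.resolve_left h2'.ne', h2.trans h2',
    fun c hc h h' => ?_⟩
  have hc' : c ∈ e.walls P := by
    rw [walls_of_neg hi hn hP]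
    exact mem_insert_of_mem hc
  have := h3 c hc'
  have := h3' c hc'
  rcases lt_trichotomy c i with hci | rfl | hci
  · omega
  · exact hiw hc
  · omega

theorem slack_eq (x : ℕ → ℝ) {a b : ℕ} (hab : a < b) : e.slack x a b =
    e.leftSum x a + e.rightSum x b - triangular (e.leftSum 1 a + e.rightSum 1 b) := by
  rw [slack, sum_belowDiagonal e x hab, card_belowDiagonal hab]

/-- When the dot `i` passes below the line, its wall disappears if `i` is negative and appears if it
is positive, merging or splitting one region. The linear terms change by `x i`, up to the total sum
absorbed by the defect; the triangular numbers combine into the product in `marginal`, as in the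
Hohlweg-Lange coordinates. -/
theorem totalSlack_insert (x : ℕ → ℝ) {P : Finset ℕ} {i : ℕ} (hi : i ∈ Icc 1 e.length)
    (hP : i ∉ P) : e.totalSlack x (insert i P) = e.totalSlack x P + x i - e.marginal P i := by
  have hi1 := (mem_Icc.1 hi).1
  have h2 := (prevWall_spec P hi).2.1
  have h2' := (nextWall_spec P hi).2.1
  let f : ℕ → ℕ → ℝ := fun a b => e.slack x a b - if a ≠ 0 ∧ ¬ e.Neg a then e.defect x else 0
  by_cases hn : e.Neg i
  · have key := sum_consecutivePairs_insert (pair_mem_of_neg hi hn hP) h2 h2' f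
    rw [← walls_of_neg hi hn hP] at key
    have h := leftSum_add_rightSum_of_neg x hi hn
    have h1 := leftSum_add_rightSum_of_neg 1 hi hn
    rw [totalSlack, totalSlack, key, marginal, if_pos hn]
    simp only [f, slack_eq x h2, slack_eq x h2', slack_eq x (h2.trans h2'),
      if_neg (show ¬ (i ≠ 0 ∧ ¬ e.Neg i) from fun h => h.2 hn), triangular]
    rw [← eq_sub_iff_add_eq] at h h1
    rw [h, h1, Pi.one_apply]
    ring
  · have key := sum_consecutivePairs_insert (pair_mem_of_pos hi hn hP) h2 h2' f
    rw [← walls_insert_of_pos hi hn] at key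
    have h := leftSum_add_rightSum_of_pos x hi hn
    have h1 := leftSum_add_rightSum_of_pos 1 hi hn
    rw [totalSlack, totalSlack, key, marginal, if_neg hn]
    simp only [f, slack_eq x h2, slack_eq x h2', slack_eq x (h2.trans h2'), hn, not_false_eq_true,
      and_true, if_pos (show i ≠ 0 by omega), triangular, defect]
    rw [← eq_sub_iff_add_eq] at h h1
    rw [h, h1]
    simp only [Pi.one_apply, sum_const, Nat.card_Icc, Nat.add_sub_cancel, nsmul_eq_mul, mul_one]
    ring

/-- Below all dots, the walls are the borders and all negative columns, so nothing lies below any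
diagonal between consecutive walls. -/
theorem totalSlack_empty (x : ℕ → ℝ) : e.totalSlack x ∅ = 0 := by
  refine sum_eq_zero fun ⟨a, b⟩ h => ?_
  obtain ⟨ha, hb, hab, h⟩ := mem_consecutivePairs.1 h
  have hba := (mem_walls.1 hb).1
  have hbd : belowDiagonal e a b = ∅ := by
    refine eq_empty_of_forall_notMem fun i hi => ?_
    obtain ⟨hi1, hi⟩ := mem_belowDiagonal.1 hi
    have := h i
    rw [mem_walls_iff hi1] at this
    rw [mem_walls] at ha hb
    rw [mem_Icc] at hi1
    simp only [notMem_empty, not_false_eq_true, iff_true] at *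
    grind
  have ha' : a = 0 ∨ e.Neg a := by
    rw [mem_walls] at ha
    simp only [notMem_empty, not_false_eq_true, iff_true] at ha
    grind
  rw [if_neg (by grind)]
  simp [slack, hbd, triangular]

/-- Above all dots, every diagonal between consecutive walls has all columns below it, so each slack
is the defect. The correction cancels all of them except the one for the pair starting at the left
border. -/
theorem totalSlack_Icc (x : ℕ → ℝ) : e.totalSlack x (Icc 1 e.length) = e.defect x := by
  have hfull : ∀ a b, (a, b) ∈ consecutivePairs (e.walls (Icc 1 e.length)) →
      e.slack x a b = e.defect x ∧ (a ≠ 0 → ¬ e.Neg a) := by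
    intro a b h
    obtain ⟨ha, hb, hab, h⟩ := mem_consecutivePairs.1 h
    have hba := (mem_walls.1 hb).1
    have hw : ∀ c ∈ e.walls (Icc 1 e.length), c = 0 ∨ c = e.length + 1 ∨ ¬ e.Neg c := by
      intro c hc
      rw [mem_walls, mem_Icc] at hc
      grind
    have hbd : belowDiagonal e a b = Icc 1 e.length := by
      ext i
      rw [mem_belowDiagonal]
      refine ⟨fun h => h.1, fun hi => ⟨hi, ?_⟩⟩
      have h1 := h i
      rw [mem_walls_iff hi] at h1
      have h2 := hw a ha
      have h3 := hw b hb
      rw [mem_Icc] at hi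
      rcases Nat.lt_or_ge a i with h4 | h4
      · rcases Nat.lt_or_ge i b with h5 | h5
        · left
          refine ⟨h4, h5, ?_⟩
          by_contra hn
          exact h1 (by simp [hn, hi]) h4 h5
        · grind
      · grind
    have := hw a ha
    refine ⟨?_, by grind⟩
    simp [slack, hbd, defect]
  obtain ⟨b, hb⟩ : ∃ b, (0, b) ∈ consecutivePairs (e.walls (Icc 1 e.length)) := by
    have hne : ((e.walls (Icc 1 e.length)).filter (0 < ·)).Nonempty :=
      ⟨e.length + 1, mem_filter.2 ⟨length_add_one_mem_walls _, by omega⟩⟩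
    have h := min'_mem _ hne
    rw [mem_filter] at h
    refine ⟨_, mem_consecutivePairs.2 ⟨zero_mem_walls _, h.1, h.2, fun c hc h1 h2 => ?_⟩⟩
    exact absurd h2 (not_lt.2 (min'_le _ c (mem_filter.2 ⟨hc, h1⟩)))
  rw [totalSlack, sum_eq_single (0, b)]
  · simp [hfull 0 b hb]
  · rintro ⟨a, c⟩ h hne
    have ha : a ≠ 0 := by
      rintro rfl
      rw [mem_consecutivePairs] at h hb
      have h1 := h.2.2.2 b hb.2.1 hb.2.2.1
      have h2 := hb.2.2.2 c h.2.1 h.2.2.1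
      exact hne (by rw [show c = b by omega])
    rw [if_pos ⟨ha, (hfull a c h).2 ha⟩, (hfull a c h).1, sub_self]
  · exact fun h => absurd hb h

/-! ### The points attached to orderings of the columns -/

/-- As the set grows, positive walls appear and negative ones disappear. A new nearest wall on the
left is positive and a lost one is negative, so `leftSum_one_lt` gives an increase in both cases. -/
theorem leftSum_prevWall_le {P Q : Finset ℕ} (h : P ⊆ Q) {i : ℕ} (hi : i ∈ Icc 1 e.length) :
    e.prevWall P i = e.prevWall Q i ∨
      e.leftSum 1 (e.prevWall P i) < e.leftSum 1 (e.prevWall Q i) := by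
  obtain ⟨h1, h2, h3⟩ := prevWall_spec P hi
  obtain ⟨h1', h2', h3'⟩ := prevWall_spec Q hi
  rw [mem_Icc] at hi
  rcases lt_trichotomy (e.prevWall P i) (e.prevWall Q i) with hlt | heq | hlt
  · have hm : e.prevWall Q i ∈ Icc 1 e.length := mem_Icc.2 ⟨by omega, by omega⟩
    refine Or.inr ((leftSum_one_lt hlt hm).2 fun hn => ?_)
    have hw : e.prevWall Q i ∈ e.walls P := by
      rw [mem_walls_iff hm] at h1' ⊢
      exact ⟨fun hn hP => h1'.1 hn (h hP), fun _ => hn⟩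
    have := h3 _ hw h2'
    omega
  · exact Or.inl heq
  · have hm : e.prevWall P i ∈ Icc 1 e.length := mem_Icc.2 ⟨by omega, by omega⟩
    refine Or.inr ((leftSum_one_lt hlt hm).1 ?_)
    by_contra hn
    have hw : e.prevWall P i ∈ e.walls Q := by
      rw [mem_walls_iff hm] at h1 ⊢
      exact ⟨fun h => absurd h hn, fun hQ => h1.2 fun hP => hQ (h hP)⟩
    have := h3' _ hw h2
    omega

theorem rightSum_nextWall_le {P Q : Finset ℕ} (h : P ⊆ Q) {i : ℕ} (hi : i ∈ Icc 1 e.length) :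
    e.nextWall P i = e.nextWall Q i ∨
      e.rightSum 1 (e.nextWall P i) < e.rightSum 1 (e.nextWall Q i) := by
  obtain ⟨h1, h2, h3⟩ := nextWall_spec P hi
  obtain ⟨h1', h2', h3'⟩ := nextWall_spec Q hi
  have hP := (mem_walls.1 h1).1
  have hQ := (mem_walls.1 h1').1
  rw [mem_Icc] at hi
  rcases lt_trichotomy (e.nextWall Q i) (e.nextWall P i) with hlt | heq | hlt
  · have hm : e.nextWall Q i ∈ Icc 1 e.length := mem_Icc.2 ⟨by omega, by omega⟩
    refine Or.inr ((rightSum_one_lt hlt hm).2 fun hn => ?_)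
    have hw : e.nextWall Q i ∈ e.walls P := by
      rw [mem_walls_iff hm] at h1' ⊢
      exact ⟨fun hn hP => h1'.1 hn (h hP), fun _ => hn⟩
    have := h3 _ hw h2'
    omega
  · exact Or.inl heq.symm
  · have hm : e.nextWall P i ∈ Icc 1 e.length := mem_Icc.2 ⟨by omega, by omega⟩
    refine Or.inr ((rightSum_one_lt hlt hm).1 ?_)
    by_contra hn
    have hw : e.nextWall P i ∈ e.walls Q := by
      rw [mem_walls_iff hm] at h1 ⊢
      exact ⟨fun h => absurd h hn, fun hQ => h1.2 fun hP => hQ (h hP)⟩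
    have := h3' _ hw h2
    omega

/-- This is supermodularity. Both factors of the product are positive; with growing `P` they
increase when `i` is negative, and decrease when it is positive, where the product is subtracted.
The strict part makes exchanges produce distinct points. -/
theorem marginal_le_and_lt {P Q : Finset ℕ} (h : P ⊆ Q) {i : ℕ} (hi : i ∈ Icc 1 e.length) :
    e.marginal P i ≤ e.marginal Q i ∧
      (e.prevWall P i ≠ e.prevWall Q i ∨ e.nextWall P i ≠ e.nextWall Q i →
        e.marginal P i < e.marginal Q i) := by
  have hl := leftSum_prevWall_le h hi
  have hr := rightSum_nextWall_le h hi
  have hl1 := leftSum_one_lt (prevWall_spec P hi).2.1 hi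
  have hl2 := leftSum_one_lt (prevWall_spec Q hi).2.1 hi
  have hr1 := rightSum_one_lt (nextWall_spec P hi).2.1 hi
  have hr2 := rightSum_one_lt (nextWall_spec Q hi).2.1 hi
  have key : ∀ p q p' q' : ℝ, 0 < p → 0 < q → p ≤ p' → q ≤ q' →
      p * q ≤ p' * q' ∧ (p < p' ∨ q < q' → p * q < p' * q') := by
    intro p q p' q' hp hq hpp hqq
    refine ⟨mul_le_mul hpp hqq hq.le (hp.le.trans hpp), ?_⟩
    rintro (h | h)
    · exact mul_lt_mul h hqq hq (hp.le.trans hpp)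
    · exact mul_lt_mul' hpp h hq.le (hp.trans_le hpp)
  have hle : e.leftSum 1 (e.prevWall P i) ≤ e.leftSum 1 (e.prevWall Q i) := by
    rcases hl with h | h
    · rw [h]
    · exact h.le
  have hre : e.rightSum 1 (e.nextWall P i) ≤ e.rightSum 1 (e.nextWall Q i) := by
    rcases hr with h | h
    · rw [h]
    · exact h.le
  have hlr : e.prevWall P i ≠ e.prevWall Q i ∨ e.nextWall P i ≠ e.nextWall Q i →
      e.leftSum 1 (e.prevWall P i) < e.leftSum 1 (e.prevWall Q i) ∨
        e.rightSum 1 (e.nextWall P i) < e.rightSum 1 (e.nextWall Q i) :=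
    Or.imp hl.resolve_left hr.resolve_left
  rw [marginal, marginal]
  split_ifs with hn
  · obtain ⟨k1, k2⟩ := key _ _ _ _ (sub_pos.2 (hl1.1 hn)) (sub_pos.2 (hr1.1 hn))
      (sub_le_sub_right hle (e.leftSum 1 i)) (sub_le_sub_right hre (e.rightSum 1 i))
    exact ⟨k1, fun h => k2 ((hlr h).imp (sub_lt_sub_right · _) (sub_lt_sub_right · _))⟩
  · obtain ⟨k1, k2⟩ := key _ _ _ _ (sub_pos.2 (hl2.2 hn)) (sub_pos.2 (hr2.2 hn))
      (sub_le_sub_left hle (e.leftSum 1 i)) (sub_le_sub_left hre (e.rightSum 1 i))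
    exact ⟨sub_le_sub_left k1 _, fun h => sub_lt_sub_left
      (k2 ((hlr h).imp (sub_lt_sub_left · _) (sub_lt_sub_left · _))) _⟩

variable (e)

/-- The columns coming before `i` in the ordering `q`. -/
def before (q : ℕ → ℕ) (i : ℕ) : Finset ℕ := (Icc 1 e.length).filter (q · < q i)

/-- The point obtained by adding the columns greedily in the ordering `q`. -/
noncomputable def orderingPoint (q : ℕ → ℕ) (i : ℕ) : ℝ := e.marginal (e.before q i) i

/-- The points of the associahedron, with coordinates indexed by `{1, …, n}`. -/
structure IsAssociahedronPoint (x : ℕ → ℝ) : Prop where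
  defect_eq : e.defect x = 0
  slack_nonneg : ∀ a b, a < b → b ≤ e.length + 1 → 0 ≤ e.slack x a b

variable {e}

/-- Greedy argument: adding the elements of `L` in the order `q`, each adds its coordinate minus its
marginal over the part of `L` already present. The coordinate is the marginal over all earlier
columns, which is at least as large. -/
theorem totalSlack_orderingPoint_nonneg {q : ℕ → ℕ} (hq : Set.InjOn q (Icc 1 e.length))
    (L : Finset ℕ) (hL : L ⊆ Icc 1 e.length) : 0 ≤ e.totalSlack (e.orderingPoint q) L := by
  induction L using Finset.induction_on_max_value q with
  | empty => rw [totalSlack_empty]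
  | insert a s ha hmax ih =>
    have hai := hL (mem_insert_self a s)
    have hs : s ⊆ Icc 1 e.length := (subset_insert a s).trans hL
    rw [totalSlack_insert _ hai ha]
    have hsub : s ⊆ e.before q a := fun j hj => mem_filter.2 ⟨hs hj, lt_of_le_of_ne (hmax j hj)
      fun h => ha (hq (hs hj) hai h ▸ hj)⟩
    have := (marginal_le_and_lt hsub hai).1
    have := ih hs
    rw [orderingPoint]
    linarith

theorem totalSlack_orderingPoint_eq_zero {q : ℕ → ℕ} (hq : Set.InjOn q (Icc 1 e.length))
    (L : Finset ℕ) (hL : L ⊆ Icc 1 e.length)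
    (hpre : ∀ j ∈ L, ∀ k ∈ Icc 1 e.length, q k < q j → k ∈ L) :
    e.totalSlack (e.orderingPoint q) L = 0 := by
  induction L using Finset.induction_on_max_value q with
  | empty => rw [totalSlack_empty]
  | insert a s ha hmax ih =>
    have hai := hL (mem_insert_self a s)
    have hs : s ⊆ Icc 1 e.length := (subset_insert a s).trans hL
    rw [totalSlack_insert _ hai ha, ih hs]
    · have : s = e.before q a := by
        ext j
        refine ⟨fun hj => mem_filter.2 ⟨hs hj, lt_of_le_of_ne (hmax j hj)
          fun h => ha (hq (hs hj) hai h ▸ hj)⟩, fun hj => ?_⟩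
        obtain ⟨h1, h2⟩ := mem_filter.1 hj
        rcases mem_insert.1 (hpre a (mem_insert_self a s) j h1 h2) with rfl | h
        · exact absurd h2 (lt_irrefl _)
        · exact h
      rw [orderingPoint, ← this]
      ring
    · intro j hj k hk hkj
      rcases mem_insert.1 (hpre j (mem_insert_of_mem hj) k hk hkj) with rfl | h
      · exact absurd hkj (hmax j hj).not_gt
      · exact h

theorem defect_orderingPoint {q : ℕ → ℕ} (hq : Set.InjOn q (Icc 1 e.length)) :
    e.defect (e.orderingPoint q) = 0 := by
  rw [← totalSlack_Icc]
  exact totalSlack_orderingPoint_eq_zero hq _ Subset.rfl fun j _ k hk _ => hk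

theorem totalSlack_eq_sum_slack {x : ℕ → ℝ} (hx : e.defect x = 0) (P : Finset ℕ) :
    e.totalSlack x P = ∑ p ∈ consecutivePairs (e.walls P), e.slack x p.1 p.2 := by
  refine sum_congr rfl fun p _ => ?_
  rw [hx, ite_self, sub_zero]

/-- Columns between `a` and `b` lie below the diagonal exactly when negative, so they are not walls,
while each end is a border or a wall. -/
theorem pair_mem_consecutivePairs_belowDiagonal {a b : ℕ} (hab : a < b) (hb : b ≤ e.length + 1) :
    (a, b) ∈ consecutivePairs (e.walls (belowDiagonal e a b)) := by
  rw [mem_consecutivePairs, mem_walls, mem_walls]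
  simp only [mem_belowDiagonal, mem_walls, mem_Icc]
  refine ⟨by grind, by grind, hab, ?_⟩
  intro c hc h1 h2
  grind

/-- Such a pair lies on one side of the diagonal, where by the sign of `a` or `b` the columns are
all below it or all above it; so its own diagonal is trivial. Thus the total slack of `belowDiagonal
e a b` reduces to the slack of a single diagonal. -/
theorem belowDiagonal_consecutivePair {a b c d : ℕ} (hab : a < b) (hb : b ≤ e.length + 1)
    (h : (c, d) ∈ consecutivePairs (e.walls (belowDiagonal e a b))) (hne : (c, d) ≠ (a, b)) :
    belowDiagonal e c d = ∅ ∨ belowDiagonal e c d = Icc 1 e.length := by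
  have hab' := mem_consecutivePairs.1 (pair_mem_consecutivePairs_belowDiagonal hab hb)
  obtain ⟨hc, hd, hcd, h⟩ := mem_consecutivePairs.1 h
  have h1 := hab'.2.2.2 c hc
  have h2 := hab'.2.2.2 d hd
  have h3 := h a hab'.1
  have h4 := h b hab'.2.1
  have h5 : d ≤ a ∨ b ≤ c := by grind
  have hdn := (mem_walls.1 hd).1
  have hgap : ∀ i ∈ Icc 1 e.length, c < i → i < d → (e.Neg i ↔ i ∈ belowDiagonal e a b) := by
    intro i hi hci hid
    have := h i
    rw [mem_walls_iff hi] at this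
    exact not_iff_not.1 (not_iff.1 fun h' => this h' hci hid)
  have hwc : c = 0 ∨ (e.Neg c ↔ c ∉ belowDiagonal e a b) := by
    rcases (mem_walls.1 hc).2 with h | h | h
    · exact Or.inl h
    · omega
    · exact Or.inr h
  have hwd : d = e.length + 1 ∨ (e.Neg d ↔ d ∉ belowDiagonal e a b) := by
    rcases (mem_walls.1 hd).2 with h | h | h
    · omega
    · exact Or.inl h
    · exact Or.inr h
  have hmem : ∀ i ∈ Icc 1 e.length, (i ≤ a → (i ∈ belowDiagonal e a b ↔ ¬ e.Neg a)) ∧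
      (b ≤ i → (i ∈ belowDiagonal e a b ↔ ¬ e.Neg b)) := by
    intro i hi
    rw [mem_belowDiagonal]
    exact ⟨fun h => ⟨by rintro ⟨_, h' | h' | h'⟩ <;> first | omega | exact h'.2,
      fun h' => ⟨hi, Or.inr (Or.inl ⟨h, h'⟩)⟩⟩, fun h =>
      ⟨by rintro ⟨_, h' | h' | h'⟩ <;> first | omega | exact h'.2,
      fun h' => ⟨hi, Or.inr (Or.inr ⟨h, h'⟩)⟩⟩⟩
  have hempty : (∀ i ∈ Icc 1 e.length, c ≤ i → i ≤ d → i ∉ belowDiagonal e a b) →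
      belowDiagonal e c d = ∅ := by
    intro hL
    refine eq_empty_of_forall_notMem fun i hi => ?_
    obtain ⟨hi, hi'⟩ := mem_belowDiagonal.1 hi
    rw [mem_Icc] at hi
    rcases hi' with h' | h' | h'
    · exact hL i (mem_Icc.2 hi) (by omega) (by omega) ((hgap i (mem_Icc.2 hi) h'.1 h'.2.1).1 h'.2.2)
    · have := hwc.resolve_left (by omega)
      exact h'.2 (this.2 (hL c (mem_Icc.2 ⟨by omega, by omega⟩) le_rfl hcd.le))
    · have := hwd.resolve_left (by omega)
      exact h'.2 (this.2 (hL d (mem_Icc.2 ⟨by omega, by omega⟩) hcd.le le_rfl))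
  have hfull : (∀ i ∈ Icc 1 e.length, c ≤ i → i ≤ d → i ∈ belowDiagonal e a b) →
      belowDiagonal e c d = Icc 1 e.length := by
    intro hL
    ext i
    refine ⟨fun hi => (mem_belowDiagonal.1 hi).1, fun hi => mem_belowDiagonal.2 ⟨hi, ?_⟩⟩
    have hi' := mem_Icc.1 hi
    rcases Nat.lt_or_ge c i with h1 | h1
    · rcases Nat.lt_or_ge i d with h2 | h2
      · exact Or.inl ⟨h1, h2, (hgap i hi h1 h2).2 (hL i hi h1.le h2.le)⟩
      · have := hwd.resolve_left (by omega)
        exact Or.inr (Or.inr ⟨h2, fun hn =>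
          this.1 hn (hL d (mem_Icc.2 ⟨by omega, by omega⟩) hcd.le le_rfl)⟩)
    · have := hwc.resolve_left (by omega)
      exact Or.inr (Or.inl ⟨h1, fun hn =>
        this.1 hn (hL c (mem_Icc.2 ⟨by omega, by omega⟩) le_rfl hcd.le)⟩)
  rcases h5 with h5 | h5
  · by_cases hn : e.Neg a
    · exact Or.inl (hempty fun i hi _ hid => by
        rw [(hmem i hi).1 (hid.trans h5)]; exact not_not.2 hn)
    · exact Or.inr (hfull fun i hi _ hid => ((hmem i hi).1 (hid.trans h5)).2 hn)
  · by_cases hn : e.Neg b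
    · exact Or.inl (hempty fun i hi hci _ => by
        rw [(hmem i hi).2 (h5.trans hci)]; exact not_not.2 hn)
    · exact Or.inr (hfull fun i hi hci _ => ((hmem i hi).2 (h5.trans hci)).2 hn)

theorem isAssociahedronPoint_orderingPoint {q : ℕ → ℕ} (hq : Set.InjOn q (Icc 1 e.length)) :
    e.IsAssociahedronPoint (e.orderingPoint q) := by
  refine ⟨defect_orderingPoint hq, fun a b hab hb => ?_⟩
  have h := totalSlack_orderingPoint_nonneg hq (belowDiagonal e a b) (filter_subset _ _)
  rw [totalSlack_eq_sum_slack (defect_orderingPoint hq), sum_eq_single (a, b)] at h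
  · exact h
  · rintro ⟨c, d⟩ hcd hne
    rcases belowDiagonal_consecutivePair hab hb hcd hne with h' | h'
    · simp [slack, h', triangular]
    · have := defect_orderingPoint hq
      rw [defect] at this
      simpa [slack, h'] using this
  · exact fun h' => absurd (pair_mem_consecutivePairs_belowDiagonal hab hb) h'

theorem IsAssociahedronPoint.totalSlack_nonneg {x : ℕ → ℝ} (hx : e.IsAssociahedronPoint x)
    (P : Finset ℕ) : 0 ≤ e.totalSlack x P := by
  rw [totalSlack_eq_sum_slack hx.defect_eq]
  refine sum_nonneg fun ⟨a, b⟩ h => ?_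
  obtain ⟨_, hb, hab, _⟩ := mem_consecutivePairs.1 h
  exact hx.slack_nonneg a b hab (mem_walls.1 hb).1

theorem IsAssociahedronPoint.totalSlack_eq_zero_iff {x : ℕ → ℝ} (hx : e.IsAssociahedronPoint x)
    (P : Finset ℕ) : e.totalSlack x P = 0 ↔
      ∀ a b, (a, b) ∈ consecutivePairs (e.walls P) → e.slack x a b = 0 := by
  rw [totalSlack_eq_sum_slack hx.defect_eq, sum_eq_zero_iff_of_nonneg]
  · exact ⟨fun h a b => h (a, b), fun h p => h p.1 p.2⟩
  · rintro ⟨a, b⟩ h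
    obtain ⟨_, hb, hab, _⟩ := mem_consecutivePairs.1 h
    exact hx.slack_nonneg a b hab (mem_walls.1 hb).1

/-- The marginals do not depend on the point, so `totalSlack` is the sum of the coordinates over `P`
minus a fixed set function. -/
theorem totalSlack_sub (x x' : ℕ → ℝ) {P : Finset ℕ} (hP : P ⊆ Icc 1 e.length) :
    e.totalSlack x P - e.totalSlack x' P = ∑ i ∈ P, (x i - x' i) := by
  induction P using Finset.induction_on with
  | empty => rw [totalSlack_empty, totalSlack_empty, sum_empty, sub_zero]
  | insert a s ha ih =>
    have hai := hP (mem_insert_self a s)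
    rw [totalSlack_insert _ hai ha, totalSlack_insert _ hai ha, sum_insert ha,
      ← ih ((subset_insert a s).trans hP)]
    ring

end Signature

end SchroderCambrian
namespace SchroderCambrian
open Finset

/-! ### Summation over initial sets -/

/-- `L` is a subset of `s` all of whose elements have smaller levels than those of `s \ L`. -/
def IsInitial {α : Type*} [LT α] (s : Finset ℕ) (r : ℕ → α) (L : Finset ℕ) : Prop :=
  L ⊆ s ∧ ∀ u ∈ L, ∀ w ∈ s, w ∉ L → r u < r w

/-- Abel summation: peeling off the levels of `y` from the top writes the sum as a positive
combination of the sums of `u` over initial sets. If it vanishes, so does each of these sums. -/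
theorem sum_initial_nonneg (y u : ℕ → ℝ) (s : Finset ℕ)
    (hu : ∀ L, IsInitial s y L → 0 ≤ ∑ i ∈ L, u i) {C : ℝ} (hC : ∀ i ∈ s, y i < C) :
    0 ≤ ∑ i ∈ s, (C - y i) * u i ∧
      (∑ i ∈ s, (C - y i) * u i ≤ 0 → ∀ L, IsInitial s y L → ∑ i ∈ L, u i = 0) := by
  induction s using Finset.strongInduction generalizing C with
  | H s ih =>
    rcases s.eq_empty_or_nonempty with rfl | hs
    · simp only [sum_empty, le_refl, true_and]
      intro _ L hL
      rw [subset_empty.1 hL.1, sum_empty]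
    obtain ⟨a, ha, hmax⟩ := exists_max_image s y hs
    have hlow : IsInitial s y (s.filter (y · < y a)) := by
      refine ⟨filter_subset _ _, fun i hi j hj hj' => ?_⟩
      rw [mem_filter] at hi hj'
      exact hi.2.trans_le (not_lt.1 fun h => hj' ⟨hj, h⟩)
    have htrans : ∀ L, IsInitial (s.filter (y · < y a)) y L → IsInitial s y L := by
      refine fun L hL => ⟨hL.1.trans hlow.1, fun i hi j hj hj' => ?_⟩
      by_cases h : j ∈ s.filter (y · < y a)
      · exact hL.2 i hi j h hj'
      · exact hlow.2 i (hL.1 hi) j hj h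
    have hsub : s.filter (y · < y a) ⊂ s := filter_ssubset.2 ⟨a, ha, lt_irrefl _⟩
    obtain ⟨ih1, ih2⟩ := ih _ hsub (fun L hL => hu L (htrans L hL))
      (C := y a) fun i hi => (mem_filter.1 hi).2
    have hs0 := hu s ⟨Subset.rfl, fun i _ j hj hj' => absurd hj hj'⟩
    have hCa : 0 < C - y a := sub_pos.2 (hC a ha)
    -- Raising the bound from the top level `y a` to `C` adds the same amount to every weight, hence
    -- a multiple of the sum over all of `s`; the top level has weight zero in the first term.
    have heq : ∑ i ∈ s, (C - y i) * u i =
        ∑ i ∈ s.filter (y · < y a), (y a - y i) * u i + (C - y a) * ∑ i ∈ s, u i := by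
      rw [sum_filter, mul_sum, ← sum_add_distrib]
      refine sum_congr rfl fun i hi => ?_
      split_ifs with h
      · ring
      · rw [le_antisymm (hmax i hi) (not_lt.1 h)]
        ring
    rw [heq]
    have h2 := mul_nonneg hCa.le hs0
    refine ⟨add_nonneg ih1 h2, fun hle L hL => ?_⟩
    by_cases hLs : s ⊆ L
    · rw [hL.1.antisymm hLs]
      have : (C - y a) * ∑ i ∈ s, u i = 0 := by linarith
      exact (mul_eq_zero.1 this).resolve_left hCa.ne'
    · obtain ⟨w, hw, hwL⟩ := not_subset.1 hLs
      exact ih2 (by linarith) L ⟨fun i hi => mem_filter.2 ⟨hL.1 hi,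
        (hL.2 i hi w hw hwL).trans_le (hmax w hw)⟩, fun i hi j hj => hL.2 i hi j (hsub.1 hj)⟩

/-! ### Slots of a level function and the faces they cut out -/

namespace Signature

/-- The columns `a < b` are consecutive walls of some horizontal line of the table in which column
`i` has its dot at level `r i`. -/
def IsSlot {α : Type*} [LT α] (e : Signature) (r : ℕ → α) (a b : ℕ) : Prop :=
  a < b ∧ b ≤ e.length + 1 ∧ ∀ u ∈ Icc 1 e.length, ∀ w ∈ Icc 1 e.length,
    ((a < u ∧ u < b ∧ e.Neg u) ∨ ((u = a ∨ u = b) ∧ ¬ e.Neg u)) →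
    ((a < w ∧ w < b ∧ ¬ e.Neg w) ∨ ((w = a ∨ w = b) ∧ e.Neg w)) → r u < r w

section

variable {α : Type*} [LinearOrder α] {e : Signature} {r : ℕ → α}

theorem isSlot_of_isInitial {L : Finset ℕ} (hL : IsInitial (Icc 1 e.length) r L) {a b : ℕ}
    (h : (a, b) ∈ consecutivePairs (e.walls L)) : e.IsSlot r a b := by
  obtain ⟨ha, hb, hab, h⟩ := mem_consecutivePairs.1 h
  refine ⟨hab, (mem_walls.1 hb).1, fun u hu w hw hu' hw' => hL.2 u ?_ w hw ?_⟩
  · rcases hu' with ⟨h1, h2, h3⟩ | ⟨rfl | rfl, h3⟩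
    · by_contra hn
      exact h u ((mem_walls_iff hu).2 (iff_of_true h3 hn)) h1 h2
    · exact not_not.1 fun hn => h3 (((mem_walls_iff hu).1 ha).2 hn)
    · exact not_not.1 fun hn => h3 (((mem_walls_iff hu).1 hb).2 hn)
  · rcases hw' with ⟨h1, h2, h3⟩ | ⟨rfl | rfl, h3⟩
    · intro hn
      exact h w ((mem_walls_iff hw).2 (iff_of_false h3 (not_not.2 hn))) h1 h2
    · exact ((mem_walls_iff hw).1 ha).1 h3
    · exact ((mem_walls_iff hw).1 hb).1 h3

/-- The line can be drawn just above the highest dot that must be below it: take as `L` all columns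
at or below the level of some such dot. -/
theorem IsSlot.exists_isInitial {a b : ℕ} (h : e.IsSlot r a b) :
    ∃ L, IsInitial (Icc 1 e.length) r L ∧ (a, b) ∈ consecutivePairs (e.walls L) := by
  classical
  obtain ⟨hab, hb, h⟩ := h
  let A := (Icc 1 e.length).filter fun u =>
    (a < u ∧ u < b ∧ e.Neg u) ∨ ((u = a ∨ u = b) ∧ ¬ e.Neg u)
  let L := (Icc 1 e.length).filter fun k => ∃ u ∈ A, r k ≤ r u
  have hA : ∀ u ∈ Icc 1 e.length,
      ((a < u ∧ u < b ∧ e.Neg u) ∨ ((u = a ∨ u = b) ∧ ¬ e.Neg u)) → u ∈ L := fun u hu hu' =>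
    mem_filter.2 ⟨hu, u, mem_filter.2 ⟨hu, hu'⟩, le_rfl⟩
  have hB : ∀ w ∈ Icc 1 e.length,
      ((a < w ∧ w < b ∧ ¬ e.Neg w) ∨ ((w = a ∨ w = b) ∧ e.Neg w)) → w ∉ L := by
    intro w hw hw' hwL
    obtain ⟨_, u, hu, hle⟩ := mem_filter.1 hwL
    obtain ⟨hu, hu'⟩ := mem_filter.1 hu
    exact (h u hu w hw hu' hw').not_ge hle
  have hend : ∀ c ∈ Icc 1 e.length, c = a ∨ c = b → c ∈ e.walls L := by
    intro c hc hc'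
    rw [mem_walls_iff hc]
    by_cases hn : e.Neg c
    · exact iff_of_true hn (hB c hc (Or.inr ⟨hc', hn⟩))
    · exact iff_of_false hn (not_not.2 (hA c hc (Or.inr ⟨hc', hn⟩)))
  refine ⟨L, ⟨filter_subset _ _, fun u hu w hw hwL => ?_⟩, mem_consecutivePairs.2
    ⟨?_, ?_, hab, fun c hc hac hcb => ?_⟩⟩
  · obtain ⟨_, u', hu', hle⟩ := mem_filter.1 hu
    by_contra hn
    exact hwL (mem_filter.2 ⟨hw, u', hu', (not_lt.1 hn).trans hle⟩)
  · rcases Nat.eq_zero_or_pos a with rfl | ha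
    · exact zero_mem_walls _
    · exact hend a (mem_Icc.2 ⟨ha, by omega⟩) (Or.inl rfl)
  · rcases hb.eq_or_lt with rfl | hb
    · exact length_add_one_mem_walls _
    · exact hend b (mem_Icc.2 ⟨by omega, by omega⟩) (Or.inr rfl)
  · have hcm : c ∈ Icc 1 e.length := mem_Icc.2 ⟨by omega, by omega⟩
    rw [mem_walls_iff hcm] at hc
    by_cases hn : e.Neg c
    · exact hc.1 hn (hA c hcm (Or.inl ⟨hac, hcb, hn⟩))
    · exact hn (hc.2 (hB c hcm (Or.inl ⟨hac, hcb, hn⟩)))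

theorem IsSlot.congr {β : Type*} [LinearOrder β] {r' : ℕ → β}
    (hr : ∀ i ∈ Icc 1 e.length, ∀ j ∈ Icc 1 e.length, r i < r j → r' i < r' j) {a b : ℕ}
    (h : e.IsSlot r a b) : e.IsSlot r' a b :=
  ⟨h.1, h.2.1, fun u hu w hw hu' hw' => hr u hu w hw (h.2.2 u hu w hw hu' hw')⟩

end

section

variable {α : Type*} [LinearOrder α]

/-- The points of the associahedron whose slacks vanish on all slots of the levels `r`. -/
def face (e : Signature) (r : ℕ → α) : Set (ℕ → ℝ) :=
  {x | e.IsAssociahedronPoint x ∧ ∀ a b, e.IsSlot r a b → e.slack x a b = 0}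

variable {e : Signature} {r : ℕ → α}

/-- The slots are the pairs of consecutive walls of initial sets, and a total slack is a sum of
nonnegative slacks. -/
theorem mem_face_iff {x : ℕ → ℝ} (hx : e.IsAssociahedronPoint x) :
    x ∈ e.face r ↔ ∀ L, IsInitial (Icc 1 e.length) r L → e.totalSlack x L = 0 := by
  constructor
  · intro h L hL
    rw [hx.totalSlack_eq_zero_iff]
    exact fun a b hab => h.2 a b (isSlot_of_isInitial hL hab)
  · intro h
    refine ⟨hx, fun a b hab => ?_⟩
    obtain ⟨L, hL, hp⟩ := hab.exists_isInitial
    exact (hx.totalSlack_eq_zero_iff L).1 (h L hL) a b hp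

theorem orderingPoint_mem_face {q : ℕ → ℕ} (hq : Set.InjOn q (Icc 1 e.length))
    (hr : ∀ i ∈ Icc 1 e.length, ∀ j ∈ Icc 1 e.length, r i < r j → q i < q j) :
    e.orderingPoint q ∈ e.face r := by
  rw [mem_face_iff (isAssociahedronPoint_orderingPoint hq)]
  intro L hL
  refine totalSlack_orderingPoint_eq_zero hq L hL.1 fun j hj k hk hkj => ?_
  by_contra hn
  exact (hr j (hL.1 hj) k hk (hL.2 j hj k hk hn)).not_gt hkj

theorem face_congr {β : Type*} [LinearOrder β] {r' : ℕ → β}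
    (hr : ∀ i ∈ Icc 1 e.length, ∀ j ∈ Icc 1 e.length, r i < r j ↔ r' i < r' j) :
    e.face r = e.face r' := by
  ext x
  refine and_congr_right fun _ => forall₂_congr fun a b => imp_congr_left ⟨?_, ?_⟩
  · exact IsSlot.congr fun i hi j hj => (hr i hi j hj).1
  · exact IsSlot.congr fun i hi j hj => (hr i hi j hj).2

/-- The number of columns of smaller level. -/
noncomputable def rank (e : Signature) (r : ℕ → α) (i : ℕ) : ℕ :=
  ((Icc 1 e.length).filter (r · < r i)).card

theorem rank_lt_rank_iff {i j : ℕ} (hi : i ∈ Icc 1 e.length) :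
    e.rank r i < e.rank r j ↔ r i < r j := by
  constructor
  · intro h
    by_contra hn
    refine absurd (card_le_card (monotone_filter_right _ fun k _ hk => ?_)) h.not_ge
    exact lt_of_lt_of_le hk (not_lt.1 hn)
  · intro h
    refine card_lt_card (ssubset_iff_of_subset ?_ |>.2 ⟨i, mem_filter.2 ⟨hi, h⟩, by simp⟩)
    exact monotone_filter_right _ fun k _ hk => lt_trans hk h

theorem mul_add_lt_mul_add_iff {B a b s t : ℕ} (hs : s < B) (ht : t < B) :
    a * B + s < b * B + t ↔ a < b ∨ (a = b ∧ s < t) := by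
  rcases lt_trichotomy a b with h | rfl | h
  · have : (a + 1) * B ≤ b * B := Nat.mul_le_mul_right B h
    rw [Nat.add_mul] at this
    exact iff_of_true (by omega) (Or.inl h)
  · simp
  · have : (b + 1) * B ≤ a * B := Nat.mul_le_mul_right B h
    rw [Nat.add_mul] at this
    exact iff_of_false (by omega) (by omega)

/-- Break ties between equal levels by the column number and take the greedy point of the resulting
ordering. -/
theorem face_nonempty (e : Signature) (r : ℕ → α) : (e.face r).Nonempty := by
  refine ⟨e.orderingPoint fun i => e.rank r i * (e.length + 1) + i, orderingPoint_mem_face ?_ ?_⟩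
  · intro i hi j hj h
    rw [mem_coe, mem_Icc] at hi hj
    have h1 := (mul_add_lt_mul_add_iff (B := e.length + 1) (a := e.rank r i) (b := e.rank r j)
      (s := i) (t := j) (by omega) (by omega)).not.1 h.not_lt
    have h2 := (mul_add_lt_mul_add_iff (B := e.length + 1) (a := e.rank r j) (b := e.rank r i)
      (s := j) (t := i) (by omega) (by omega)).not.1 h.not_gt
    omega
  · intro i hi j hj h
    rw [mem_Icc] at hj
    rw [mul_add_lt_mul_add_iff (by have := mem_Icc.1 hi; omega) (by omega)]
    exact Or.inl ((rank_lt_rank_iff hi).2 h)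

end

variable {e : Signature}

/-- Abel summation with `u = z - x`: over an initial set, `u` sums to the total slack of `z`, that
of `x` being zero. Equality of the linear forms makes the total slacks of `z` on initial sets vanish
as well. -/
theorem sum_mul_le_of_mem_face {y x z : ℕ → ℝ} (hx : x ∈ e.face y)
    (hz : e.IsAssociahedronPoint z) :
    ∑ i ∈ Icc 1 e.length, y i * z i ≤ ∑ i ∈ Icc 1 e.length, y i * x i ∧
      (∑ i ∈ Icc 1 e.length, y i * x i ≤ ∑ i ∈ Icc 1 e.length, y i * z i → z ∈ e.face y) := by
  have hu : ∀ L, IsInitial (Icc 1 e.length) y L →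
      ∑ i ∈ L, (z i - x i) = e.totalSlack z L := by
    intro L hL
    rw [← totalSlack_sub z x hL.1, (mem_face_iff hx.1).1 hx L hL, sub_zero]
  obtain ⟨C, hC⟩ : ∃ C, ∀ i ∈ Icc 1 e.length, y i < C := by
    obtain ⟨C, hC⟩ := ((Icc 1 e.length).image y).bddAbove
    exact ⟨C + 1, fun i hi => (hC (mem_coe.2 (mem_image_of_mem y hi))).trans_lt (lt_add_one C)⟩
  have h0 : ∑ i ∈ Icc 1 e.length, (z i - x i) = 0 := by
    rw [← totalSlack_sub z x Subset.rfl, totalSlack_Icc, totalSlack_Icc, hz.defect_eq,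
      hx.1.defect_eq, sub_zero]
  obtain ⟨h1, h2⟩ := sum_initial_nonneg y (fun i => z i - x i) (Icc 1 e.length)
    (fun L hL => by rw [hu L hL]; exact hz.totalSlack_nonneg L) hC
  have heq : ∑ i ∈ Icc 1 e.length, (C - y i) * (z i - x i) =
      ∑ i ∈ Icc 1 e.length, y i * x i - ∑ i ∈ Icc 1 e.length, y i * z i := by
    rw [← sum_sub_distrib, ← add_zero (∑ i ∈ Icc 1 e.length, (y i * x i - y i * z i)),
      ← mul_zero C, ← h0, mul_sum, ← sum_add_distrib]
    exact sum_congr rfl fun i _ => by ring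
  rw [heq] at h1 h2
  refine ⟨sub_nonneg.1 h1, fun hle => (mem_face_iff hz).2 fun L hL => ?_⟩
  rw [← hu L hL]
  exact h2 (sub_nonpos.2 hle) L hL

theorem mem_face_iff_isMax {y x : ℕ → ℝ} : x ∈ e.face y ↔ e.IsAssociahedronPoint x ∧
    ∀ z, e.IsAssociahedronPoint z →
      ∑ i ∈ Icc 1 e.length, y i * z i ≤ ∑ i ∈ Icc 1 e.length, y i * x i := by
  refine ⟨fun h => ⟨h.1, fun z hz => (sum_mul_le_of_mem_face h hz).1⟩, fun ⟨hx, h⟩ => ?_⟩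
  obtain ⟨x₀, hx₀⟩ := e.face_nonempty y
  exact (sum_mul_le_of_mem_face hx₀ hx).2 (h x₀ hx₀.1)

/-! ### Exchange of two adjacent columns of an ordering -/

/-- Adding `j` toggles the wall of `j`. With no wall strictly between `i` and `j`, this changes the
wall nearest to `i` on that side, so the strict part of `marginal_le_and_lt` applies. -/
theorem marginal_lt_marginal_insert {P : Finset ℕ} {i j : ℕ} (hi : i ∈ Icc 1 e.length)
    (hj : j ∈ Icc 1 e.length) (hij : i ≠ j) (hjP : j ∉ P)
    (hw : ∀ c ∈ e.walls P, min i j < c → ¬ c < max i j) :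
    e.marginal P i < e.marginal (insert j P) i := by
  refine (marginal_le_and_lt (subset_insert j P) hi).2 ?_
  have hjw : j ∈ e.walls P ↔ j ∉ e.walls (insert j P) := by
    rw [mem_walls_iff hj, mem_walls_iff hj]
    simp [hjP]
  rcases hij.lt_or_gt with h | h
  · rw [min_eq_left h.le, max_eq_right h.le] at hw
    right
    obtain ⟨h1, h2, h3⟩ := nextWall_spec P hi
    obtain ⟨h1', h2', h3'⟩ := nextWall_spec (insert j P) hi
    have hge : j ≤ e.nextWall P i := not_lt.1 (hw _ h1 h2)
    intro heq
    by_cases hjP : j ∈ e.walls P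
    · have := le_antisymm hge (h3 j hjP h)
      rw [← heq, ← this] at h1'
      exact hjw.1 hjP h1'
    · have := h3' j (not_not.1 (hjw.not.1 hjP)) h
      have : e.nextWall P i = j := by omega
      exact hjP (this ▸ h1)
  · rw [min_eq_right h.le, max_eq_left h.le] at hw
    left
    obtain ⟨h1, h2, h3⟩ := prevWall_spec P hi
    obtain ⟨h1', h2', h3'⟩ := prevWall_spec (insert j P) hi
    have hge : e.prevWall P i ≤ j := not_lt.1 fun h => hw _ h1 h h2
    intro heq
    by_cases hjP : j ∈ e.walls P
    · have := le_antisymm hge (h3 j hjP h)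
      rw [← heq, this] at h1'
      exact hjw.1 hjP h1'
    · have := h3' j (not_not.1 (hjw.not.1 hjP)) h
      have : e.prevWall P i = j := by omega
      exact hjP (this ▸ h1)

/-- Take the greedy point of the ordering with `i` and `j` exchanged: as they are adjacent, the
columns before any third column stay the same, and `i` gains `j` as a predecessor. -/
theorem exists_sub_orderingPoint {q : ℕ → ℕ} (hq : Set.InjOn q (Icc 1 e.length)) {i j : ℕ}
    (hi : i ∈ Icc 1 e.length) (hj : j ∈ Icc 1 e.length) (hij : q i < q j)
    (hadj : ∀ k ∈ Icc 1 e.length, q i < q k → ¬ q k < q j)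
    (hw : ∀ c ∈ e.walls (e.before q i), min i j < c → ¬ c < max i j) :
    ∃ z, e.IsAssociahedronPoint z ∧ e.orderingPoint q i < z i ∧
      (∀ k ∈ Icc 1 e.length, k ≠ i → k ≠ j → z k = e.orderingPoint q k) := by
  have hne : i ≠ j := fun h => hij.ne (h ▸ rfl)
  let q' : ℕ → ℕ := fun k => q (Equiv.swap i j k)
  have hmaps : ∀ k ∈ Icc 1 e.length, Equiv.swap i j k ∈ Icc 1 e.length := by
    intro k hk
    rw [Equiv.swap_apply_def]
    split_ifs <;> assumption
  have hq' : Set.InjOn q' (Icc 1 e.length) := fun a ha b hb h =>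
    (Equiv.swap i j).injective (hq (hmaps a ha) (hmaps b hb) h)
  refine ⟨e.orderingPoint q', isAssociahedronPoint_orderingPoint hq', ?_, ?_⟩
  · have : e.before q' i = insert j (e.before q i) := by
      ext k
      rw [before, mem_filter, mem_insert, before, mem_filter]
      simp only [q', Equiv.swap_apply_def]
      by_cases h1 : k = i
      · subst h1
        simp [hne]
      by_cases h2 : k = j
      · subst h2
        simp [h1, hij, hj]
      · rw [if_neg h1, if_neg h2]
        refine ⟨fun h => Or.inr ⟨h.1, ?_⟩, fun h => ?_⟩
        · by_contra hn
          refine hadj k h.1 (lt_of_le_of_ne (not_lt.1 hn) fun h' => h1 ?_) h.2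
          exact (hq hi h.1 h').symm
        · have h := h.resolve_left h2
          exact ⟨h.1, h.2.trans hij⟩
    rw [orderingPoint, orderingPoint, this]
    exact marginal_lt_marginal_insert hi hj hne
      (fun h => hij.not_gt (mem_filter.1 h).2) hw
  · intro k hk hki hkj
    have : e.before q' k = e.before q k := by
      ext m
      rw [before, mem_filter, before, mem_filter]
      simp only [q', Equiv.swap_apply_of_ne_of_ne hki hkj]
      refine and_congr_right fun hm => ?_
      have hk1 : q i < q k ↔ q j < q k := by
        refine ⟨fun h => ?_, fun h => hij.trans h⟩
        exact lt_of_le_of_ne (not_lt.1 (hadj k hk h)) fun h' => hkj (hq hj hk h').symm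
      rw [Equiv.swap_apply_def]
      split_ifs with h1 h2
      · rw [h1, hk1]
      · rw [h2, hk1]
      · rfl
    rw [orderingPoint, orderingPoint, this]

/-- Two columns at equal or neighboring levels, which are not separated by the wall of a column
between them, are compared by all linear forms which are maximal on the face. -/
theorem le_of_isMax_on_face {r : ℕ → ℕ} {y : ℕ → ℝ}
    (hy : ∀ x ∈ e.face r, ∀ z, e.IsAssociahedronPoint z →
      ∑ i ∈ Icc 1 e.length, y i * z i ≤ ∑ i ∈ Icc 1 e.length, y i * x i)
    {i j : ℕ} (hi : i ∈ Icc 1 e.length) (hj : j ∈ Icc 1 e.length) (hne : i ≠ j)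
    (hij : r i ≤ r j) (hadj : ∀ k ∈ Icc 1 e.length, r i < r k → ¬ r k < r j)
    (hbet : ∀ c ∈ Icc 1 e.length, min i j < c → c < max i j →
      (e.Neg c → r c < r i) ∧ (¬ e.Neg c → r j < r c)) : y i ≤ y j := by
  -- Tie-breaking that makes `i` and `j` adjacent: at equal levels they come first with values 0 and
  -- 1; otherwise `i` is last in its level and `j` first in its own. Other columns get values from 2
  -- to n + 1.
  let t : ℕ → ℕ := fun k =>
    if k = i then (if r i = r j then 0 else e.length + 3) else if k = j then 1 else k + 1
  let q : ℕ → ℕ := fun k => r k * (e.length + 5) + t k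
  have hti : t i = if r i = r j then 0 else e.length + 3 := if_pos rfl
  have htj : t j = 1 := by simp [t, hne.symm]
  have htk : ∀ k, k ≠ i → k ≠ j → t k = k + 1 := fun k h1 h2 => by simp [t, h1, h2]
  have ht : ∀ k ∈ Icc 1 e.length, t k < e.length + 5 := by
    intro k hk
    rw [mem_Icc] at hk
    simp only [t]
    split_ifs <;> omega
  have hlt : ∀ a ∈ Icc 1 e.length, ∀ b ∈ Icc 1 e.length,
      (q a < q b ↔ r a < r b ∨ (r a = r b ∧ t a < t b)) :=
    fun a ha b hb => mul_add_lt_mul_add_iff (ht a ha) (ht b hb)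
  have htinj : Set.InjOn t (Icc 1 e.length) := by
    intro a ha b hb hab
    rw [mem_coe, mem_Icc] at ha hb
    simp only [t] at hab
    split_ifs at hab <;> omega
  have hq : Set.InjOn q (Icc 1 e.length) := by
    intro a ha b hb hab
    have h1 := (hlt a ha b hb).not.1 hab.not_lt
    have h2 := (hlt b hb a ha).not.1 hab.not_gt
    exact htinj ha hb (by omega)
  have hqij : q i < q j := by
    rw [hlt i hi j hj, hti, htj]
    split_ifs <;> omega
  have hqadj : ∀ k ∈ Icc 1 e.length, q i < q k → ¬ q k < q j := by
    intro k hk h1 h2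
    have hki : k ≠ i := fun h => by rw [h] at h1; exact lt_irrefl _ h1
    have hkj : k ≠ j := fun h => by rw [h] at h2; exact lt_irrefl _ h2
    rw [hlt i hi k hk, hti, htk k hki hkj] at h1
    rw [hlt k hk j hj, htj, htk k hki hkj] at h2
    have := hadj k hk
    rw [mem_Icc] at hk
    split_ifs at h1 <;> omega
  obtain ⟨z, hz, hzi, hzk⟩ := exists_sub_orderingPoint hq hi hj hqij hqadj (by
    intro c hc h1 h2
    have hcm : c ∈ Icc 1 e.length := by
      rw [mem_Icc] at *
      omega
    obtain ⟨k1, k2⟩ := hbet c hcm h1 h2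
    rw [mem_walls_iff hcm, before, mem_filter, hlt c hcm i hi] at hc
    by_cases hn : e.Neg c
    · exact hc.1 hn ⟨hcm, Or.inl (k1 hn)⟩
    · have := k2 hn
      refine hn (hc.2 fun h => ?_)
      omega)
  have hx := orderingPoint_mem_face (r := r) hq fun a ha b hb h => (hlt a ha b hb).2 (Or.inl h)
  have hle := hy _ hx z hz
  have hd : ∑ k ∈ Icc 1 e.length, (z k - e.orderingPoint q k) = 0 := by
    rw [← totalSlack_sub z _ Subset.rfl, totalSlack_Icc, totalSlack_Icc, hz.defect_eq,
      hx.1.defect_eq, sub_zero]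
  have hpair : ∀ f : ℕ → ℝ, (∀ k ∈ Icc 1 e.length, k ≠ i → k ≠ j → f k = 0) →
      ∑ k ∈ Icc 1 e.length, f k = f i + f j := by
    intro f hf
    rw [← sum_pair hne]
    refine (sum_subset (fun k hk => ?_) fun k hk hk' => ?_).symm
    · rcases mem_insert.1 hk with rfl | hk
      · exact hi
      · rwa [mem_singleton.1 hk]
    · rw [mem_insert, mem_singleton, not_or] at hk'
      exact hf k hk hk'.1 hk'.2
  rw [hpair _ fun k hk h1 h2 => by rw [hzk k hk h1 h2, sub_self]] at hd
  rw [← sub_nonpos, ← sum_sub_distrib, hpair _ fun k hk h1 h2 => by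
    rw [hzk k hk h1 h2, sub_self]] at hle
  -- The coordinate sums agree, so what `i` gains `j` loses, and maximality of `y` at the first
  -- point gives the sign.
  have : (z i - e.orderingPoint q i) * (y i - y j) ≤ 0 := by
    have h3 : z j - e.orderingPoint q j = -(z i - e.orderingPoint q i) := by linarith
    calc _ = y i * (z i - e.orderingPoint q i) + y j * (z j - e.orderingPoint q j) := by
          rw [h3]; ring
      _ ≤ 0 := by linarith
  have hpos := sub_pos.2 hzi
  by_contra hn
  exact absurd (mul_pos hpos (sub_pos.2 (not_le.1 hn))) this.not_gt

end Signature

end SchroderCambrian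
namespace SchroderCambrian
open Finset
open SignedOrdPart Signature

/-! ### Faces attached to trees -/

section

variable {α β : Type*} [LinearOrder α] [LinearOrder β] {e : Signature} {D : LabeledDigraph}

/-- Take a column `u` required below the slot and `w` required above it. By induction on their
distance, the walls of columns between them cannot separate them if `w` is not above `u` in the
table; then they see a common cell, and `r` would order them wrongly. -/
theorem SignedOrdPart.isSlot_row_of_isExtension {l : SignedOrdPart} {r : ℕ → α}
    (hr : l.pSymbol.IsExtension r) {a b : ℕ} (h : l.signature.IsSlot r a b) :
    l.signature.IsSlot l.row a b := by
  refine ⟨h.1, h.2.1, ?_⟩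
  intro u hu w hw hu' hw'
  induction hd : max u w - min u w using Nat.strong_induction_on generalizing u w with
  | _ d ih =>
    by_contra hle
    have hlen := length_signature l
    have hbet : ∀ c, min u w < c → c < max u w →
        (l.Neg c → l.row c < l.row w) ∧ (¬ l.Neg c → l.row u < l.row c) := by
      intro c h1 h2
      have hc : c ∈ Icc 1 l.signature.length := by
        rw [mem_Icc] at hu hw ⊢
        omega
      have hab : a < c ∧ c < b := by
        have := h.1
        omega
      refine ⟨fun hn => ?_, fun hn => ?_⟩
      · exact ih (max c w - min c w) (by omega) c hc w hw (Or.inl ⟨hab.1, hab.2, hn⟩) hw' rfl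
      · exact ih (max u c - min u c) (by omega) u hu c hc hu' (Or.inl ⟨hab.1, hab.2, hn⟩) rfl
    have hvis : ∀ i, i = u ∨ i = w → l.Visible i (min u w) (min u w + 1) := by
      intro i hi c hc
      have hci : c ≠ i := fun h => not_wallAtRow_of_row_eq (h ▸ rfl) hc
      rw [wallAtRow_iff] at hc
      refine ⟨by omega, fun h' => ?_⟩
      obtain ⟨k1, k2⟩ := hbet c (by omega) (by omega)
      rcases hc.2 with ⟨h3, h4⟩ | ⟨h3, h4⟩
      · have := k1 h3
        rcases hi with rfl | rfl <;> omega
      · have := k2 h3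
        rcases hi with rfl | rfl <;> omega
    rw [hlen] at hu hw
    have hx : min u w ≤ l.size := by
      rw [mem_Icc] at hu
      omega
    obtain ⟨k1, k2⟩ := isExtension_pSymbol_iff.1 hr w hw u hu _ hx (hvis w (Or.inr rfl))
      (hvis u (Or.inl rfl))
    rw [← hlen] at hu hw
    have hlt := h.2.2 u hu w hw hu' hw'
    rcases (not_lt.1 hle).lt_or_eq with h' | h'
    · exact hlt.not_gt (k1 h')
    · exact hlt.ne' (k2 h')

theorem IsSchroderCambrianTree.exists_row (hT : IsSchroderCambrianTree e D) {r : ℕ → α}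
    (hr : D.IsExtension r) : ∃ l : SignedOrdPart, l.signature = e ∧ l.pSymbol = D ∧
      ∀ i ∈ Icc 1 e.length, ∀ j ∈ Icc 1 e.length, l.row i < l.row j ↔ r i < r j := by
  have h : ∀ i ∈ Icc 1 e.length, ∀ j ∈ Icc 1 e.length,
      (ofRow e (e.rank r)).row i < (ofRow e (e.rank r)).row j ↔ r i < r j := fun i hi j hj => by
    rw [row_ofRow_lt_iff hi hj, Signature.rank_lt_rank_iff hi]
  refine ⟨ofRow e (e.rank r), signature_ofRow _ _, pSymbol_eq_of_isExtension ?_ ?_, h⟩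
  · rwa [signature_ofRow]
  · exact hT.isExtension_congr (fun i hi j hj => (h i hi j hj).symm) hr

/-- All strict extensions of a tree have the same slots: realize one by a table and apply
`isSlot_row_of_isExtension` to the other, both ways. Passing to ranks puts both extensions in the
natural numbers. -/
theorem IsSchroderCambrianTree.face_eq (hT : IsSchroderCambrianTree e D) {r : ℕ → α} {r' : ℕ → β}
    (hr : D.IsExtension r) (hr' : D.IsExtension r') : e.face r = e.face r' := by
  have key : ∀ {r r' : ℕ → ℕ}, D.IsExtension r → D.IsExtension r' → ∀ {a b},
      e.IsSlot r a b → e.IsSlot r' a b := by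
    intro r r' hr hr' a b h
    obtain ⟨l, rfl, rfl, hl⟩ := hT.exists_row hr'
    exact (isSlot_row_of_isExtension hr h).congr fun i hi j hj => (hl i hi j hj).1
  have h1 : ∀ i ∈ Icc 1 e.length, ∀ j ∈ Icc 1 e.length, r i < r j ↔ e.rank r i < e.rank r j :=
    fun i hi j hj => (Signature.rank_lt_rank_iff hi).symm
  have h2 : ∀ i ∈ Icc 1 e.length, ∀ j ∈ Icc 1 e.length, r' i < r' j ↔ e.rank r' i < e.rank r' j :=
    fun i hi j hj => (Signature.rank_lt_rank_iff hi).symm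
  rw [face_congr h1, face_congr h2]
  have hr := hT.isExtension_congr h1 hr
  have hr' := hT.isExtension_congr h2 hr'
  ext x
  exact and_congr_right fun _ => forall₂_congr fun a b => imp_congr_left ⟨key hr hr', key hr' hr⟩

end

/-- A function on the columns which is constant on the labels and weakly increases along arcs. -/
structure LabeledDigraph.IsWeakExtension (D : LabeledDigraph) (y : ℕ → ℝ) : Prop where
  const : ∀ v ∈ D.nodes, ∀ i ∈ v, ∀ j ∈ v, y i = y j
  le : ∀ v w, (v, w) ∈ D.arcs → ∀ i ∈ v, ∀ j ∈ w, y i ≤ y j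

theorem LabeledDigraph.IsExtension.isWeakExtension {D : LabeledDigraph} {y : ℕ → ℝ}
    (h : D.IsExtension y) : D.IsWeakExtension y :=
  ⟨h.const, fun v w hvw i hi j hj => (h.lt v w hvw i hi j hj).le⟩

theorem LabeledDigraph.IsWeakExtension.add {D : LabeledDigraph} {y z : ℕ → ℝ}
    (hy : D.IsWeakExtension y) (hz : D.IsExtension z) {t : ℝ} (ht : 0 < t) :
    D.IsExtension (fun i => y i + t * z i) where
  const v hv i hi j hj := by rw [hy.const v hv i hi j hj, hz.const v hv i hi j hj]
  lt v w hvw i hi j hj :=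
    add_lt_add_of_le_of_lt (hy.le v w hvw i hi j hj) (mul_lt_mul_of_pos_left
      (hz.lt v w hvw i hi j hj) ht)

/-- All values of the linear form `y` on `F` are maximal on the associahedron. -/
def Signature.IsMaxOnSet (e : Signature) (y : ℕ → ℝ) (F : Set (ℕ → ℝ)) : Prop :=
  ∀ x ∈ F, ∀ z, e.IsAssociahedronPoint z →
    ∑ i ∈ Icc 1 e.length, y i * z i ≤ ∑ i ∈ Icc 1 e.length, y i * x i

section

variable {e : Signature} {D : LabeledDigraph} {y : ℕ → ℝ}

/-- It suffices to treat two dots of the node with no other one between. No wall crosses the row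
between them and no dot of the row lies there, so `le_of_isMax_on_face` applies in both directions.
-/
theorem SignedOrdPart.eq_of_isMaxOnSet {l : SignedOrdPart}
    (hy : l.signature.IsMaxOnSet y (l.signature.face l.row)) {k : ℕ} {i j : ℕ}
    (hi : i ∈ l.nodeOf k) (hj : j ∈ l.nodeOf k) : y i = y j := by
  have key : ∀ d i j, i ∈ l.nodeOf k → j ∈ l.nodeOf k → i < j → j - i = d → y i = y j := by
    intro d
    induction d using Nat.strong_induction_on with
    | _ d ih =>
      intro i j hi hj hij hd
      by_cases hc : ∃ c ∈ l.nodeOf k, i < c ∧ c < j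
      · obtain ⟨c, hc, h1, h2⟩ := hc
        exact (ih (c - i) (by omega) i c hi hc h1 rfl).trans
          (ih (j - c) (by omega) c j hc hj h2 rfl)
      · have hrij : l.row i = l.row j := by
          rw [row_eq_of_mem_nodeOf hi, row_eq_of_mem_nodeOf hj]
        have hiI := mem_Icc_of_mem_nodeOf hi
        have hjI := mem_Icc_of_mem_nodeOf hj
        have hji : j ∈ l.nodeOf i := by rwa [nodeOf_eq_of_mem hi]
        have hbet : ∀ c ∈ Icc 1 l.signature.length, i < c → c < j →
            (l.Neg c → l.row c < l.row i) ∧ (¬ l.Neg c → l.row i < l.row c) := by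
          intro c hcI h1 h2
          rw [length_signature, mem_Icc] at hcI
          obtain ⟨-, -, hw⟩ := mem_nodeOf.1 hji
          have hcw := hw c (by omega) (by omega)
          have hne : l.row c ≠ l.row i := by
            intro hr
            refine hc ⟨c, ?_, h1, h2⟩
            rw [← nodeOf_eq_of_mem hi]
            exact mem_nodeOf.2 ⟨hcI, hr, fun c' h3 h4 => hw c' (by omega) (by omega)⟩
          rw [wallAtRow_iff] at hcw
          have hcw := fun h => hcw ⟨hcI, h⟩
          exact ⟨fun hn => lt_of_le_of_ne (not_lt.1 fun h => hcw (Or.inl ⟨hn, h⟩)) hne,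
            fun hn => lt_of_le_of_ne (not_lt.1 fun h => hcw (Or.inr ⟨hn, h⟩)) hne.symm⟩
        rw [← length_signature] at hiI hjI
        refine le_antisymm
          (le_of_isMax_on_face hy hiI hjI hij.ne hrij.le (fun c _ h1 h2 => by omega) ?_)
          (le_of_isMax_on_face hy hjI hiI hij.ne' hrij.ge (fun c _ h1 h2 => by omega) ?_)
        · intro c hcI h1 h2
          rw [← hrij]
          exact hbet c hcI (by omega) (by omega)
        · intro c hcI h1 h2
          rw [← hrij]
          exact hbet c hcI (by omega) (by omega)
  rcases lt_trichotomy i j with h | rfl | h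
  · exact key _ i j hi hj h rfl
  · rfl
  · exact (key _ j i hj hi h rfl).symm

/-- There are no obstructions between `i` and `j` except at the rows of `i` and `j`. -/
theorem SignedOrdPart.Joined.not_separated {l : SignedOrdPart} {i j : ℕ} (h : l.Joined i j) :
    ∀ c ∈ Icc 1 l.size, min i j < c → c < max i j →
      (l.Neg c → l.row c ≤ l.row j) ∧ (¬ l.Neg c → l.row i ≤ l.row c) := by
  obtain ⟨hij, a, b, hs, hi, hj⟩ := h
  obtain ⟨hab, -, -, hno⟩ := hs (l.row j) hij le_rfl
  intro c hcI h1 h2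
  rw [mem_Icc] at hcI
  have key : l.WallAtRow (l.row i) c → l.WallAtRow (l.row j) c → False := by
    intro hwi hwj
    have h3 := hi c hwi
    have h4 := hj c hwj
    have h5 := fun h h' => hno c h h' (wallAtLine_of_wallAtRow hwj)
    have h6 : c ≠ i := fun h => not_wallAtRow_of_row_eq (h ▸ rfl) hwi
    have h7 : c ≠ j := fun h => not_wallAtRow_of_row_eq (h ▸ rfl) hwj
    by_cases h8 : a < c
    · by_cases h9 : c < b
      · exact h5 h8 h9
      · omega
    · omega
  simp only [wallAtRow_iff] at key
  refine ⟨fun hn => ?_, fun hn => ?_⟩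
  · by_contra h
    exact key ⟨hcI, Or.inl ⟨hn, by omega⟩⟩ ⟨hcI, Or.inl ⟨hn, by omega⟩⟩
  · by_contra h
    exact key ⟨hcI, Or.inr ⟨hn, by omega⟩⟩ ⟨hcI, Or.inr ⟨hn, by omega⟩⟩

/-- If no row lies between the rows of `i` and `j`, a linear form maximal on the face of the table
is compared at two dots of these rows. -/
theorem SignedOrdPart.exists_le_of_isMaxOnSet {l : SignedOrdPart}
    (hy : l.signature.IsMaxOnSet y (l.signature.face l.row)) {i j : ℕ} (hi : i ∈ Icc 1 l.size)
    (hj : j ∈ Icc 1 l.size) (hij : l.row i < l.row j)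
    (hadj : ∀ k ∈ Icc 1 l.size, l.row i < l.row k → ¬ l.row k < l.row j)
    (hsep : ∀ c ∈ Icc 1 l.size, min i j < c → c < max i j →
      (l.Neg c → l.row c ≤ l.row j) ∧ (¬ l.Neg c → l.row i ≤ l.row c)) :
    ∃ i' ∈ Icc 1 l.size, ∃ j' ∈ Icc 1 l.size, l.row i' = l.row i ∧ l.row j' = l.row j ∧
      y i' ≤ y j' := by
  induction hd : max i j - min i j using Nat.strong_induction_on generalizing i j with
  | _ d ih =>
    -- Replace one of the dots by a closer one of the same row as long as possible; then the columns
    -- between them avoid both rows and the inequalities become strict.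
    by_cases hc : ∃ c ∈ Icc 1 l.size, min i j < c ∧ c < max i j ∧
        (l.row c = l.row i ∨ l.row c = l.row j)
    · obtain ⟨c, hcI, h1, h2, h | h⟩ := hc
      · obtain ⟨i', hi', j', hj', h3, h4, h5⟩ := ih (max c j - min c j) (by omega) hcI hj
          (h ▸ hij) (h ▸ hadj) (fun c' hc' h3 h4 => by
            rw [h]
            exact hsep c' hc' (by omega) (by omega)) rfl
        exact ⟨i', hi', j', hj', h3.trans h, h4, h5⟩
      · obtain ⟨i', hi', j', hj', h3, h4, h5⟩ := ih (max i c - min i c) (by omega) hi hcI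
          (h ▸ hij) (h ▸ hadj) (fun c' hc' h3 h4 => by
            rw [h]
            exact hsep c' hc' (by omega) (by omega)) rfl
        exact ⟨i', hi', j', hj', h3, h4.trans h, h5⟩
    · refine ⟨i, hi, j, hj, rfl, rfl, ?_⟩
      rw [← length_signature] at hi hj hadj hsep hc
      refine le_of_isMax_on_face hy hi hj (fun h => hij.ne (h ▸ rfl)) hij.le hadj ?_
      intro c hcI h1 h2
      obtain ⟨k1, k2⟩ := hsep c hcI h1 h2
      have h3 : l.row c ≠ l.row i := fun h => hc ⟨c, hcI, h1, h2, Or.inl h⟩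
      have h4 : l.row c ≠ l.row j := fun h => hc ⟨c, hcI, h1, h2, Or.inr h⟩
      have h5 := hadj c hcI
      refine ⟨fun hn => ?_, fun hn => ?_⟩
      · have := k1 hn
        omega
      · have := k2 hn
        omega

open Classical in
/-- Every arc of a tree joins consecutive levels of some extension. -/
theorem IsSchroderCambrianTree.exists_extension_adjacent (hT : IsSchroderCambrianTree e D)
    {v w : Finset ℕ} (h : (v, w) ∈ D.arcs) : ∃ (r : ℕ → ℕ) (R : ℕ), D.IsExtension r ∧
      ∀ i ∈ Icc 1 e.length, (r i = R ↔ i ∈ v) ∧ (r i = R + 1 ↔ i ∈ w) := by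
  obtain ⟨q, hq⟩ := hT.exists_extension
  obtain ⟨hv, hw⟩ := mem_product.1 (hT.arcs_subset h)
  have hvw : (⟨v, hv⟩ : D.Vertex) ≠ ⟨w, hw⟩ := by
    intro h'
    obtain ⟨i, hi⟩ := hT.label_nonempty v hv
    have h' : v = w := congrArg Subtype.val h'
    exact (hq.lt v w h i hi i (h' ▸ hi)).false
  let Up : D.Vertex → Prop := Relation.TransGen (D.Arc 1) ⟨v, hv⟩
  let R := (Icc 1 e.length).sup q + 1
  -- The vertices strictly above `v` other than `w` are lifted above level `R + 1`, and all
  -- remaining ones stay below `R`. The order is respected because no directed path from `v` to `w`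
  -- has an intermediate vertex.
  let level : D.Vertex → ℕ → ℕ := fun u i =>
    if u.1 = v then R else if u.1 = w then R + 1 else if Up u then q i + (R + 2) else q i
  let r : ℕ → ℕ := fun i => if h : ∃ u : D.Vertex, i ∈ u.1 then level h.choose i else 0
  have hr : ∀ (u : D.Vertex) (i : ℕ), i ∈ u.1 → r i = level u i := by
    intro u i hi
    have h : ∃ u : D.Vertex, i ∈ u.1 := ⟨u, hi⟩
    simp only [r, dif_pos h]
    rw [hT.vertex_unique h.choose_spec hi]
  have hR : ∀ i ∈ Icc 1 e.length, q i < R := fun i hi => Nat.lt_succ_of_le (le_sup hi)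
  have hqlt : ∀ {u u' : D.Vertex}, Relation.TransGen (D.Arc 1) u u' → ∀ {i j}, i ∈ u.1 →
      j ∈ u'.1 → q i < q j := by
    intro u u' h
    induction h with
    | single h => exact fun hi hj => hq.lt _ _ (LabeledDigraph.arc_one.1 h) _ hi _ hj
    | @tail b c _ h ih =>
      intro i j hi hj
      obtain ⟨m, hm⟩ := hT.label_nonempty _ b.2
      exact (ih hi hm).trans (hq.lt _ _ (LabeledDigraph.arc_one.1 h) _ hm _ hj)
  have hrr : D.IsExtension (fun i => (q i : ℝ)) :=
    hq.comp (f := fun k : ℕ => (k : ℝ)) Nat.strictMono_cast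
  refine ⟨r, R, ⟨fun u hu i hi j hj => ?_, fun u u' huu i hi j hj => ?_⟩, fun i hi => ?_⟩
  · rw [hr ⟨u, hu⟩ i hi, hr ⟨u, hu⟩ j hj]
    simp only [level, hq.const u hu i hi j hj]
  · obtain ⟨hu, hu'⟩ := mem_product.1 (hT.arcs_subset huu)
    rw [hr ⟨u, hu⟩ i hi, hr ⟨u', hu'⟩ j hj]
    have harc : D.Arc 1 ⟨u, hu⟩ ⟨u', hu'⟩ := LabeledDigraph.arc_one.2 huu
    have hlt := hq.lt u u' huu i hi j hj
    have hRi := hR i (hT.mem_Icc (v := ⟨u, hu⟩) hi)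
    have hup : u = v ∨ Up ⟨u, hu⟩ → Up ⟨u', hu'⟩ := by
      rintro (rfl | h')
      · exact .single harc
      · exact h'.tail harc
    have hne : u' = v → ¬ Up ⟨u, hu⟩ ∧ u ≠ v := by
      rintro rfl
      refine ⟨fun h' => ?_, ?_⟩
      · exact (hqlt (h'.tail harc) hj hj).false
      · rintro rfl
        exact (hq.lt _ _ huu i hi i hi).false
    have hne' : u' = w → ¬ Up ⟨u, hu⟩ := by
      rintro rfl h'
      exact hT.not_transGen_transGen hrr (LabeledDigraph.arc_one.2 h) h' (.single harc)
    have hwup : u = w → u' ≠ v ∧ u' ≠ w ∧ Up ⟨u', hu'⟩ := by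
      rintro rfl
      have h1 : Up ⟨u, hu⟩ := .single (LabeledDigraph.arc_one.2 h)
      refine ⟨fun h' => (hne h').1 h1, ?_, hup (Or.inr h1)⟩
      rintro rfl
      exact (hq.lt _ _ huu i hi i hi).false
    simp only [level]
    by_cases h1 : u = v
    · have h2 : u' ≠ v := fun h' => (hne h').2 h1
      rw [if_pos h1, if_neg h2]
      split_ifs with h3 h4
      · omega
      · omega
      · exact absurd (hup (Or.inl h1)) h4
    · rw [if_neg h1]
      by_cases h2 : u = w
      · obtain ⟨h3, h4, h5⟩ := hwup h2
        rw [if_pos h2, if_neg h3, if_neg h4, if_pos h5]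
        omega
      · rw [if_neg h2]
        by_cases h3 : Up ⟨u, hu⟩
        · rw [if_pos h3, if_neg fun h' => (hne h').1 h3, if_neg fun h' => hne' h' h3,
            if_pos (hup (Or.inr h3))]
          omega
        · rw [if_neg h3]
          split_ifs <;> omega
  · obtain ⟨u, hu⟩ := hT.exists_vertex hi
    have huv : i ∈ v ↔ u.1 = v :=
      ⟨fun h => congrArg Subtype.val (hT.vertex_unique (w := ⟨v, hv⟩) hu h), fun h => h ▸ hu⟩
    have huw : i ∈ w ↔ u.1 = w :=
      ⟨fun h => congrArg Subtype.val (hT.vertex_unique (w := ⟨w, hw⟩) hu h), fun h => h ▸ hu⟩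
    have hvw' : v ≠ w := fun h => hvw (Subtype.ext h)
    have hRi := hR i hi
    rw [hr u i hu, huv, huw]
    simp only [level]
    by_cases h1 : u.1 = v
    · simp [h1, hvw']
    · by_cases h2 : u.1 = w
      · simp [h2, hvw'.symm]
      · simp only [h1, h2, if_false, iff_false]
        split_ifs <;> omega

/-- The linear forms maximal on the face of a tree are the weak extensions of the tree. -/
theorem IsSchroderCambrianTree.isMaxOnSet_face_iff (hT : IsSchroderCambrianTree e D) {z : ℕ → ℝ}
    (hz : D.IsExtension z) : e.IsMaxOnSet y (e.face z) ↔ D.IsWeakExtension y := by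
  constructor
  · intro hy
    have hconst : ∀ v ∈ D.nodes, ∀ i ∈ v, ∀ j ∈ v, y i = y j := by
      obtain ⟨l, rfl, rfl, hl⟩ := hT.exists_row hz
      rw [← face_congr hl] at hy
      intro v hv i hi j hj
      obtain ⟨k, hk, rfl⟩ := mem_nodes.1 hv
      exact eq_of_isMaxOnSet hy hi hj
    refine ⟨hconst, fun v w hvw i hi j hj => ?_⟩
    -- The face does not depend on the extension, so choose one in which `v` and `w` occupy two
    -- consecutive levels by themselves; any comparison between these levels is then the desired
    -- one.
    obtain ⟨r, R, hr, hR⟩ := hT.exists_extension_adjacent hvw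
    rw [hT.face_eq hz hr] at hy
    obtain ⟨l, rfl, rfl, hl⟩ := hT.exists_row hr
    rw [← face_congr hl] at hy
    obtain ⟨hv, hw⟩ := mem_product.1 (hT.arcs_subset hvw)
    obtain ⟨i₀, hi₀, j₀, hj₀, hJ, rfl, rfl⟩ := mem_arcs.1 hvw
    have hlen := length_signature l
    rw [hlen] at hl hR
    have hRi := (hR i₀ hi₀).1.2 (mem_nodeOf_self hi₀)
    have hRj := (hR j₀ hj₀).2.2 (mem_nodeOf_self hj₀)
    have heq : ∀ a ∈ Icc 1 l.size, ∀ b ∈ Icc 1 l.size, l.row a = l.row b → r a = r b := by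
      intro a ha b hb h
      have h1 := (hl a ha b hb).not.1 h.not_lt
      have h2 := (hl b hb a ha).not.1 h.not_gt
      omega
    obtain ⟨i', hi', j', hj', h1, h2, h3⟩ := exists_le_of_isMaxOnSet hy hi₀ hj₀ hJ.1
      (fun k hk h1 h2 => by
        rw [hl i₀ hi₀ k hk] at h1
        rw [hl k hk j₀ hj₀] at h2
        omega) hJ.not_separated
    have hi'v := (hR i' hi').1.1 ((heq i' hi' i₀ hi₀ h1).trans hRi)
    have hj'w := (hR j' hj').2.1 ((heq j' hj' j₀ hj₀ h2).trans hRj)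
    rw [hconst _ hv i hi i' hi'v, hconst _ hw j hj j' hj'w]
    exact h3
  · intro hy x hx p hp
    -- A weak extension plus a positive multiple of a strict one is strict, so it defines the same
    -- face; letting `t` be small gives the claim for `y`.
    have key : ∀ t : ℝ, 0 < t → ∑ i ∈ Icc 1 e.length, (y i + t * z i) * p i ≤
        ∑ i ∈ Icc 1 e.length, (y i + t * z i) * x i := by
      intro t ht
      rw [hT.face_eq hz (hy.add hz ht)] at hx
      exact (sum_mul_le_of_mem_face hx hp).1
    have hlin : ∀ (t : ℝ) (p : ℕ → ℝ), ∑ i ∈ Icc 1 e.length, (y i + t * z i) * p i =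
        ∑ i ∈ Icc 1 e.length, y i * p i + t * ∑ i ∈ Icc 1 e.length, z i * p i := by
      intro t p
      rw [mul_sum, ← sum_add_distrib]
      exact sum_congr rfl fun i _ => by ring
    simp only [hlin] at key
    by_contra hn
    rw [not_le] at hn
    have h0 := (sum_mul_le_of_mem_face hx hp).1
    set A := ∑ i ∈ Icc 1 e.length, z i * x i - ∑ i ∈ Icc 1 e.length, z i * p i with hA
    set B := ∑ i ∈ Icc 1 e.length, y i * p i - ∑ i ∈ Icc 1 e.length, y i * x i with hB
    have hA0 : 0 ≤ A := sub_nonneg.2 h0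
    have hB0 : 0 < B := sub_pos.2 hn
    -- A value of `t` small enough that `t * A < B`; adding 1 to `A` avoids division by zero.
    have h1 := key (B / (A + 1)) (by positivity)
    have h2 : B / (A + 1) * A < B := by
      rw [div_mul_eq_mul_div, div_lt_iff₀ (by positivity)]
      nlinarith
    have h3 : B ≤ B / (A + 1) * A := by
      rw [hA, mul_sub]
      linarith
    linarith

end

end SchroderCambrian
namespace SchroderCambrian
open Finset
open SignedOrdPart Signature

/-! ### The faces of the associahedron -/

/-- The restriction to `{1, …, n}`. -/
def restrict (n : ℕ) (x : ℕ → ℝ) : Fin n → ℝ := fun k => x (k + 1)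

theorem exists_restrict_eq {n : ℕ} (x : Fin n → ℝ) : ∃ y, restrict n y = x :=
  ⟨fun i => if h : i - 1 < n then x ⟨i - 1, h⟩ else 0, funext fun k => by simp [restrict]⟩

theorem sum_fin_succ_eq (n : ℕ) (f : ℕ → ℝ) : ∑ k : Fin n, f (k + 1) = ∑ i ∈ Icc 1 n, f i := by
  rw [Fin.sum_univ_eq_sum_range fun k => f (k + 1), range_eq_Ico, sum_Ico_add' f 0 n 1, zero_add]
  rfl

variable {e : Signature}

theorem restrict_mem_associahedron_iff {x : ℕ → ℝ} :
    restrict e.length x ∈ associahedron e ↔ e.IsAssociahedronPoint x := by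
  have h1 : ∑ k, restrict e.length x k = ∑ i ∈ Icc 1 e.length, x i := sum_fin_succ_eq _ _
  have h2 : ∀ a b, ∑ k ∈ univ.filter (fun k : Fin e.length => k.val + 1 ∈ belowDiagonal e a b),
      restrict e.length x k = ∑ i ∈ belowDiagonal e a b, x i := by
    intro a b
    rw [sum_filter]
    refine (sum_fin_succ_eq e.length fun i => if i ∈ belowDiagonal e a b then x i else 0).trans ?_
    rw [← sum_filter, filter_mem_eq_inter, inter_eq_right.2 (show belowDiagonal e a b ⊆ _ from filter_subset _ _)]
  constructor
  · rintro ⟨h, h'⟩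
    refine ⟨?_, fun a b hab hb => ?_⟩
    · rw [defect, ← h1, h, triangular, sub_self]
    · have := h' a b hab hb
      rw [h2] at this
      exact sub_nonneg.2 this
  · rintro ⟨h, h'⟩
    refine ⟨?_, fun a b hab hb => ?_⟩
    · rw [h1]
      exact sub_eq_zero.1 h
    · rw [h2]
      exact sub_nonneg.1 (h' a b hab hb)

/-- The face of the associahedron where the linear form `y` is maximal. -/
def maxFace (e : Signature) (y : Fin e.length → ℝ) : Set (Fin e.length → ℝ) :=
  {x | x ∈ associahedron e ∧ ∀ z ∈ associahedron e, ∑ i, y i * z i ≤ ∑ i, y i * x i}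

theorem restrict_mem_maxFace_iff {y x : ℕ → ℝ} :
    restrict e.length x ∈ maxFace e (restrict e.length y) ↔ x ∈ e.face y := by
  rw [mem_face_iff_isMax]
  refine and_congr restrict_mem_associahedron_iff ⟨fun h z hz => ?_, fun h z hz => ?_⟩
  · have := h _ (restrict_mem_associahedron_iff.2 hz)
    rwa [← sum_fin_succ_eq, ← sum_fin_succ_eq]
  · obtain ⟨z, rfl⟩ := exists_restrict_eq z
    have := h z (restrict_mem_associahedron_iff.1 hz)
    rwa [← sum_fin_succ_eq, ← sum_fin_succ_eq] at this

theorem maxFace_congr {y y' : ℕ → ℝ} (h : e.face y = e.face y') :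
    maxFace e (restrict e.length y) = maxFace e (restrict e.length y') := by
  ext x
  obtain ⟨x, rfl⟩ := exists_restrict_eq x
  rw [restrict_mem_maxFace_iff, restrict_mem_maxFace_iff, h]

theorem maxFace_nonempty (y : Fin e.length → ℝ) : (maxFace e y).Nonempty := by
  obtain ⟨y, rfl⟩ := exists_restrict_eq y
  obtain ⟨x, hx⟩ := e.face_nonempty y
  exact ⟨_, restrict_mem_maxFace_iff.2 hx⟩

theorem isExposed_maxFace (y : Fin e.length → ℝ) : IsExposed ℝ (associahedron e) (maxFace e y) := by
  intro _
  refine ⟨∑ i, y i • ContinuousLinearMap.proj i, ?_⟩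
  simp [maxFace]

/-- An exposed face maximizes a continuous linear form, which is given by its values on the standard
basis. -/
theorem exists_eq_maxFace {G : Set (Fin e.length → ℝ)} (hG : G.Nonempty)
    (h : IsExposed ℝ (associahedron e) G) : ∃ y, G = maxFace e y := by
  obtain ⟨f, rfl⟩ := h hG
  refine ⟨fun i => f (Pi.single i 1), ?_⟩
  have hf : ∀ x, f x = ∑ i, f (Pi.single i 1) * x i := by
    intro x
    conv_lhs => rw [← univ_sum_single x, map_sum]
    refine sum_congr rfl fun i _ => ?_
    rw [mul_comm, ← smul_eq_mul, ← map_smul, ← Pi.single_smul, smul_eq_mul, mul_one]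
  simp only [maxFace, ← hf]

theorem mem_braidCone_iff {T : SchroderCambrianTree e} {y : ℕ → ℝ} :
    restrict e.length y ∈ braidCone T ↔
      ∑ i ∈ Icc 1 e.length, y i = 0 ∧ T.1.IsWeakExtension y := by
  refine and_congr (by rw [← sum_fin_succ_eq]; rfl) ?_
  have hT := T.2
  have hfin : ∀ {v}, v ∈ T.1.nodes → ∀ {i}, i ∈ v → ∃ k : Fin e.length, (k : ℕ) + 1 = i := by
    intro v hv i hi
    have := Finset.mem_Icc.1 (hT.mem_Icc (v := ⟨v, hv⟩) hi)
    exact ⟨⟨i - 1, by omega⟩, by simp only; omega⟩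
  constructor
  · intro h
    have key : ∀ v ∈ T.1.nodes, ∀ w ∈ T.1.nodes, ∀ i ∈ v, ∀ j ∈ w,
        Relation.ReflTransGen (fun v w => (v, w) ∈ T.1.arcs) v w → y i ≤ y j := by
      intro v hv w hw i hi j hj hvw
      obtain ⟨i, rfl⟩ := hfin hv hi
      obtain ⟨j, rfl⟩ := hfin hw hj
      exact h i j v hv w hw hi hj hvw
    refine ⟨fun v hv i hi j hj => ?_, fun v w hvw i hi j hj => ?_⟩
    · exact le_antisymm (key v hv v hv i hi j hj .refl) (key v hv v hv j hj i hi .refl)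
    · obtain ⟨hv, hw⟩ := mem_product.1 (hT.arcs_subset hvw)
      exact key v hv w hw i hi j hj (.single hvw)
  · intro h i j v hv w hw hi hj hvw
    change y (i + 1) ≤ y (j + 1)
    generalize (i : ℕ) + 1 = i at hi
    generalize (j : ℕ) + 1 = j at hj
    induction hvw generalizing j with
    | refl => exact (h.const v hv i hi j hj).le
    | @tail u w _ huw ih =>
      obtain ⟨hu, -⟩ := mem_product.1 (hT.arcs_subset huw)
      obtain ⟨m, hm⟩ := hT.label_nonempty u hu
      exact (ih hu m hm).trans (h.le u w huw m hm j hj)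

theorem mem_normalCone_maxFace_iff {y z : ℕ → ℝ} :
    restrict e.length y ∈ normalCone (associahedron e) (maxFace e (restrict e.length z)) ↔
      ∑ i ∈ Icc 1 e.length, y i = 0 ∧ e.IsMaxOnSet y (e.face z) := by
  refine and_congr (by rw [← sum_fin_succ_eq]; rfl) ⟨fun h x hx p hp => ?_, fun h x hx p hp => ?_⟩
  · have := h _ (restrict_mem_maxFace_iff.2 hx) _ (restrict_mem_associahedron_iff.2 hp)
    rwa [← sum_fin_succ_eq, ← sum_fin_succ_eq]
  · obtain ⟨x, rfl⟩ := exists_restrict_eq x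
    obtain ⟨p, rfl⟩ := exists_restrict_eq p
    have := h x (restrict_mem_maxFace_iff.1 hx) p (restrict_mem_associahedron_iff.1 hp)
    rwa [← sum_fin_succ_eq, ← sum_fin_succ_eq] at this

theorem normalCone_maxFace {T : SchroderCambrianTree e} {z : ℕ → ℝ} (hz : T.1.IsExtension z) :
    normalCone (associahedron e) (maxFace e (restrict e.length z)) = braidCone T := by
  ext y
  obtain ⟨y, rfl⟩ := exists_restrict_eq y
  rw [mem_normalCone_maxFace_iff, mem_braidCone_iff, T.2.isMaxOnSet_face_iff hz]

/-! ### The bijection between trees and faces -/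

namespace SchroderCambrianTree

theorem exists_centered_extension (T : SchroderCambrianTree e) :
    ∃ z : ℕ → ℝ, T.1.IsExtension z ∧ ∑ i ∈ Icc 1 e.length, z i = 0 := by
  obtain ⟨r, hr⟩ := T.2.exists_extension
  let c : ℝ := (∑ i ∈ Icc 1 e.length, (r i : ℝ)) / e.length
  refine ⟨fun i => (r i : ℝ) - c, hr.comp (f := fun k : ℕ => (k : ℝ) - c)
    fun a b hab => by simpa using hab, ?_⟩
  rw [sum_sub_distrib, sum_const, Nat.card_Icc, Nat.add_sub_cancel, nsmul_eq_mul]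
  rcases Nat.eq_zero_or_pos e.length with h | h
  · simp [h]
  · rw [mul_div_cancel₀, sub_self]
    exact_mod_cast h.ne'

/-- A linear form inducing the order of the tree. -/
noncomputable def form (T : SchroderCambrianTree e) : ℕ → ℝ := T.exists_centered_extension.choose

theorem isExtension_form (T : SchroderCambrianTree e) : T.1.IsExtension T.form :=
  T.exists_centered_extension.choose_spec.1

theorem sum_form (T : SchroderCambrianTree e) : ∑ i ∈ Icc 1 e.length, T.form i = 0 :=
  T.exists_centered_extension.choose_spec.2

/-- The face of the associahedron attached to a tree. -/
noncomputable def toFace (T : SchroderCambrianTree e) : AssociahedronFace e :=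
  ⟨maxFace e (restrict e.length T.form), maxFace_nonempty _, isExposed_maxFace _⟩

theorem normalCone_toFace (T : SchroderCambrianTree e) :
    normalCone (associahedron e) T.toFace.1 = braidCone T := normalCone_maxFace T.isExtension_form

/-- Equal faces have equal normal cones, so each form weakly extends the other tree. The sum of the
two forms is then a strict extension of both trees, and `eq_of_common_extension` concludes. -/
theorem toFace_injective : Function.Injective (toFace (e := e)) := by
  intro T T' h
  have hcone : braidCone T = braidCone T' := by
    rw [← normalCone_toFace, ← normalCone_toFace, h]
  have h1 : T'.1.IsWeakExtension T.form := (mem_braidCone_iff.1 (hcone ▸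
    mem_braidCone_iff.2 ⟨T.sum_form, T.isExtension_form.isWeakExtension⟩)).2
  have h2 : T.1.IsWeakExtension T'.form := (mem_braidCone_iff.1 (hcone.symm ▸
    mem_braidCone_iff.2 ⟨T'.sum_form, T'.isExtension_form.isWeakExtension⟩)).2
  have h3 := h1.add T'.isExtension_form one_pos
  have h4 := h2.add T.isExtension_form one_pos
  refine Subtype.ext (eq_of_common_extension T.2 h4 T'.2 ?_)
  simpa only [one_mul, add_comm] using h3

/-- A face is the set of maxima of some `y`. The table whose rows are ordered like `y` has a
P-symbol extended by `y`, so its form and `y` define the same face. -/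
theorem toFace_surjective : Function.Surjective (toFace (e := e)) := by
  rintro ⟨G, hG, h⟩
  obtain ⟨y, rfl⟩ := exists_eq_maxFace hG h
  obtain ⟨y, rfl⟩ := exists_restrict_eq y
  obtain ⟨l, rfl, hl⟩ : ∃ l : SignedOrdPart, l.signature = e ∧
      ∀ i ∈ Icc 1 e.length, ∀ j ∈ Icc 1 e.length, l.row i < l.row j ↔ y i < y j :=
    ⟨ofRow e (e.rank y), signature_ofRow _ _, fun i hi j hj => by
      rw [row_ofRow_lt_iff hi hj, Signature.rank_lt_rank_iff hi]⟩
  refine ⟨l.tree, Subtype.ext (maxFace_congr ?_)⟩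
  exact l.tree.2.face_eq l.tree.isExtension_form
    (l.tree.2.isExtension_congr hl (isExtension_pSymbol l))

end SchroderCambrianTree

end SchroderCambrian
theorem mainTheorem12 (K : Type*) [Field K] :
    SchroderCambrian.IsHopfSubalgebra (SchroderCambrian.SchrCamb K) ∧
    (∀ l : SchroderCambrian.SignedOrdPart,
      SchroderCambrian.IsSchroderCambrianTree l.signature l.pSymbol) ∧
    (∃ b : Module.Basis (Σ e : SchroderCambrian.Signature, SchroderCambrian.SchroderCambrianTree e)
        K (SchroderCambrian.SchrCamb K),
      ∀ e T, (b ⟨e, T⟩ : SchroderCambrian.OrdPart K) = SchroderCambrian.PCamb K e T) ∧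
    (∀ e : SchroderCambrian.Signature,
      ∃ f : SchroderCambrian.SchroderCambrianTree e ≃ SchroderCambrian.AssociahedronFace e,
        ∀ T, SchroderCambrian.normalCone (SchroderCambrian.associahedron e) (f T).1 =
          SchroderCambrian.braidCone T) :=
  ⟨SchroderCambrian.isHopfSubalgebra_SchrCamb K,
    SchroderCambrian.SignedOrdPart.isSchroderCambrianTree_pSymbol,
    SchroderCambrian.exists_basis_SchrCamb K,
    fun _ => ⟨Equiv.ofBijective SchroderCambrian.SchroderCambrianTree.toFace
      ⟨SchroderCambrian.SchroderCambrianTree.toFace_injective,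
        SchroderCambrian.SchroderCambrianTree.toFace_surjective⟩,
      SchroderCambrian.SchroderCambrianTree.normalCone_toFace⟩⟩
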